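/- Let $n\ge 1$, let $\Omega\subset\mathbb R^n$ be a nonempty open set, and let $d\gamma(x)=(2\pi)^{-n/2}e^{-|x|^2/2}\,dx$, with $\gamma(\Omega)<1$. Let $0<s<1$, $a=1-2s$, $\mathcal C_\Omega=\Omega\times(0,\infty)$ and $c_s=\dfrac{\Gamma(1-s)}{4^{s-1/2}\Gamma(s)}$. All functions are real valued. $H^1_0(\Omega,\gamma)$ is the closure of $C_c^\infty(\Omega)$ in the norm $\big(\int_\Omega(u^2+|\nabla u|^2)\,d\gamma\big)^{1/2}$. A Dirichlet eigensystem of $\mathcal L=-\Delta+x\cdot\nabla$ in $\Omega$ is a sequence $0<\lambda_1\le\lambda_2\le\cdots\nearrow\infty$ together with an orthonormal basis $(\psi_k)_{k\ge1}$ of $L^2(\Omega,\gamma)$ such that $\psi_k\in H^1_0(\Omega,\gamma)$ and $\int_\Omega\nabla\psi_k\cdot\nabla\zeta\,d\gamma=\lambda_k\int_\Omega\psi_k\zeta\,d\gamma$ for all $\zeta\in C_c^\infty(\Omega)$. Put $$\mathcal H^s(\Omega,\gamma)=\Big\{u\in L^2(\Omega,\gamma):\ \sum_{k\ge1}\lambda_k^s\langle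 u,\psi_k\rangle^2<\infty\Big\},\qquad \mathcal L^{s/2}u=\sum_{k\ge1}\lambda_k^{s/2}\langle u,\psi_k\rangle\psi_k ,$$ and, for $y>0$, with $\mathcal K_s$ the modified Bessel function of the second kind of order $s$, $$\mathcal P^s_yu=\frac{2^{1-s}}{\Gamma(s)}\sum_{k\ge1}(\lambda_k^{1/2}y)^s\mathcal K_s(\lambda_k^{1/2}y)\langle u,\psi_k\rangle\psi_k .$$ $H^1_{0,L}(\mathcal C_\Omega,d\gamma\otimes y^ady)$ is the space of all $v\in H^1_{\mathrm{loc}}(\mathcal C_\Omega)$ with $\iint_{\mathcal C_\Omega}y^a(v^2+|\nabla_{x,y}v|^2)\,d\gamma\,dy<\infty$ that vanish on $\partial\Omega\times[0,\infty)$ in the sense that $v(\cdot,y)\in H_0^1(\Omega,\gamma)$ for a.e. $y>0$. The trace $\operatorname{tr}_\Omega v=v(\cdot,0)$ is the (essential) limit of $v(\cdot,y)$ in $L^2(\Omega,\gamma)$ as $y\to0^+$. Then a Dirichlet eigensystem exists, every $v\in H^1_{0,L}(\mathcal C_\Omega,d\gamma\otimes y^ady)$ has a unique trace in $L^2(\Omega,\gamma)$,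 and for every Dirichlet eigensystem: 1. $\operatorname{tr}_\Omega\big(H^1_{0,L}(\mathcal C_\Omega,d\gamma\otimes y^ady)\big)=\mathcal H^s(\Omega,\gamma)$. 2. For all $v\in H^1_{0,L}(\mathcal C_\Omega,d\gamma\otimes y^ady)$, $$\|\mathcal L^{s/2}v(\cdot,0)\|_{L^2(\Omega,\gamma)}^2\le c_s^{-1}\iint_{\mathcal C_\Omega}y^a|\nabla_{x,y}v|^2\,d\gamma(x)\,dy .$$ 3. For every $u\in\mathcal H^s(\Omega,\gamma)$ the function $(x,y)\mapsto\mathcal P^s_yu(x)$ belongs to $H^1_{0,L}(\mathcal C_\Omega,d\gamma\otimes y^ady)$ and has trace $u$; and equality holds in 2 whenever $v(\cdot,y)=\mathcal P_y^s(\operatorname{tr}_\Omega v)$ for a.e. $y>0$. -/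

import Mathlib

open MeasureTheory Set Filter Topology
open scoped ENNReal ContDiff RealInnerProductSpace

noncomputable section

namespace OUTrace

/-- `ℝⁿ` with its Euclidean norm. -/
abbrev E (n : ℕ) : Type := EuclideanSpace ℝ (Fin n)

/-- The Gaussian measure `dγ = (2π)^{-n/2} exp(-|x|²/2) dx` on `ℝⁿ`. -/
def gauss (n : ℕ) : Measure (E n) :=
  volume.withDensity fun x =>
    ENNReal.ofReal ((2 * Real.pi) ^ (-(n : ℝ) / 2) * Real.exp (-‖x‖ ^ 2 / 2))

/-- The real Hilbert space `L²(Ω, γ)`. -/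
abbrev L2 {n : ℕ} (Ω : Set (E n)) : Type := Lp ℝ 2 ((gauss n).restrict Ω)

/-- `C_c^∞(U)`. -/
structure IsTestFun {F : Type*} [NormedAddCommGroup F] [NormedSpace ℝ F]
    (U : Set F) (ζ : F → ℝ) : Prop where
  smooth : ContDiff ℝ ∞ ζ
  compact : HasCompactSupport ζ
  support : tsupport ζ ⊆ U

/-- `u ∈ H¹₀(Ω, γ)` with gradient `G`: the pair `(u, G)` is the limit in `L²(Ω, γ)` of pairs
`(ζ, ∇ζ)` with `ζ ∈ C_c^∞(Ω)`. -/
def HasH10Gradient {n : ℕ} (Ω : Set (E n)) (u : E n → ℝ) (G : E n → E n) : Prop :=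
  MemLp u 2 ((gauss n).restrict Ω) ∧ MemLp G 2 ((gauss n).restrict Ω) ∧
    ∃ ζ : ℕ → E n → ℝ, (∀ j, IsTestFun Ω (ζ j)) ∧
      Tendsto (fun j => eLpNorm (fun x => ζ j x - u x) 2 ((gauss n).restrict Ω)) atTop (𝓝 0) ∧
      Tendsto (fun j => eLpNorm (fun x => gradient (ζ j) x - G x) 2 ((gauss n).restrict Ω))
        atTop (𝓝 0)

/-- `u ∈ H¹₀(Ω, γ)`: the closure of `C_c^∞(Ω)` in the norm of `H¹(Ω, γ)`. -/
def MemH10 {n : ℕ} (Ω : Set (E n)) (u : E n → ℝ) : Prop :=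
  ∃ G, HasH10Gradient Ω u G

/-- `ψ ∈ H¹₀(Ω, γ)` is a weak solution of `-div(φ∇ψ) = lam φ ψ` in `Ω`, `ψ = 0` on `∂Ω`,
where `φ` is the Gaussian density. -/
def IsWeakDirichletSolution {n : ℕ} (Ω : Set (E n)) (lam : ℝ) (ψ : E n → ℝ) : Prop :=
  ∃ G, HasH10Gradient Ω ψ G ∧ ∀ ζ : E n → ℝ, IsTestFun Ω ζ →
    ∫ x in Ω, ⟪G x, gradient ζ x⟫ ∂(gauss n) = lam * ∫ x in Ω, ψ x * ζ x ∂(gauss n)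

/-- `(lam k, ψ k)` is the sequence of Dirichlet eigenvalues
`0 < lam 0 ≤ lam 1 ≤ ⋯ ↗ ∞` of `𝓛 = -Δ + x·∇` in `Ω`, with a corresponding orthonormal basis
of `L²(Ω, γ)` of eigenfunctions. -/
structure IsDirichletEigenSystem {n : ℕ} (Ω : Set (E n))
    (lam : ℕ → ℝ) (ψ : HilbertBasis ℕ ℝ (L2 Ω)) : Prop where
  pos : ∀ k, 0 < lam k
  mono : Monotone lam
  tendsto : Tendsto lam atTop atTop
  eigen : ∀ k, IsWeakDirichletSolution Ω (lam k) (ψ k)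

/-- `𝓗^s(Ω, γ)`, the set of `u ∈ L²(Ω, γ)` with `∑ lam_k^s |⟨u, ψ_k⟩|² < ∞`. -/
def fracSpace {n : ℕ} {Ω : Set (E n)} (lam : ℕ → ℝ) (ψ : HilbertBasis ℕ ℝ (L2 Ω))
    (s : ℝ) : Set (L2 Ω) :=
  {u | Summable fun k => lam k ^ s * ⟪u, ψ k⟫ ^ 2}

/-- `𝓛^{s/2} u = ∑ lam_k^{s/2} ⟨u, ψ_k⟩ ψ_k`; the series converges in `L²(Ω, γ)` exactly when
`u ∈ 𝓗^s(Ω, γ)`. -/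
def fracHalfPow {n : ℕ} {Ω : Set (E n)} (lam : ℕ → ℝ) (ψ : HilbertBasis ℕ ℝ (L2 Ω))
    (s : ℝ) (u : L2 Ω) : L2 Ω :=
  ∑' k, (lam k ^ (s / 2) * ⟪u, ψ k⟫) • ψ k

/-- The cylinder `𝒞_Ω = Ω × (0, ∞)`. -/
def cyl {n : ℕ} (Ω : Set (E n)) : Set (E n × ℝ) := Ω ×ˢ Ioi 0

/-- The measure `dγ(x) ⊗ y^a dy` on `𝒞_Ω`. -/
def cylMeasure {n : ℕ} (Ω : Set (E n)) (a : ℝ) : Measure (E n × ℝ) :=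
  ((gauss n).restrict Ω).prod
    ((volume.restrict (Ioi (0 : ℝ))).withDensity fun y => ENNReal.ofReal (y ^ a))

/-- `v ∈ H¹_loc(𝒞_Ω)` with weak derivatives `∇_x v = G` and `∂_y v = g`. -/
structure HasWeakGradient {n : ℕ} (Ω : Set (E n)) (v : E n × ℝ → ℝ)
    (G : E n × ℝ → E n) (g : E n × ℝ → ℝ) : Prop where
  locL2 : ∀ K ⊆ cyl Ω, IsCompact K →
    MemLp v 2 (volume.restrict K) ∧ MemLp G 2 (volume.restrict K) ∧
      MemLp g 2 (volume.restrict K)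
  weak_x : ∀ η : E n × ℝ → ℝ, IsTestFun (cyl Ω) η → ∀ e : E n,
    ∫ p in cyl Ω, v p * fderiv ℝ η p (e, 0) = -∫ p in cyl Ω, ⟪G p, e⟫ * η p
  weak_y : ∀ η : E n × ℝ → ℝ, IsTestFun (cyl Ω) η →
    ∫ p in cyl Ω, v p * fderiv ℝ η p (0, 1) = -∫ p in cyl Ω, g p * η p

/-- `v ∈ H¹_{0,L}(𝒞_Ω, dγ ⊗ y^a dy)`, with `∇_x v = G` and `∂_y v = g`: the function `v` lies in
`H¹_loc(𝒞_Ω)`, `v`, `∇_x v`, `∂_y v` are square integrable for `dγ ⊗ y^a dy`, and `v` vanishes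
on the lateral boundary, that is, `v(·, y) ∈ H¹₀(Ω, γ)` for almost every `y > 0`. -/
structure HasEnergyGradient {n : ℕ} (Ω : Set (E n)) (a : ℝ) (v : E n × ℝ → ℝ)
    (G : E n × ℝ → E n) (g : E n × ℝ → ℝ) : Prop where
  weak : HasWeakGradient Ω v G g
  memLp : MemLp v 2 (cylMeasure Ω a)
  memLp_x : MemLp G 2 (cylMeasure Ω a)
  memLp_y : MemLp g 2 (cylMeasure Ω a)
  lateral : ∀ᵐ y ∂(volume.restrict (Ioi (0 : ℝ))), MemH10 Ω fun x => v (x, y)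

/-- `v ∈ H¹_{0,L}(𝒞_Ω, dγ ⊗ y^a dy)`. -/
def MemEnergySpace {n : ℕ} (Ω : Set (E n)) (a : ℝ) (v : E n × ℝ → ℝ) : Prop :=
  ∃ G g, HasEnergyGradient Ω a v G g

/-- `∬ y^a |∇_{x,y} v|² dγ(x) dy` for a function `v` with `∇_x v = G` and `∂_y v = g`. -/
def energy {n : ℕ} (Ω : Set (E n)) (a : ℝ) (G : E n × ℝ → E n) (g : E n × ℝ → ℝ) : ℝ :=
  ∫ p, (‖G p‖ ^ 2 + g p ^ 2) ∂(cylMeasure Ω a)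

/-- `u = tr_Ω v = v(·, 0)`: `v(·, y) → u` in `L²(Ω, γ)` as `y → 0⁺`. As `v` is only determined
almost everywhere, this is the essential limit: a null set of `y` is disregarded. -/
def IsTrace {n : ℕ} {Ω : Set (E n)} (v : E n × ℝ → ℝ) (u : L2 Ω) : Prop :=
  Tendsto (fun y : ℝ => eLpNorm (fun x => v (x, y) - u x) 2 ((gauss n).restrict Ω))
    (ae volume ⊓ 𝓝[>] (0 : ℝ)) (𝓝 0)

/-- The range of the trace operator on `H¹_{0,L}(𝒞_Ω, dγ ⊗ y^a dy)`. -/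
def traceRange {n : ℕ} (Ω : Set (E n)) (a : ℝ) : Set (L2 Ω) :=
  {u | ∃ v, MemEnergySpace Ω a v ∧ IsTrace v u}

/-- The modified Bessel function of the second kind `K_ν(z)`, for `z > 0`, through
`K_ν(z) = ∫₀^∞ exp(-z cosh t) cosh(ν t) dt`. -/
def besselK (ν z : ℝ) : ℝ :=
  ∫ t in Ioi (0 : ℝ), Real.exp (-z * Real.cosh t) * Real.cosh (ν * t)

/-- The extension `𝒫_y^s u ∈ L²(Ω, γ)`, for `y > 0`:
`(2^{1-s}/Γ(s)) ∑ (lam_k^{1/2} y)^s K_s(lam_k^{1/2} y) ⟨u, ψ_k⟩ ψ_k`. -/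
def besselExt {n : ℕ} {Ω : Set (E n)} (lam : ℕ → ℝ) (ψ : HilbertBasis ℕ ℝ (L2 Ω))
    (s : ℝ) (u : L2 Ω) (y : ℝ) : L2 Ω :=
  (2 ^ (1 - s) / Real.Gamma s) •
    ∑' k, ((Real.sqrt (lam k) * y) ^ s * besselK s (Real.sqrt (lam k) * y) * ⟪u, ψ k⟫) • ψ k

/-- `v(x, y) = 𝒫_y^s u(x)` for almost every `(x, y)` in the cylinder. -/
def IsBesselExt {n : ℕ} {Ω : Set (E n)} (lam : ℕ → ℝ) (ψ : HilbertBasis ℕ ℝ (L2 Ω))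
    (s : ℝ) (v : E n × ℝ → ℝ) (u : L2 Ω) : Prop :=
  ∀ᵐ y ∂(volume.restrict (Ioi (0 : ℝ))),
    (fun x => v (x, y)) =ᵐ[(gauss n).restrict Ω] besselExt lam ψ s u y

/-- `c_s = Γ(1-s) / (4^{s-1/2} Γ(s))`. -/
def traceConst (s : ℝ) : ℝ :=
  Real.Gamma (1 - s) / (4 ^ (s - 1 / 2) * Real.Gamma s)

end OUTrace

end

/-!
Everything is reduced to one dimension by expanding the slices `v(·, y)` in the eigenfunctions.

*Eigenfunctions.* Let `ι` be the embedding of `H¹₀(Ω, γ)` into `L²(Ω, γ)`. The law of a pair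
`(X, Y)` of independent Gaussian vectors is invariant under rotations, so the mean square of
`ζ(X cos θ + Y sin θ) - ζ(X)` is at most a constant times `θ² ‖∇ζ‖²` (`lintegral_rotation_sub_le`).
For small `θ` this says that the Mehler operators `ζ ↦ E ζ(cos θ x + sin θ Y)`, which have a square
integrable kernel and so are compact, converge to the identity as maps from `H¹₀` to `L²`; hence
`ι` is compact (`isCompactOperator_embed`). For `θ = π / 2` it is the Poincaré inequality, as
`ζ(Y) = 0` with probability at least `γ(Ωᶜ) > 0` (`exists_poincare`). The spectral theorem for the
compact operator `ι ι†` gives the eigensystem (`exists_eigenSystem`).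

*The profile.* For an eigenvalue `lam`, the function
`θ(y) = (2^{1-s}/Γ(s)) (lam^{1/2} y)^s K_s(lam^{1/2} y)` satisfies `θ(0) = 1` and
`(y^a θ')' = lam y^a θ`, and `-y^a θ'` tends to `c_s lam^s` at zero and to zero at infinity. These
facts come from the integral representation of `K_s`, written as a function that is continuous up
to zero (`besselProfile`). Integrating by parts, `∫ y^a (lam f θ + f' θ') dy = c_s lam^s f(0)` for
every `f` of finite weighted energy (`integral_profile_pairing`), so that the energy of
`f - f(0) θ` is the energy of `f` minus `c_s lam^s f(0)²`. This is the sharp inequality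
`c_s lam^s f(0)² ≤ ∫ y^a (lam f² + f'²) dy`, with equality for `f = θ`
(`halfLine_trace_inequality`, `energy_extProfile`).

*The trace.* For `v` of finite energy, `f_k(y) = ⟨v(·, y), ψ_k⟩` has the weak derivative
`⟨∂_y v(·, y), ψ_k⟩`, and `∇_x v(·, y)` is the gradient of `v(·, y)` in `H¹₀(Ω, γ)` for almost every
`y` (`HasEnergyGradient.ae_hasH10Gradient`), so that Bessel's inequality for the orthogonal family
`∇ψ_k` bounds `∑_k ∫ y^a (lam_k f_k² + f_k'²) dy` by the energy of `v`. Summing the one-dimensional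
inequalities shows that the trace `∑ f_k(0) ψ_k` lies in `𝓗^s(Ω, γ)` and satisfies the trace
inequality (`HasEnergyGradient.exists_trace`).

*The extension.* For `u ∈ 𝓗^s(Ω, γ)` the series `∑ u_k θ_k(y) ψ_k(x)` and those of its derivatives
are orthogonal series in the weighted `L²` spaces of the cylinder, with total energy
`c_s ∑ lam_k^s u_k²` (`exists_extension`). As weak gradients are unique, any function that agrees
with the extension has the same energy (`HasEnergyGradient.energy_congr`), which is the case of
equality.
-/

noncomputable section

namespace OUTrace

/-! ### The Gaussian measure -/

/-- The density of the Gaussian measure with respect to Lebesgue measure. -/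
def dens {n : ℕ} (x : E n) : ℝ := (2 * Real.pi) ^ (-(n : ℝ) / 2) * Real.exp (-‖x‖ ^ 2 / 2)

lemma dens_pos {n : ℕ} (x : E n) : 0 < dens x := by
  unfold dens; positivity

lemma contDiff_dens {n : ℕ} : ContDiff ℝ ∞ (dens : E n → ℝ) := by
  unfold dens
  exact contDiff_const.mul (Real.contDiff_exp.comp ((contDiff_norm_sq ℝ).neg.div_const 2))

lemma continuous_dens {n : ℕ} : Continuous (dens : E n → ℝ) := contDiff_dens.continuous

lemma gauss_eq_withDensity (n : ℕ) :
    gauss n = (volume : Measure (E n)).withDensity fun x => ENNReal.ofReal (dens x) := rfl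

lemma integrable_exp_neg_mul_sq_norm {n : ℕ} {b : ℝ} (hb : 0 < b) :
    Integrable (fun x : E n => Real.exp (-b * ‖x‖ ^ 2)) := by
  have h := GaussianFourier.integrable_cexp_neg_mul_sq_norm_add (V := E n) (b := (b : ℂ))
    (by simpa using hb) 0 0
  have := h.norm
  simpa [Complex.norm_exp, ← Complex.ofReal_pow] using this

lemma integrable_dens {n : ℕ} : Integrable (dens : E n → ℝ) := by
  unfold dens
  refine Integrable.const_mul ?_ _
  refine (integrable_exp_neg_mul_sq_norm (n := n) (b := 1 / 2) (by norm_num)).congr ?_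
  filter_upwards with x
  congr 1; ring

lemma integral_gauss {n : ℕ} {F : Type*} [NormedAddCommGroup F] [NormedSpace ℝ F]
    (f : E n → F) : ∫ x, f x ∂(gauss n) = ∫ x, dens x • f x := by
  rw [gauss_eq_withDensity, integral_withDensity_eq_integral_toReal_smul
    (by have := @continuous_dens n; fun_prop) (by simp)]
  simp [(dens_pos _).le]

/-- The measure `gauss n` is the standard Gaussian measure: the characteristic functions agree. -/
lemma gauss_eq_stdGaussian (n : ℕ) : gauss n = ProbabilityTheory.stdGaussian (E n) := by
  have : IsFiniteMeasure (gauss n) := by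
    rw [gauss_eq_withDensity]
    exact isFiniteMeasure_withDensity_ofReal integrable_dens.2
  refine Measure.ext_of_charFun ?_
  ext t
  rw [ProbabilityTheory.charFun_stdGaussian, charFun_apply, integral_gauss]
  have h := GaussianFourier.integral_cexp_neg_mul_sq_norm_add (V := E n) (b := (1 / 2 : ℂ))
    (by norm_num) Complex.I t
  have e : ∀ x : E n, dens x • Complex.exp (⟪x, t⟫ * Complex.I) =
      (((2 * Real.pi) ^ (-(n : ℝ) / 2) : ℝ) : ℂ) *
        Complex.exp (-(1 / 2) * ‖x‖ ^ 2 + Complex.I * ⟪t, x⟫) := by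
    intro x
    rw [dens, Complex.real_smul, real_inner_comm x t, Complex.exp_add]
    push_cast
    rw [mul_comm Complex.I, mul_assoc]
    congr 3
    ring
  simp_rw [e]
  rw [integral_const_mul, h]
  have e2 : (Real.pi / (1 / 2 : ℂ)) = ((2 * Real.pi : ℝ) : ℂ) := by push_cast; ring
  rw [e2, Complex.ofReal_cpow (by positivity), finrank_euclideanSpace_fin, ← mul_assoc,
    ← Complex.cpow_add]
  · have : (((-(n : ℝ) / 2 : ℝ) : ℂ) + (n : ℂ) / 2) = 0 := by push_cast; ring
    rw [this, Complex.cpow_zero, one_mul, Complex.I_sq]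
    congr 1; ring
  · exact_mod_cast (by positivity : (2 * Real.pi : ℝ) ≠ 0)

instance (n : ℕ) : ProbabilityTheory.IsGaussian (gauss n) := by
  rw [gauss_eq_stdGaussian]; infer_instance

lemma map_rotation_gauss (n : ℕ) (θ : ℝ) :
    ((gauss n).prod (gauss n)).map (ContinuousLinearMap.rotation θ) =
      (gauss n).prod (gauss n) := by
  apply ProbabilityTheory.IsGaussian.map_rotation_eq_self
  rw [gauss_eq_stdGaussian]; simp

/-- The second moment of the Gaussian measure. -/
def secondMoment (n : ℕ) : ℝ≥0∞ := ∫⁻ y, ‖y‖ₑ ^ 2 ∂(gauss n)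

lemma eLpNorm_two_sq {α F : Type*} [MeasurableSpace α] [NormedAddCommGroup F] (μ : Measure α)
    (f : α → F) : eLpNorm f 2 μ ^ 2 = ∫⁻ x, ‖f x‖ₑ ^ 2 ∂μ := by
  simpa using eLpNorm_nnreal_pow_eq_lintegral (f := f) (μ := μ) (p := 2) (by norm_num)

lemma secondMoment_lt_top (n : ℕ) : secondMoment n < ⊤ := by
  have := (ProbabilityTheory.IsGaussian.memLp_two_id (μ := gauss n)).2
  have h := eLpNorm_two_sq (gauss n) (id : E n → E n)
  unfold secondMoment
  simp only [id] at h
  rw [← h]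
  exact ENNReal.pow_lt_top this

/-- The Cauchy–Schwarz inequality for the Lebesgue integral. -/
lemma sq_lintegral_mul_le {α : Type*} [MeasurableSpace α] (μ : Measure α) {f g : α → ℝ≥0∞}
    (hf : AEMeasurable f μ) (hg : AEMeasurable g μ) :
    (∫⁻ x, f x * g x ∂μ) ^ 2 ≤ (∫⁻ x, f x ^ 2 ∂μ) * ∫⁻ x, g x ^ 2 ∂μ := by
  have h := ENNReal.lintegral_mul_le_Lp_mul_Lq μ Real.HolderConjugate.two_two hf hg
  calc (∫⁻ x, f x * g x ∂μ) ^ 2 ≤ ((∫⁻ x, f x ^ (2 : ℝ) ∂μ) ^ (1 / (2 : ℝ)) *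
        (∫⁻ x, g x ^ (2 : ℝ) ∂μ) ^ (1 / (2 : ℝ))) ^ 2 := by gcongr; exact h
    _ = _ := by
      rw [mul_pow, ← ENNReal.rpow_natCast, ← ENNReal.rpow_natCast, ← ENNReal.rpow_mul,
        ← ENNReal.rpow_mul]
      simp

lemma sq_lintegral_le {α : Type*} [MeasurableSpace α] (μ : Measure α) {f : α → ℝ≥0∞}
    (hf : AEMeasurable f μ) :
    (∫⁻ x, f x ∂μ) ^ 2 ≤ μ univ * ∫⁻ x, f x ^ 2 ∂μ := by
  have := sq_lintegral_mul_le μ hf (aemeasurable_const (b := (1 : ℝ≥0∞)))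
  simpa [mul_comm] using this

/-- The rotation `(X cos r + Y sin r, -X sin r + Y cos r)` of a pair of independent standard
Gaussian vectors has the same law for all `r`, so that the increment of a function along the
arc `0 ≤ r ≤ θ` is controlled by its gradient. -/
lemma lintegral_rotation_sub_le {n : ℕ} {ζ : E n → ℝ} (hζ : ContDiff ℝ 1 ζ) {θ : ℝ}
    (hθ : 0 ≤ θ) :
    ∫⁻ p, ‖ζ (Real.cos θ • p.1 + Real.sin θ • p.2) - ζ p.1‖ₑ ^ 2 ∂((gauss n).prod (gauss n)) ≤
      ENNReal.ofReal θ ^ 2 * secondMoment n * ∫⁻ x, ‖fderiv ℝ ζ x‖ₑ ^ 2 ∂(gauss n) := by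
  set F : E n × E n → ℝ → ℝ := fun p r =>
    fderiv ℝ ζ (Real.cos r • p.1 + Real.sin r • p.2) (-Real.sin r • p.1 + Real.cos r • p.2) with hF
  have hcf : Continuous (fderiv ℝ ζ) := hζ.continuous_fderiv (by norm_num)
  have hFc : Continuous (fun q : (E n × E n) × ℝ => F q.1 q.2) := by
    have := Real.continuous_cos
    have := Real.continuous_sin
    simp only [hF]
    fun_prop
  have hftc : ∀ p : E n × E n, ζ (Real.cos θ • p.1 + Real.sin θ • p.2) - ζ p.1 =
      ∫ r in (0 : ℝ)..θ, F p r := by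
    intro p
    have hd : ∀ r : ℝ, HasDerivAt (fun r => ζ (Real.cos r • p.1 + Real.sin r • p.2)) (F p r) r := by
      intro r
      have h1 : HasDerivAt (fun r => Real.cos r • p.1 + Real.sin r • p.2)
          (-Real.sin r • p.1 + Real.cos r • p.2) r :=
        ((Real.hasDerivAt_cos r).smul_const _).add ((Real.hasDerivAt_sin r).smul_const _)
      exact ((hζ.differentiable (by norm_num) _).hasFDerivAt).comp_hasDerivAt r h1
    rw [intervalIntegral.integral_eq_sub_of_hasDerivAt (fun r _ => hd r)]
    · simp
    · apply Continuous.intervalIntegrable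
      fun_prop
  have hpt : ∀ p : E n × E n, ‖ζ (Real.cos θ • p.1 + Real.sin θ • p.2) - ζ p.1‖ₑ ^ 2 ≤
      ENNReal.ofReal θ * ∫⁻ r in Ioc 0 θ, ‖F p r‖ₑ ^ 2 := by
    intro p
    rw [hftc, intervalIntegral.integral_of_le hθ]
    have hm : AEMeasurable (fun r => ‖F p r‖ₑ) (volume.restrict (Ioc 0 θ)) := by
      have : Continuous (fun r => F p r) := by fun_prop
      exact this.measurable.enorm.aemeasurable
    calc _ ≤ (∫⁻ r in Ioc 0 θ, ‖F p r‖ₑ) ^ 2 := by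
          gcongr; exact enorm_integral_le_lintegral_enorm _
      _ ≤ _ := by
        refine (sq_lintegral_le _ hm).trans ?_
        simp
  have hbound : ∀ r : ℝ, ∫⁻ p, ‖F p r‖ₑ ^ 2 ∂((gauss n).prod (gauss n)) ≤
      secondMoment n * ∫⁻ x, ‖fderiv ℝ ζ x‖ₑ ^ 2 ∂(gauss n) := by
    intro r
    have hrot : ∫⁻ p, ‖F p r‖ₑ ^ 2 ∂((gauss n).prod (gauss n)) =
        ∫⁻ p, ‖fderiv ℝ ζ p.1 p.2‖ₑ ^ 2 ∂((gauss n).prod (gauss n)) := by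
      conv_rhs => rw [← map_rotation_gauss n r]
      rw [lintegral_map]
      · rfl
      · have : Continuous fun p : E n × E n => fderiv ℝ ζ p.1 p.2 := by fun_prop
        exact this.measurable.enorm.pow_const 2
      · fun_prop
    rw [hrot]
    calc _ ≤ ∫⁻ p : E n × E n, ‖fderiv ℝ ζ p.1‖ₑ ^ 2 * ‖p.2‖ₑ ^ 2 ∂((gauss n).prod (gauss n)) := by
          refine lintegral_mono fun p => ?_
          rw [← mul_pow]
          gcongr
          exact (fderiv ℝ ζ p.1).le_opENorm p.2
      _ = _ := by
          rw [lintegral_prod_mul (f := fun x : E n => ‖fderiv ℝ ζ x‖ₑ ^ 2)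
            (g := fun y : E n => ‖y‖ₑ ^ 2), mul_comm]
          · rfl
          · exact (hcf.measurable.enorm.pow_const 2).aemeasurable
          · exact (measurable_enorm.pow_const 2).aemeasurable
  calc _ ≤ ∫⁻ p, (ENNReal.ofReal θ * ∫⁻ r in Ioc 0 θ, ‖F p r‖ₑ ^ 2) ∂((gauss n).prod (gauss n)) :=
        lintegral_mono hpt
    _ = ENNReal.ofReal θ * ∫⁻ r in Ioc 0 θ, ∫⁻ p, ‖F p r‖ₑ ^ 2 ∂((gauss n).prod (gauss n)) := by
        rw [lintegral_const_mul' _ _ (by simp), lintegral_lintegral_swap]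
        exact (hFc.measurable.enorm.pow_const 2).aemeasurable
    _ ≤ ENNReal.ofReal θ * ∫⁻ r in Ioc 0 θ,
          secondMoment n * ∫⁻ x, ‖fderiv ℝ ζ x‖ₑ ^ 2 ∂(gauss n) := by
        gcongr with r; exact hbound r
    _ = _ := by
        rw [setLIntegral_const]
        simp only [Real.volume_Ioc, sub_zero]
        ring

/-- A Poincaré inequality for functions that vanish outside a set `Ω` with `γ(Ωᶜ) > 0`. -/
lemma poincare_of_support {n : ℕ} {Ω : Set (E n)} (hΩ : MeasurableSet Ω) {ζ : E n → ℝ}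
    (hζ : ContDiff ℝ 1 ζ) (hs : ∀ x ∉ Ω, ζ x = 0) :
    gauss n Ωᶜ * ∫⁻ x, ‖ζ x‖ₑ ^ 2 ∂(gauss n) ≤
      ENNReal.ofReal (Real.pi / 2) ^ 2 * secondMoment n *
        ∫⁻ x, ‖fderiv ℝ ζ x‖ₑ ^ 2 ∂(gauss n) := by
  -- For the angle `π / 2` the increment is `ζ(Y) - ζ(X)`, which is `-ζ(X)` if `Y ∉ Ω`.
  refine le_trans ?_ (lintegral_rotation_sub_le hζ (θ := Real.pi / 2) (by positivity))
  have e : gauss n Ωᶜ * ∫⁻ x, ‖ζ x‖ₑ ^ 2 ∂(gauss n) =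
      ∫⁻ p : E n × E n, ‖ζ p.1‖ₑ ^ 2 * Ωᶜ.indicator 1 p.2 ∂((gauss n).prod (gauss n)) := by
    rw [lintegral_prod_mul (f := fun x : E n => ‖ζ x‖ₑ ^ 2)
      (g := fun y : E n => Ωᶜ.indicator (1 : E n → ℝ≥0∞) y), lintegral_indicator_one hΩ.compl,
      mul_comm]
    · exact (hζ.continuous.measurable.enorm.pow_const 2).aemeasurable
    · exact (measurable_one.indicator hΩ.compl).aemeasurable
  rw [e]
  refine lintegral_mono fun p => ?_
  by_cases hp : p.2 ∈ Ω
  · simp [hp]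
  · simp [hp, hs p.2 hp]

/-! ### The Mehler kernel -/

/-- The Mehler kernel: the density, with respect to the Gaussian measure, of the law of
`c x + s Y`, where `Y` is a standard Gaussian vector. -/
def mehler {n : ℕ} (c s : ℝ) (p : E n × E n) : ℝ :=
  (s ^ n)⁻¹ * dens (s⁻¹ • (p.2 - c • p.1)) / dens p.2

lemma continuous_mehler {n : ℕ} (c s : ℝ) : Continuous (mehler (n := n) c s) := by
  have := @continuous_dens n
  unfold mehler
  exact Continuous.div (by fun_prop) (by fun_prop) fun p => (dens_pos _).ne'

/-- The change of variables `z = c x + s y`. -/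
lemma integral_mehler_mul {n : ℕ} {c s : ℝ} (hs : 0 < s) (ζ : E n → ℝ) (x : E n) :
    ∫ y, ζ (c • x + s • y) ∂(gauss n) = ∫ z, mehler c s (x, z) * ζ z ∂(gauss n) := by
  rw [integral_gauss, integral_gauss]
  have h1 := Measure.integral_comp_smul (μ := (volume : Measure (E n)))
    (fun w => dens (s⁻¹ • w) • ζ (c • x + w)) s
  simp only [smul_smul, inv_mul_cancel₀ hs.ne', one_smul, finrank_euclideanSpace_fin] at h1
  rw [h1, abs_of_pos (by positivity), ← integral_smul]
  conv_rhs => rw [← integral_add_left_eq_self (μ := (volume : Measure (E n))) _ (c • x)]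
  congr 1
  ext w
  have := (dens_pos (c • x + w)).ne'
  simp only [mehler, smul_eq_mul, add_sub_cancel_left]
  field_simp

/-- The Mehler kernel is square integrable: up to a constant, its square times the Gaussian
densities is at most `exp (-δ (|x|² + |z|²))` with `δ = (1 - c)² / (2 s²)`. -/
lemma memLp_mehler {n : ℕ} {c s : ℝ} (hs : 0 < s) (hcs : c ^ 2 + s ^ 2 = 1) (hc0 : 0 ≤ c) :
    MemLp (mehler (n := n) c s) 2 ((gauss n).prod (gauss n)) := by
  have hc1 : c < 1 := by nlinarith
  refine (memLp_two_iff_integrable_sq (continuous_mehler c s).aestronglyMeasurable).2 ?_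
  have hm : Measurable fun x : E n => ENNReal.ofReal (dens x) :=
    (continuous_dens.measurable).ennreal_ofReal
  have hm2 : Measurable fun p : E n × E n =>
      ENNReal.ofReal (dens p.1) * ENNReal.ofReal (dens p.2) :=
    (hm.comp measurable_fst).mul (hm.comp measurable_snd)
  have : SFinite ((volume : Measure (E n)).withDensity fun x => ENNReal.ofReal (dens x)) := by
    rw [← gauss_eq_withDensity]; infer_instance
  rw [gauss_eq_withDensity, prod_withDensity hm hm,
    integrable_withDensity_iff_integrable_smul' hm2 (by
      filter_upwards with p
      exact ENNReal.mul_lt_top ENNReal.ofReal_lt_top ENNReal.ofReal_lt_top)]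
  set δ : ℝ := (1 - c) ^ 2 / (2 * s ^ 2) with hδ
  have hδ0 : 0 < δ := by
    have : 0 < 1 - c := by linarith
    positivity
  set A : ℝ := (2 * Real.pi) ^ (-(n : ℝ) / 2) with hA
  have hA0 : 0 < A := by positivity
  have hg := ((integrable_exp_neg_mul_sq_norm (n := n) hδ0).mul_prod
    (integrable_exp_neg_mul_sq_norm (n := n) hδ0)).const_mul (((s ^ n)⁻¹) ^ 2 * A ^ 2)
  refine hg.mono' ?_ ?_
  · refine Continuous.aestronglyMeasurable ?_
    have := continuous_mehler (n := n) c s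
    have h2 := @continuous_dens n
    simp only [ENNReal.toReal_mul, ENNReal.toReal_ofReal (dens_pos _).le]
    fun_prop
  · filter_upwards with p
    obtain ⟨x, z⟩ := p
    simp only [ENNReal.toReal_mul, ENNReal.toReal_ofReal (dens_pos _).le, smul_eq_mul]
    have hdx := dens_pos x
    have hdz := dens_pos z
    rw [Real.norm_of_nonneg (by positivity)]
    have e1 : dens x * dens z * mehler c s (x, z) ^ 2 = ((s ^ n)⁻¹) ^ 2 *
        (dens (s⁻¹ • (z - c • x)) ^ 2 * dens x / dens z) := by
      unfold mehler
      field_simp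
    rw [e1, mul_assoc]
    gcongr
    have e2 : dens (s⁻¹ • (z - c • x)) ^ 2 * dens x / dens z = A ^ 2 *
        Real.exp (-(‖s⁻¹ • (z - c • x)‖ ^ 2) - ‖x‖ ^ 2 / 2 + ‖z‖ ^ 2 / 2) := by
      unfold dens
      rw [← hA, div_eq_iff (by positivity), mul_pow, ← Real.exp_nat_mul]
      have : Real.exp (-(‖s⁻¹ • (z - c • x)‖ ^ 2) - ‖x‖ ^ 2 / 2 + ‖z‖ ^ 2 / 2) =
          Real.exp ((2 : ℕ) * (-‖s⁻¹ • (z - c • x)‖ ^ 2 / 2)) * Real.exp (-‖x‖ ^ 2 / 2) /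
            Real.exp (-‖z‖ ^ 2 / 2) := by
        rw [← Real.exp_add, ← Real.exp_sub]
        congr 1
        push_cast
        ring
      rw [this]
      field_simp
    rw [e2]
    refine mul_le_mul_of_nonneg_left ?_ (by positivity)
    rw [← Real.exp_add]
    refine Real.exp_le_exp.2 ?_
    rw [norm_smul, mul_pow, norm_sub_sq_real, norm_smul, real_inner_smul_right]
    have hin : ⟪z, x⟫ ≤ ‖z‖ * ‖x‖ := real_inner_le_norm z x
    simp only [norm_inv, Real.norm_eq_abs, mul_pow, inv_pow, sq_abs]
    have h3 : c * ⟪z, x⟫ ≤ c * ((‖z‖ ^ 2 + ‖x‖ ^ 2) / 2) := by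
      refine mul_le_mul_of_nonneg_left ?_ hc0
      nlinarith [sq_nonneg (‖z‖ - ‖x‖)]
    have hs2 : 0 < s ^ 2 := by positivity
    have key : (s ^ 2)⁻¹ * (2 * (c * ⟪z, x⟫)) ≤ (s ^ 2)⁻¹ * (c * (‖z‖ ^ 2 + ‖x‖ ^ 2)) := by
      refine mul_le_mul_of_nonneg_left ?_ (by positivity)
      linarith
    have e3 : c ^ 2 = 1 - s ^ 2 := by linarith
    have e4 : -((s ^ 2)⁻¹ * (‖z‖ ^ 2 + c ^ 2 * ‖x‖ ^ 2)) - ‖x‖ ^ 2 / 2 + ‖z‖ ^ 2 / 2 +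
        (s ^ 2)⁻¹ * (c * (‖z‖ ^ 2 + ‖x‖ ^ 2)) = -δ * ‖x‖ ^ 2 + -δ * ‖z‖ ^ 2 := by
      rw [hδ]
      field_simp
      rw [show s ^ 2 = 1 - c ^ 2 by linarith]
      ring
    have e5 : (s ^ 2)⁻¹ * (‖z‖ ^ 2 - 2 * (c * ⟪z, x⟫) + c ^ 2 * ‖x‖ ^ 2) =
      (s ^ 2)⁻¹ * (‖z‖ ^ 2 + c ^ 2 * ‖x‖ ^ 2) - (s ^ 2)⁻¹ * (2 * (c * ⟪z, x⟫)) := by ring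
    rw [e5]
    linarith

/-- The Mehler kernel with parameters `(cos θ, sin θ)` is an approximate identity on `H¹`. -/
lemma lintegral_sub_mehler_le {n : ℕ} {ζ : E n → ℝ} (hζ : ContDiff ℝ 1 ζ)
    (hc : HasCompactSupport ζ) {θ : ℝ} (hθ : 0 < θ) (hθ' : θ < Real.pi / 2) :
    ∫⁻ x, ‖ζ x - ∫ z, mehler (Real.cos θ) (Real.sin θ) (x, z) * ζ z ∂(gauss n)‖ₑ ^ 2 ∂(gauss n) ≤
      ENNReal.ofReal θ ^ 2 * secondMoment n * ∫⁻ x, ‖fderiv ℝ ζ x‖ₑ ^ 2 ∂(gauss n) := by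
  refine le_trans ?_ (lintegral_rotation_sub_le hζ hθ.le)
  have hsin : 0 < Real.sin θ := Real.sin_pos_of_pos_of_lt_pi hθ (by linarith [Real.pi_pos])
  have hcont := hζ.continuous
  rw [lintegral_prod _ (by
    have : Continuous fun p : E n × E n =>
      ζ (Real.cos θ • p.1 + Real.sin θ • p.2) - ζ p.1 := by fun_prop
    exact (this.measurable.enorm.pow_const 2).aemeasurable)]
  refine lintegral_mono fun x => ?_
  simp only
  rw [← integral_mehler_mul hsin]
  obtain ⟨M, hM⟩ := hc.exists_bound_of_continuous hcont
  have hint : Integrable (fun y => ζ (Real.cos θ • x + Real.sin θ • y)) (gauss n) :=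
    Integrable.of_bound (C := M) (by
      have : Continuous fun y => ζ (Real.cos θ • x + Real.sin θ • y) := by fun_prop
      exact this.aestronglyMeasurable) (by filter_upwards with y using hM _)
  have e : ζ x - ∫ y, ζ (Real.cos θ • x + Real.sin θ • y) ∂(gauss n) =
      ∫ y, (ζ x - ζ (Real.cos θ • x + Real.sin θ • y)) ∂(gauss n) := by
    rw [integral_sub (integrable_const _) hint]; simp
  rw [e]
  calc _ ≤ (∫⁻ y, ‖ζ x - ζ (Real.cos θ • x + Real.sin θ • y)‖ₑ ∂(gauss n)) ^ 2 := by
        gcongr; exact enorm_integral_le_lintegral_enorm _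
    _ ≤ _ := by
        refine (sq_lintegral_le _ ?_).trans ?_
        · have : Continuous fun y => ζ x - ζ (Real.cos θ • x + Real.sin θ • y) := by fun_prop
          exact this.measurable.enorm.aemeasurable
        · rw [measure_univ, one_mul]
          refine lintegral_mono fun y => ?_
          simp only
          rw [← enorm_neg, neg_sub]

/-! ### Compact operators -/

section Compact

variable {H H' : Type*} [NormedAddCommGroup H] [InnerProductSpace ℝ H]
  [NormedAddCommGroup H'] [InnerProductSpace ℝ H'] [CompleteSpace H']

/-- A Hilbert–Schmidt operator is compact: it is the norm limit of its restrictions to the spans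
of finitely many basis vectors. -/
lemma isCompactOperator_of_summable_norm_sq {ι : Type*} (b : HilbertBasis ι ℝ H) (K : H →L[ℝ] H')
    (hK : Summable fun i => ‖K (b i)‖ ^ 2) : IsCompactOperator K := by
  classical
  let KF : Finset ι → H →L[ℝ] H' := fun F => ∑ i ∈ F, (innerSL ℝ (b i)).smulRight (K (b i))
  have hKF : ∀ F, IsCompactOperator (KF F) := by
    intro F
    refine Submodule.sum_mem (compactOperator (RingHom.id ℝ) H H')
      (t := F) (f := fun i => (innerSL ℝ (b i)).smulRight (K (b i))) ?_
    intro i _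
    change IsCompactOperator fun x => (innerSL ℝ (b i) x) • K (b i)
    have h1 : IsCompactOperator (ContinuousLinearMap.toSpanSingleton ℝ (K (b i))) :=
      isCompactOperator_of_locallyCompactSpace_rng
        (T := (ContinuousLinearMap.toSpanSingleton ℝ (K (b i))))
    exact h1.comp_clm (innerSL ℝ (b i))
  let R : Finset ι → ℝ := fun F => ∑' i : {i // i ∉ F}, ‖K (b i)‖ ^ 2
  have hR : Tendsto R atTop (𝓝 0) := tendsto_tsum_compl_atTop_zero fun i => ‖K (b i)‖ ^ 2
  have hbound : ∀ F, ‖K - KF F‖ ≤ √(R F) := by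
    intro F
    refine ContinuousLinearMap.opNorm_le_bound _ (Real.sqrt_nonneg _) fun x => ?_
    have h1 : HasSum (fun i => ⟪b i, x⟫ • K (b i)) (K x) := by
      have := (b.hasSum_repr x).mapL K
      simpa [b.repr_apply_apply] using this
    have h2 : HasSum (fun i : {i // i ∉ F} => ⟪b i, x⟫ • K (b i)) ((K - KF F) x) := by
      have := (F.hasSum_compl_iff (f := fun i => ⟪b i, x⟫ • K (b i))
        (a := (K - KF F) x)).2 (by simpa [KF] using h1)
      exact this
    refine le_of_tendsto h2.norm (Eventually.of_forall fun G => ?_)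
    calc ‖∑ i ∈ G, ⟪b i, x⟫ • K (b i)‖ ≤ ∑ i ∈ G, ‖K (b i)‖ * |⟪b i, x⟫| := by
          refine (norm_sum_le _ _).trans (le_of_eq ?_)
          refine Finset.sum_congr rfl fun i _ => ?_
          rw [norm_smul, Real.norm_eq_abs, mul_comm]
      _ ≤ √(∑ i ∈ G, ‖K (b i)‖ ^ 2) * √(∑ i ∈ G, |⟪b i, x⟫| ^ 2) :=
          Real.sum_mul_le_sqrt_mul_sqrt _ _ _
      _ ≤ √(R F) * ‖x‖ := by
          gcongr
          · exact (hK.subtype _).sum_le_tsum G fun i _ => sq_nonneg ‖K (b i.1)‖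
          · rw [Real.sqrt_le_left (norm_nonneg _)]
            have h3 := Orthonormal.sum_inner_products_le x (s := G)
              (b.orthonormal.comp (fun i : {i // i ∉ F} => i.1) Subtype.val_injective)
            simpa using h3
  refine isCompactOperator_of_tendsto (l := atTop) (F := KF) (f := K) ?_
    (Eventually.of_forall hKF)
  rw [tendsto_iff_norm_sub_tendsto_zero]
  have hR' : Tendsto (fun F => √(R F)) atTop (𝓝 0) := by
    have := (Real.continuous_sqrt.tendsto 0).comp hR
    rwa [Real.sqrt_zero] at this
  refine squeeze_zero (fun _ => norm_nonneg _) (fun F => ?_) hR'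
  rw [norm_sub_rev]
  exact hbound F

/-- A compact symmetric positive operator attains its norm at a unit eigenvector. -/
lemma exists_eigenvector_norm [CompleteSpace H] [Nontrivial H] {S : H →L[ℝ] H}
    (hc : IsCompactOperator S) (hs : (S : H →ₗ[ℝ] H).IsSymmetric)
    (hpos : ∀ x, x ≠ 0 → 0 < ⟪S x, x⟫) :
    ∃ e, ‖e‖ = 1 ∧ 0 < ‖S‖ ∧ S e = ‖S‖ • e := by
  have hne : S ≠ 0 := by
    rintro rfl
    obtain ⟨x, hx⟩ := exists_ne (0 : H)
    simpa using hpos x hx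
  have hsr := S.spectralRadius_eq_nnnorm hs.isSelfAdjoint
  have hnon : (spectrum ℝ S).Nonempty := by
    by_contra hemp
    rw [Set.not_nonempty_iff_eq_empty] at hemp
    rw [spectralRadius, hemp] at hsr
    simp only [mem_empty_iff_false, not_false_eq_true, iSup_neg, bot_eq_zero'] at hsr
    exact hne (by simpa using hsr.symm)
  obtain ⟨m, hm, hm2⟩ := spectrum.exists_nnnorm_eq_spectralRadius_of_nonempty hnon
  rw [hsr, ENNReal.coe_inj] at hm2
  have hm0 : m ≠ 0 := by
    rintro rfl
    exact hne (by simpa using hm2.symm)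
  obtain ⟨v, hv⟩ := ((hc.hasEigenvalue_iff_mem_spectrum hm0).2 hm).exists_hasEigenvector
  have hv0 : v ≠ 0 := hv.2
  have hvT : S v = m • v := hv.apply_eq_smul
  have hmpos : 0 < m := by
    have := hpos v hv0
    rw [hvT, real_inner_smul_left, real_inner_self_eq_norm_sq] at this
    exact pos_of_mul_pos_left this (by positivity)
  have h2 : ‖S‖ = m := by
    have := congrArg NNReal.toReal hm2
    simp only [coe_nnnorm] at this
    rw [← this, Real.norm_of_nonneg hmpos.le]
  have hn : 0 < ‖v‖ := norm_pos_iff.2 hv0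
  refine ⟨‖v‖⁻¹ • v, ?_, h2 ▸ hmpos, ?_⟩
  · rw [norm_smul, norm_inv, norm_norm, inv_mul_cancel₀ hn.ne']
  · rw [map_smul, hvT, smul_comm, h2]

/-- A compact symmetric positive operator attains its norm, on the orthogonal complement of a
finite-dimensional invariant subspace, at a unit eigenvector. -/
lemma exists_eigenvector_orthogonal [CompleteSpace H] (hinf : ¬ FiniteDimensional ℝ H)
    {T : H →L[ℝ] H} (hc : IsCompactOperator T) (hs : (T : H →ₗ[ℝ] H).IsSymmetric)
    (hpos : ∀ x, x ≠ 0 → 0 < ⟪T x, x⟫) (U : Submodule ℝ H) (hU : FiniteDimensional ℝ U)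
    (hinv : ∀ x ∈ U, T x ∈ U) :
    ∃ e ∈ Uᗮ, ‖e‖ = 1 ∧ ∃ m : ℝ, 0 < m ∧ T e = m • e ∧ ∀ x ∈ Uᗮ, ‖T x‖ ≤ m * ‖x‖ := by
  have hinv' : ∀ x ∈ Uᗮ, T x ∈ Uᗮ := by
    intro x hx
    rw [Submodule.mem_orthogonal] at hx ⊢
    intro u hu
    have := hs u x
    simp only [ContinuousLinearMap.coe_coe] at this
    rw [← this]
    exact hx _ (hinv u hu)
  obtain ⟨S, hSv, hSc⟩ : ∃ S : Uᗮ →L[ℝ] Uᗮ, (∀ x, (S x : H) = T x) ∧ IsCompactOperator S :=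
    ⟨T.restrict hinv', fun _ => rfl, hc.restrict' hinv'⟩
  have hSs : (S : Uᗮ →ₗ[ℝ] Uᗮ).IsSymmetric := fun v w => by
    have := hs v w
    simp only [ContinuousLinearMap.coe_coe] at this
    simp only [Submodule.coe_inner, ContinuousLinearMap.coe_coe, hSv, this]
  have hnt : Nontrivial Uᗮ := by
    rw [Submodule.nontrivial_iff_ne_bot]
    intro hbot
    rw [Submodule.orthogonal_eq_bot_iff] at hbot
    subst hbot
    exact hinf (Submodule.topEquiv (R := ℝ) (M := H)).finiteDimensional
  obtain ⟨e, he, hm, hSe⟩ := exists_eigenvector_norm hSc hSs (fun x hx => by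
    rw [Submodule.coe_inner, hSv]
    exact hpos x (by simpa using hx))
  refine ⟨e, e.2, he, ‖S‖, hm, ?_, fun x hx => ?_⟩
  · rw [← hSv, hSe]; rfl
  · have h1 := S.le_opNorm ⟨x, hx⟩
    rw [Submodule.coe_norm, hSv] at h1
    exact h1

/-- The spectral theorem for an injective positive compact operator, with the eigenvalues in
decreasing order. The eigenvectors are found one after the other, each of them maximizing the
operator on the orthogonal complement of its predecessors. -/
theorem exists_hilbertBasis_eigenvectors [CompleteSpace H] (hinf : ¬ FiniteDimensional ℝ H)
    {T : H →L[ℝ] H} (hc : IsCompactOperator T) (hs : (T : H →ₗ[ℝ] H).IsSymmetric)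
    (hpos : ∀ x, x ≠ 0 → 0 < ⟪T x, x⟫) :
    ∃ (b : HilbertBasis ℕ ℝ H) (m : ℕ → ℝ), (∀ k, 0 < m k) ∧ Antitone m ∧
      Tendsto m atTop (𝓝 0) ∧ ∀ k, T (b k) = m k • b k := by
  let S := {U : Submodule ℝ H // FiniteDimensional ℝ U ∧ ∀ x ∈ U, T x ∈ U}
  choose e he1 he2 mm hm0 hTe hmax using fun U : S =>
    exists_eigenvector_orthogonal hinf hc hs hpos U.1 U.2.1 U.2.2
  -- The next eigenvector is adjoined to an invariant subspace.
  let step : S → S := fun U => ⟨U.1 ⊔ Submodule.span ℝ {e U}, by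
    have := U.2.1
    infer_instance, by
    intro x hx
    obtain ⟨y, hy, z, hz, rfl⟩ := Submodule.mem_sup.1 hx
    rw [map_add]
    refine Submodule.add_mem_sup (U.2.2 y hy) ?_
    obtain ⟨c, rfl⟩ := Submodule.mem_span_singleton.1 hz
    rw [map_smul, hTe]
    exact Submodule.smul_mem _ _ (Submodule.smul_mem _ _ (Submodule.mem_span_singleton_self _))⟩
  let U : ℕ → S := fun k => step^[k] ⟨⊥, inferInstance, by simp⟩
  have hU0 : (U 0).1 = ⊥ := rfl
  have hUs : ∀ k, (U (k + 1)).1 = (U k).1 ⊔ Submodule.span ℝ {e (U k)} := by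
    intro k
    simp only [U, Function.iterate_succ_apply']
    rfl
  have hmono : Monotone fun k => (U k).1 :=
    monotone_nat_of_le_succ fun k => by rw [hUs]; exact le_sup_left
  have hmem : ∀ k, e (U k) ∈ (U (k + 1)).1 := fun k => by
    rw [hUs]; exact Submodule.mem_sup_right (Submodule.mem_span_singleton_self _)
  have horth : ∀ j k, j < k → ⟪e (U j), e (U k)⟫ = 0 := fun j k hjk =>
    (Submodule.mem_orthogonal _ _).1 (he1 (U k)) _ (hmono hjk (hmem j))
  have hon : Orthonormal ℝ fun k => e (U k) := by
    refine ⟨fun k => he2 _, fun j k hjk => ?_⟩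
    rcases lt_or_gt_of_ne hjk with h | h
    · exact horth j k h
    · simp only
      rw [real_inner_comm]; exact horth k j h
  have hanti : Antitone fun k => mm (U k) := by
    refine antitone_nat_of_succ_le fun k => ?_
    have h1 := hmax (U k) (e (U (k + 1)))
      (Submodule.orthogonal_le (hmono (Nat.le_succ k)) (he1 (U (k + 1))))
    rw [hTe, norm_smul, he2, mul_one, mul_one, Real.norm_of_nonneg (hm0 _).le] at h1
    exact h1
  have hlim : Tendsto (fun k => mm (U k)) atTop (𝓝 0) := by
    have hbdd : BddBelow (range fun k => mm (U k)) := ⟨0, by rintro _ ⟨k, rfl⟩; exact (hm0 _).le⟩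
    have hL := tendsto_atTop_ciInf hanti hbdd
    set L := ⨅ k, mm (U k)
    have hL0 : 0 ≤ L := le_ciInf fun k => (hm0 _).le
    rcases hL0.eq_or_lt with h | h
    · rwa [← h] at hL
    · -- Otherwise the images of the eigenvectors stay at distance at least `L` from each other,
      -- and have no convergent subsequence.
      exfalso
      have hle : ∀ k, L ≤ mm (U k) := fun k => ciInf_le hbdd k
      obtain ⟨C, hC, hCsub⟩ := hc.image_closedBall_subset_compact (f := (T : H →ₗ[ℝ] H)) 1
      obtain ⟨a, -, φ, hφ, hφa⟩ := hC.tendsto_subseq (x := fun k => T (e (U k)))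
        (fun k => hCsub ⟨e (U k), by simp [he2], rfl⟩)
      have hcau := hφa.cauchySeq
      obtain ⟨N, hN⟩ := Metric.cauchySeq_iff'.1 hcau L h
      have h1 := hN (N + 1) (Nat.le_succ N)
      simp only [Function.comp, dist_eq_norm] at h1
      have hlt : φ N < φ (N + 1) := hφ (Nat.lt_succ_self N)
      have h2 : ‖T (e (U (φ (N + 1)))) - T (e (U (φ N)))‖ ^ 2 =
          mm (U (φ (N + 1))) ^ 2 + mm (U (φ N)) ^ 2 := by
        rw [hTe, hTe, norm_sub_sq_real, real_inner_smul_left, real_inner_smul_right,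
          real_inner_comm, horth _ _ hlt, norm_smul, norm_smul, he2, he2]
        simp
      have h3 := hle (φ N)
      have h4 : L ^ 2 ≤ ‖T (e (U (φ (N + 1)))) - T (e (U (φ N)))‖ ^ 2 := by
        rw [h2]; nlinarith [sq_nonneg (mm (U (φ (N + 1))))]
      exact absurd h1 (not_lt.2 (le_of_sq_le_sq h4 (norm_nonneg _)))
  have hspan : ∀ k, (U k).1 ≤ Submodule.span ℝ (range fun k => e (U k)) := by
    intro k
    induction k with
    | zero => rw [hU0]; exact bot_le
    | succ k ih =>
      rw [hUs]
      refine sup_le ih (Submodule.span_mono ?_)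
      rintro _ rfl
      exact ⟨k, rfl⟩
  -- On the orthogonal complement of all eigenvectors `T` is bounded by every `mm (U k)`.
  have hbot : (Submodule.span ℝ (range fun k => e (U k)))ᗮ = ⊥ := by
    rw [Submodule.eq_bot_iff]
    intro x hx
    have h1 : ∀ k, ‖T x‖ ≤ mm (U k) * ‖x‖ := fun k =>
      hmax (U k) x (Submodule.orthogonal_le (hspan k) hx)
    have h2 : ‖T x‖ ≤ 0 := by
      have := hlim.mul_const ‖x‖
      rw [zero_mul] at this
      exact ge_of_tendsto' this h1
    by_contra hx0
    have h3 := hpos x hx0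
    rw [norm_le_zero_iff.1 h2] at h3
    simp at h3
  refine ⟨HilbertBasis.mkOfOrthogonalEqBot hon hbot, fun k => mm (U k), fun k => hm0 _, hanti,
    hlim, fun k => ?_⟩
  simp only [HilbertBasis.coe_mkOfOrthogonalEqBot]
  exact hTe _

end Compact

/-! ### Square integrable functions on a product -/

lemma enorm_sq_Lp {α F : Type*} [MeasurableSpace α] [NormedAddCommGroup F] {μ : Measure α}
    (u : Lp F 2 μ) : ‖u‖ₑ ^ 2 = ∫⁻ x, ‖u x‖ₑ ^ 2 ∂μ := by
  rw [Lp.enorm_def, eLpNorm_two_sq]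

lemma norm_sq_Lp {α : Type*} [MeasurableSpace α] {μ : Measure α}
    {F : Type*} [NormedAddCommGroup F] [InnerProductSpace ℝ F] (u : Lp F 2 μ) :
    ‖u‖ ^ 2 = ∫ x, ‖u x‖ ^ 2 ∂μ := by
  rw [← real_inner_self_eq_norm_sq, L2.inner_def]
  simp

lemma lintegral_enorm_sq_lt_top {α F : Type*} [MeasurableSpace α] [NormedAddCommGroup F]
    {μ : Measure α} {f : α → F} (hf : MemLp f 2 μ) : ∫⁻ x, ‖f x‖ₑ ^ 2 ∂μ < ⊤ := by
  rw [← eLpNorm_two_sq]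
  exact ENNReal.pow_lt_top hf.2

lemma memLp_two_of_lintegral {α F : Type*} [MeasurableSpace α] [NormedAddCommGroup F]
    {μ : Measure α} {f : α → F} (hm : AEStronglyMeasurable f μ)
    (hf : ∫⁻ x, ‖f x‖ₑ ^ 2 ∂μ < ⊤) : MemLp f 2 μ := by
  refine ⟨hm, ?_⟩
  rw [← eLpNorm_two_sq] at hf
  by_contra h
  rw [not_lt, top_le_iff] at h
  rw [h] at hf
  simp at hf

section Slices

variable {α β F : Type*} [MeasurableSpace α] [MeasurableSpace β] [NormedAddCommGroup F]
  {μ : Measure α} {ν : Measure β} [SFinite ν]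

lemma lintegral_slice_right [SFinite μ] {f : α × β → F} (hf : AEStronglyMeasurable f (μ.prod ν)) :
    ∫⁻ p, ‖f p‖ₑ ^ 2 ∂(μ.prod ν) = ∫⁻ y, ∫⁻ x, ‖f (x, y)‖ₑ ^ 2 ∂μ ∂ν :=
  lintegral_prod_symm _ (hf.enorm.pow_const 2)

lemma memLp_slice_right [SFinite μ] {f : α × β → F} (hf : MemLp f 2 (μ.prod ν)) :
    ∀ᵐ y ∂ν, MemLp (fun x => f (x, y)) 2 μ := by
  have h1 := lintegral_enorm_sq_lt_top hf
  rw [lintegral_slice_right hf.1] at h1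
  have h2 : AEMeasurable (fun y => ∫⁻ x, ‖f (x, y)‖ₑ ^ 2 ∂μ) ν :=
    ((hf.1.prod_swap.enorm.pow_const 2)).lintegral_prod_right'
  filter_upwards [ae_lt_top' h2 h1.ne, hf.1.prodMk_right] with y hy hm
  exact memLp_two_of_lintegral hm hy

lemma memLp_slice_left {f : α × β → F} (hf : MemLp f 2 (μ.prod ν)) :
    ∀ᵐ x ∂μ, MemLp (fun y => f (x, y)) 2 ν := by
  have h1 := lintegral_enorm_sq_lt_top hf
  rw [lintegral_prod _ (hf.1.enorm.pow_const 2)] at h1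
  have h2 : AEMeasurable (fun x => ∫⁻ y, ‖f (x, y)‖ₑ ^ 2 ∂ν) μ :=
    (hf.1.enorm.pow_const 2).lintegral_prod_right'
  filter_upwards [ae_lt_top' h2 h1.ne, hf.1.prodMk_left] with y hy hm
  exact memLp_two_of_lintegral hm hy

end Slices

section Kernel

variable {α : Type*} [MeasurableSpace α] {μ : Measure α} [SFinite μ]

/-- A square integrable kernel defines a compact operator on `L²`. -/
lemma exists_compact_kernel_operator {k : α × α → ℝ} (hk : MemLp k 2 (μ.prod μ)) :
    ∃ K : Lp ℝ 2 μ →L[ℝ] Lp ℝ 2 μ, IsCompactOperator K ∧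
      ∀ u : Lp ℝ 2 μ, K u =ᵐ[μ] fun x => ∫ z, k (x, z) * u z ∂μ := by
  have hsl := memLp_slice_left hk
  have hmeas : ∀ u : Lp ℝ 2 μ, AEStronglyMeasurable (fun x => ∫ z, k (x, z) * u z ∂μ) μ := by
    intro u
    exact (hk.1.mul ((Lp.aestronglyMeasurable u).comp_snd (μ := μ))).integral_prod_right'
  have hcs : ∀ (u : Lp ℝ 2 μ) x, MemLp (fun y => k (x, y)) 2 μ →
      ‖∫ z, k (x, z) * u z ∂μ‖ₑ ^ 2 ≤ (∫⁻ z, ‖k (x, z)‖ₑ ^ 2 ∂μ) * ‖u‖ₑ ^ 2 := by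
    intro u x hx
    rw [enorm_sq_Lp]
    calc _ ≤ (∫⁻ z, ‖k (x, z)‖ₑ * ‖u z‖ₑ ∂μ) ^ 2 := by
          gcongr
          refine (enorm_integral_le_lintegral_enorm _).trans (le_of_eq ?_)
          simp_rw [enorm_mul]
      _ ≤ _ := sq_lintegral_mul_le μ hx.1.enorm (Lp.aestronglyMeasurable u).enorm
  set B := ∫⁻ p, ‖k p‖ₑ ^ 2 ∂(μ.prod μ) with hB
  have hBtop : B < ⊤ := lintegral_enorm_sq_lt_top hk
  have hBeq : B = ∫⁻ x, ∫⁻ z, ‖k (x, z)‖ₑ ^ 2 ∂μ ∂μ := lintegral_prod _ (hk.1.enorm.pow_const 2)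
  have hL2 : ∀ u : Lp ℝ 2 μ,
      ∫⁻ x, ‖∫ z, k (x, z) * u z ∂μ‖ₑ ^ 2 ∂μ ≤ B * ‖u‖ₑ ^ 2 := by
    intro u
    calc _ ≤ ∫⁻ x, (∫⁻ z, ‖k (x, z)‖ₑ ^ 2 ∂μ) * ‖u‖ₑ ^ 2 ∂μ := by
          refine lintegral_mono_ae ?_
          filter_upwards [hsl] with x hx using hcs u x hx
      _ = _ := by
          rw [lintegral_mul_const' _ _ (by simp), hBeq]
  have hmem : ∀ u : Lp ℝ 2 μ, MemLp (fun x => ∫ z, k (x, z) * u z ∂μ) 2 μ := fun u =>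
    memLp_two_of_lintegral (hmeas u) ((hL2 u).trans_lt
      (ENNReal.mul_lt_top hBtop (by simp)))
  have hint : ∀ (u : Lp ℝ 2 μ), ∀ᵐ x ∂μ, Integrable (fun z => k (x, z) * u z) μ := by
    intro u
    filter_upwards [hsl] with x hx using hx.integrable_mul (Lp.memLp u)
  let K₀ : Lp ℝ 2 μ →ₗ[ℝ] Lp ℝ 2 μ :=
    { toFun := fun u => (hmem u).toLp
      map_add' := fun u v => by
        rw [← MemLp.toLp_add, MemLp.toLp_eq_toLp_iff]
        filter_upwards [hint u, hint v] with x hu hv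
        simp only [Pi.add_apply]
        rw [← integral_add hu hv]
        refine integral_congr_ae ?_
        filter_upwards [Lp.coeFn_add u v] with z hz
        rw [hz, Pi.add_apply, mul_add]
      map_smul' := fun c u => by
        rw [RingHom.id_apply, ← MemLp.toLp_const_smul, MemLp.toLp_eq_toLp_iff]
        filter_upwards with x
        simp only [Pi.smul_apply, smul_eq_mul]
        rw [← integral_const_mul]
        refine integral_congr_ae ?_
        filter_upwards [Lp.coeFn_smul c u] with z hz
        rw [hz, Pi.smul_apply, smul_eq_mul]; ring }
  have hK₀ : ∀ u, ‖K₀ u‖ₑ ^ 2 = ∫⁻ x, ‖∫ z, k (x, z) * u z ∂μ‖ₑ ^ 2 ∂μ := by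
    intro u
    rw [enorm_sq_Lp]
    refine lintegral_congr_ae ?_
    filter_upwards [(hmem u).coeFn_toLp] with x hx
    change ‖(hmem u).toLp _ x‖ₑ ^ 2 = _
    rw [hx]
  have hbd : ∀ u, ‖K₀ u‖ ≤ √B.toReal * ‖u‖ := by
    intro u
    have h1 := (hK₀ u).le.trans (hL2 u)
    have h2 := ENNReal.toReal_mono (ENNReal.mul_lt_top hBtop (by simp)).ne h1
    rw [ENNReal.toReal_mul, ENNReal.toReal_pow, ENNReal.toReal_pow, toReal_enorm,
      toReal_enorm] at h2
    refine le_of_sq_le_sq ?_ (by positivity)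
    rw [mul_pow, Real.sq_sqrt ENNReal.toReal_nonneg]
    exact h2
  refine ⟨K₀.mkContinuous _ hbd, ?_, fun u => (hmem u).coeFn_toLp⟩
  obtain ⟨w, b, -⟩ := exists_hilbertBasis ℝ (Lp ℝ 2 μ)
  refine isCompactOperator_of_summable_norm_sq b _ ?_
  refine summable_of_sum_le (c := B.toReal) (fun i => sq_nonneg _) fun F => ?_
  -- Bessel's inequality for the slice `k (x, ·)`, integrated over `x`.
  have h1 : ∑ i ∈ F, ‖K₀ (b i)‖ₑ ^ 2 ≤ B := by
    simp_rw [hK₀]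
    rw [← lintegral_finsetSum' _ fun i _ => ((hmeas (b i)).enorm.pow_const 2), hBeq]
    refine lintegral_mono_ae ?_
    filter_upwards [hsl] with x hx
    have h2 := Orthonormal.sum_inner_products_le (𝕜 := ℝ) hx.toLp (s := F) b.orthonormal
    have h3 : ∀ i, ⟪b i, hx.toLp⟫ = ∫ z, k (x, z) * b i z ∂μ := by
      intro i
      rw [L2.inner_def]
      refine integral_congr_ae ?_
      filter_upwards [hx.coeFn_toLp] with z hz
      rw [hz]; rfl
    have h4 : ∫⁻ z, ‖k (x, z)‖ₑ ^ 2 ∂μ = ENNReal.ofReal (‖hx.toLp‖ ^ 2) := by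
      rw [ENNReal.ofReal_pow (norm_nonneg _), ofReal_norm, enorm_sq_Lp]
      refine lintegral_congr_ae ?_
      filter_upwards [hx.coeFn_toLp] with z hz
      rw [hz]
    rw [h4]
    refine le_trans (le_of_eq ?_) (ENNReal.ofReal_le_ofReal h2)
    rw [ENNReal.ofReal_sum_of_nonneg fun i _ => sq_nonneg _]
    refine Finset.sum_congr rfl fun i _ => ?_
    rw [h3, ENNReal.ofReal_pow (norm_nonneg _), ofReal_norm]
  have h2 := ENNReal.toReal_mono hBtop.ne h1
  rw [ENNReal.toReal_sum fun i _ => by simp] at h2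
  simpa using h2

end Kernel

/-! ### Test functions -/

section TestFun

variable {F : Type*} [NormedAddCommGroup F] [NormedSpace ℝ F] {U : Set F} {ζ η : F → ℝ}

lemma IsTestFun.add (h₁ : IsTestFun U ζ) (h₂ : IsTestFun U η) : IsTestFun U (ζ + η) :=
  ⟨h₁.smooth.add h₂.smooth, h₁.compact.add h₂.compact,
    (tsupport_add ζ η).trans (union_subset h₁.support h₂.support)⟩

lemma IsTestFun.mul_smooth (h₁ : IsTestFun U ζ) (h₂ : ContDiff ℝ ∞ η) :
    IsTestFun U (fun x => ζ x * η x) :=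
  ⟨h₁.smooth.mul h₂, h₁.compact.mul_right,
    (tsupport_mul_subset_left (f := ζ) (g := η)).trans h₁.support⟩

lemma IsTestFun.const_smul (h₁ : IsTestFun U ζ) (c : ℝ) : IsTestFun U (c • ζ) := by
  have := h₁.mul_smooth (η := fun _ => c) contDiff_const
  convert this using 1
  ext x; simp [mul_comm]

lemma isTestFun_zero : IsTestFun U (0 : F → ℝ) :=
  ⟨contDiff_const, HasCompactSupport.zero, by simp [tsupport]⟩

lemma IsTestFun.fderiv_apply (h : IsTestFun U ζ) (e : F) :
    IsTestFun U (fun x => fderiv ℝ ζ x e) :=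
  ⟨(h.smooth.fderiv_right (by simp)).clm_apply contDiff_const, h.compact.fderiv_apply ℝ e,
    (tsupport_fderiv_apply_subset ℝ e).trans h.support⟩

lemma IsTestFun.eq_zero (h : IsTestFun U ζ) {x : F} (hx : x ∉ U) : ζ x = 0 :=
  image_eq_zero_of_notMem_tsupport fun h' => hx (h.support h')

lemma IsTestFun.differentiable (h : IsTestFun U ζ) : Differentiable ℝ ζ :=
  h.smooth.differentiable (by simp)

lemma IsTestFun.continuous (h : IsTestFun U ζ) : Continuous ζ := h.smooth.continuous

lemma IsTestFun.contDiff_one (h : IsTestFun U ζ) : ContDiff ℝ 1 ζ := h.smooth.of_le (by simp)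

end TestFun

section Gauss

variable {n : ℕ} {Ω : Set (E n)}

lemma norm_gradient (f : E n → ℝ) (x : E n) : ‖gradient f x‖ = ‖fderiv ℝ f x‖ := by
  simp [gradient]

lemma enorm_gradient (f : E n → ℝ) (x : E n) : ‖gradient f x‖ₑ = ‖fderiv ℝ f x‖ₑ := by
  rw [← ofReal_norm, ← ofReal_norm, norm_gradient]

lemma inner_gradient (f : E n → ℝ) (x e : E n) : ⟪gradient f x, e⟫ = fderiv ℝ f x e := by
  simp [gradient]

lemma gradient_add' {f g : E n → ℝ} (hf : Differentiable ℝ f) (hg : Differentiable ℝ g) (x : E n) :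
    gradient (f + g) x = gradient f x + gradient g x := by
  simp [gradient, fderiv_add (hf x) (hg x)]

lemma gradient_const_smul' {f : E n → ℝ} (hf : Differentiable ℝ f) (c : ℝ) (x : E n) :
    gradient (c • f) x = c • gradient f x := by
  simp [gradient, fderiv_const_smul (hf x)]

lemma memLp_of_continuous_compact {α F : Type*} [TopologicalSpace α] [MeasurableSpace α]
    [OpensMeasurableSpace α] [NormedAddCommGroup F] [SecondCountableTopologyEither α F]
    {f : α → F} (hf : Continuous f) (hc : HasCompactSupport f) (μ : Measure α)
    [IsFiniteMeasure μ] : MemLp f 2 μ := by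
  obtain ⟨C, hC⟩ := hc.exists_bound_of_continuous hf
  exact MemLp.of_bound hf.aestronglyMeasurable C (Eventually.of_forall hC)

lemma continuous_gradient {f : E n → ℝ} (hf : ContDiff ℝ 1 f) : Continuous (gradient f) :=
  (InnerProductSpace.toDual ℝ (E n)).symm.continuous.comp (hf.continuous_fderiv (by norm_num))

lemma hasCompactSupport_gradient {f : E n → ℝ} (hf : HasCompactSupport f) :
    HasCompactSupport (gradient f) :=
  (hf.fderiv ℝ).comp_left (g := (InnerProductSpace.toDual ℝ (E n)).symm) (by simp)

lemma IsTestFun.memLp {ζ : E n → ℝ} (h : IsTestFun Ω ζ) : MemLp ζ 2 ((gauss n).restrict Ω) :=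
  memLp_of_continuous_compact h.continuous h.compact _

lemma IsTestFun.memLp_gradient {ζ : E n → ℝ} (h : IsTestFun Ω ζ) :
    MemLp (gradient ζ) 2 ((gauss n).restrict Ω) :=
  memLp_of_continuous_compact (continuous_gradient h.contDiff_one)
    (hasCompactSupport_gradient h.compact) _

lemma setIntegral_gauss (hΩ : MeasurableSet Ω) {F : Type*} [NormedAddCommGroup F]
    [NormedSpace ℝ F] (f : E n → F) :
    ∫ x in Ω, f x ∂(gauss n) = ∫ x in Ω, dens x • f x := by
  rw [gauss_eq_withDensity, setIntegral_withDensity_eq_setIntegral_toReal_smul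
    (by have := @continuous_dens n; fun_prop) (by simp) _ hΩ]
  simp [(dens_pos _).le]

/-- The quotient of a test function by the Gaussian density; pairing with it in `L²(Ω, γ)` is
integration against the test function with respect to Lebesgue measure. -/
def divDens (χ : E n → ℝ) (x : E n) : ℝ := χ x * (dens x)⁻¹

lemma IsTestFun.divDens {χ : E n → ℝ} (h : IsTestFun Ω χ) : IsTestFun Ω (divDens χ) :=
  h.mul_smooth (contDiff_dens.inv fun x => (dens_pos x).ne')

lemma setIntegral_mul_divDens (hΩ : MeasurableSet Ω) (f χ : E n → ℝ) :
    ∫ x in Ω, f x * divDens χ x ∂(gauss n) = ∫ x in Ω, f x * χ x := by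
  rw [setIntegral_gauss hΩ]
  congr 1; ext x
  have := (dens_pos x).ne'
  simp only [OUTrace.divDens, smul_eq_mul]
  field_simp

/-- A locally integrable function orthogonal to all test functions vanishes, so test functions
are dense in `L²(Ω, γ)`. -/
lemma ae_eq_zero_of_forall_testFun (hΩ : IsOpen Ω) {u : E n → ℝ}
    (hu : MemLp u 2 ((gauss n).restrict Ω))
    (h : ∀ ζ, IsTestFun Ω ζ → ∫ x in Ω, u x * ζ x ∂(gauss n) = 0) :
    u =ᵐ[(gauss n).restrict Ω] 0 := by
  have hint : IntegrableOn u Ω (gauss n) := hu.integrable (by norm_num)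
  have := hΩ.ae_eq_zero_of_integral_contDiff_smul_eq_zero (μ := gauss n) (f := u)
    hint.locallyIntegrableOn (fun g g1 g2 g3 => by
      have hg : IsTestFun Ω g := ⟨g1, g2, g3⟩
      rw [← h g hg, ← integral_indicator hΩ.measurableSet]
      congr 1; ext x
      by_cases hx : x ∈ Ω
      · simp [hx, mul_comm]
      · simp [hx, hg.eq_zero hx])
  rw [EventuallyEq, ae_restrict_iff' hΩ.measurableSet]
  exact this

/-! ### The space `H¹₀(Ω, γ)` -/

/-- The ambient Hilbert space of pairs `(u, G)` of a function and a vector field. -/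
abbrev PairL2 (Ω : Set (E n)) : Type := WithLp 2 (L2 Ω × Lp (E n) 2 ((gauss n).restrict Ω))

/-- The pairs `(ζ, ∇ζ)` with `ζ ∈ C_c^∞(Ω)`. -/
def testPairs (Ω : Set (E n)) : Submodule ℝ (PairL2 Ω) where
  carrier := {w | ∃ ζ, IsTestFun Ω ζ ∧ w.fst =ᵐ[(gauss n).restrict Ω] ζ ∧
    w.snd =ᵐ[(gauss n).restrict Ω] gradient ζ}
  add_mem' := by
    rintro w w' ⟨ζ, hζ, h1, h2⟩ ⟨η, hη, h3, h4⟩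
    refine ⟨ζ + η, hζ.add hη, ?_, ?_⟩
    · rw [WithLp.add_fst]
      exact (Lp.coeFn_add _ _).trans (h1.add h3)
    · rw [WithLp.add_snd]
      refine (Lp.coeFn_add _ _).trans ((h2.add h4).trans ?_)
      filter_upwards with x
      exact (gradient_add' hζ.differentiable hη.differentiable x).symm
  zero_mem' := by
    refine ⟨0, isTestFun_zero, Lp.coeFn_zero _ _ _, (Lp.coeFn_zero _ _ _).trans ?_⟩
    filter_upwards with x
    simp [gradient]
  smul_mem' := by
    rintro c w ⟨ζ, hζ, h1, h2⟩
    refine ⟨c • ζ, hζ.const_smul c, ?_, ?_⟩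
    · rw [WithLp.smul_fst]
      exact (Lp.coeFn_smul _ _).trans (h1.const_smul c)
    · rw [WithLp.smul_snd]
      refine (Lp.coeFn_smul _ _).trans ((h2.const_smul c).trans ?_)
      filter_upwards with x
      exact (gradient_const_smul' hζ.differentiable c x).symm

/-- The graph of the gradient on `H¹₀(Ω, γ)`, a closed subspace of the space of pairs. -/
def H10 (Ω : Set (E n)) : Submodule ℝ (PairL2 Ω) := (testPairs Ω).topologicalClosure

instance (Ω : Set (E n)) : CompleteSpace (H10 Ω) :=
  (testPairs Ω).isClosed_topologicalClosure.completeSpace_coe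

/-- The element `(ζ, ∇ζ)` of `H¹₀(Ω, γ)` given by a test function. -/
def testPair {ζ : E n → ℝ} (h : IsTestFun Ω ζ) : PairL2 Ω :=
  WithLp.toLp 2 (h.memLp.toLp ζ, h.memLp_gradient.toLp (gradient ζ))

lemma testPair_mem_testPairs {ζ : E n → ℝ} (h : IsTestFun Ω ζ) : testPair h ∈ testPairs Ω :=
  ⟨ζ, h, h.memLp.coeFn_toLp, h.memLp_gradient.coeFn_toLp⟩

lemma testPair_mem {ζ : E n → ℝ} (h : IsTestFun Ω ζ) : testPair h ∈ H10 Ω :=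
  subset_closure (testPair_mem_testPairs h)

lemma exists_eq_testPair {w : PairL2 Ω} (hw : w ∈ testPairs Ω) :
    ∃ (ζ : E n → ℝ) (h : IsTestFun Ω ζ), w = testPair h := by
  obtain ⟨ζ, h, h1, h2⟩ := hw
  refine ⟨ζ, h, ?_⟩
  have e1 : w.fst = h.memLp.toLp ζ := Lp.ext (h1.trans h.memLp.coeFn_toLp.symm)
  have e2 : w.snd = h.memLp_gradient.toLp (gradient ζ) :=
    Lp.ext (h2.trans h.memLp_gradient.coeFn_toLp.symm)
  unfold testPair
  rw [← e1, ← e2]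
  rfl

/-- A closed property of pairs that holds for test functions holds on `H¹₀(Ω, γ)`. -/
lemma H10_induction {p : PairL2 Ω → Prop} (hp : IsClosed {w | p w})
    (h : ∀ (ζ : E n → ℝ) (hζ : IsTestFun Ω ζ), p (testPair hζ)) {w : PairL2 Ω} (hw : w ∈ H10 Ω) :
    p w := by
  refine closure_minimal (s := (testPairs Ω : Set (PairL2 Ω))) ?_ hp hw
  intro w' hw'
  obtain ⟨ζ, hζ, rfl⟩ := exists_eq_testPair hw'
  exact h ζ hζ

lemma hasH10Gradient_iff {u : E n → ℝ} {G : E n → E n} :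
    HasH10Gradient Ω u G ↔ ∃ w ∈ H10 Ω, w.fst =ᵐ[(gauss n).restrict Ω] u ∧
      w.snd =ᵐ[(gauss n).restrict Ω] G := by
  constructor
  · rintro ⟨hu, hG, ζ, hζ, h1, h2⟩
    refine ⟨WithLp.toLp 2 (hu.toLp u, hG.toLp G), ?_, hu.coeFn_toLp, hG.coeFn_toLp⟩
    refine mem_closure_of_tendsto (f := fun j => testPair (hζ j)) (b := atTop) ?_
      (Eventually.of_forall fun j => testPair_mem_testPairs (hζ j))
    refine ((WithLp.prod_continuous_toLp 2 _ _).tendsto _).comp (Tendsto.prodMk_nhds ?_ ?_)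
    · exact (Lp.tendsto_Lp_iff_tendsto_eLpNorm'' _ (fun j => (hζ j).memLp) _ hu).2 h1
    · exact (Lp.tendsto_Lp_iff_tendsto_eLpNorm'' _ (fun j => (hζ j).memLp_gradient) _ hG).2 h2
  · rintro ⟨w, hw, h1, h2⟩
    have hu : MemLp u 2 ((gauss n).restrict Ω) := (memLp_congr_ae h1).1 (Lp.memLp _)
    have hG : MemLp G 2 ((gauss n).restrict Ω) := (memLp_congr_ae h2).1 (Lp.memLp _)
    refine ⟨hu, hG, ?_⟩
    obtain ⟨x, hx, hlim⟩ := mem_closure_iff_seq_limit.1 hw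
    choose ζ hζ hxe using fun j => exists_eq_testPair (hx j)
    refine ⟨ζ, hζ, ?_, ?_⟩
    · have e1 : w.fst = hu.toLp u := Lp.ext (h1.trans hu.coeFn_toLp.symm)
      have := ((WithLp.continuous_fst 2 _ _).tendsto _).comp hlim
      rw [e1] at this
      refine (Lp.tendsto_Lp_iff_tendsto_eLpNorm'' _ (fun j => (hζ j).memLp) _ hu).1 ?_
      convert! this using 1
      ext1 j
      simp only [Function.comp, hxe]
      rfl
    · have e1 : w.snd = hG.toLp G := Lp.ext (h2.trans hG.coeFn_toLp.symm)
      have := ((WithLp.continuous_snd 2 _ _).tendsto _).comp hlim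
      rw [e1] at this
      refine (Lp.tendsto_Lp_iff_tendsto_eLpNorm'' _ (fun j => (hζ j).memLp_gradient) _ hG).1 ?_
      convert! this using 1
      ext1 j
      simp only [Function.comp, hxe]
      rfl

lemma hasH10Gradient_of_mem {w : PairL2 Ω} (hw : w ∈ H10 Ω) : HasH10Gradient Ω w.fst w.snd :=
  hasH10Gradient_iff.2 ⟨w, hw, ae_eq_rfl, ae_eq_rfl⟩

lemma inner_toLp {F : Type*} [NormedAddCommGroup F] [InnerProductSpace ℝ F] {α : Type*}
    [MeasurableSpace α] {μ : Measure α} {f : α → F} (hf : MemLp f 2 μ) (u : Lp F 2 μ) :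
    ⟪hf.toLp f, u⟫ = ∫ x, ⟪f x, u x⟫ ∂μ := by
  rw [L2.inner_def]
  refine integral_congr_ae ?_
  filter_upwards [hf.coeFn_toLp] with x hx
  rw [hx]

/-- The weak form of the gradient: elements of `H¹₀(Ω, γ)` satisfy the integration by parts
formula with respect to Lebesgue measure. -/
lemma H10_integral_fderiv (hΩ : IsOpen Ω) {w : PairL2 Ω} (hw : w ∈ H10 Ω) {χ : E n → ℝ}
    (hχ : IsTestFun Ω χ) (e : E n) :
    ∫ x in Ω, w.fst x * fderiv ℝ χ x e = -∫ x in Ω, ⟪w.snd x, e⟫ * χ x := by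
  have hm := hΩ.measurableSet
  have hd := (hχ.fderiv_apply e).divDens
  have hχ' := hχ.divDens
  have hv : MemLp (fun x => OUTrace.divDens χ x • e) 2 ((gauss n).restrict Ω) :=
    memLp_of_continuous_compact (hχ'.continuous.smul continuous_const)
      (hχ'.compact.smul_right) _
  have e1 : ∀ u : L2 Ω, ∫ x in Ω, u x * fderiv ℝ χ x e = ⟪hd.memLp.toLp _, u⟫ := by
    intro u
    rw [inner_toLp, ← setIntegral_mul_divDens hm]
    rfl
  have e2 : ∀ G : Lp (E n) 2 ((gauss n).restrict Ω),
      ∫ x in Ω, ⟪G x, e⟫ * χ x = ⟪hv.toLp _, G⟫ := by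
    intro G
    rw [inner_toLp, ← setIntegral_mul_divDens hm]
    congr 1; ext x
    rw [real_inner_smul_left, real_inner_comm, mul_comm]
  refine H10_induction (p := fun w => ∫ x in Ω, w.fst x * fderiv ℝ χ x e =
    -∫ x in Ω, ⟪w.snd x, e⟫ * χ x) ?_ ?_ hw
  · simp_rw [e1, e2]
    exact isClosed_eq (continuous_const.inner (WithLp.continuous_fst 2 _ _))
      (continuous_const.inner (WithLp.continuous_snd 2 _ _)).neg
  · intro ζ hζ
    simp only [testPair, WithLp.toLp_fst, WithLp.toLp_snd]
    have a1 : ∫ x in Ω, (hζ.memLp.toLp ζ) x * fderiv ℝ χ x e = ∫ x, ζ x * fderiv ℝ χ x e := by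
      rw [← setIntegral_mul_divDens hm]
      have : ∫ x in Ω, (hζ.memLp.toLp ζ) x * OUTrace.divDens (fun x => fderiv ℝ χ x e) x
          ∂(gauss n) = ∫ x in Ω, ζ x * OUTrace.divDens (fun x => fderiv ℝ χ x e) x ∂(gauss n) := by
        refine integral_congr_ae ?_
        filter_upwards [hζ.memLp.coeFn_toLp] with x hx
        rw [hx]
      rw [this, setIntegral_mul_divDens hm]
      exact setIntegral_eq_integral_of_forall_compl_eq_zero fun x hx => by
        rw [hζ.eq_zero hx, zero_mul]
    have a2 : ∫ x in Ω, ⟪(hζ.memLp_gradient.toLp (gradient ζ)) x, e⟫ * χ x =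
        ∫ x, fderiv ℝ ζ x e * χ x := by
      rw [← setIntegral_mul_divDens hm]
      have : ∫ x in Ω, ⟪(hζ.memLp_gradient.toLp (gradient ζ)) x, e⟫ * OUTrace.divDens χ x
          ∂(gauss n) = ∫ x in Ω, fderiv ℝ ζ x e * OUTrace.divDens χ x ∂(gauss n) := by
        refine integral_congr_ae ?_
        filter_upwards [hζ.memLp_gradient.coeFn_toLp] with x hx
        rw [hx, inner_gradient]
      rw [this, setIntegral_mul_divDens hm]
      exact setIntegral_eq_integral_of_forall_compl_eq_zero fun x hx => by
        rw [hχ.eq_zero hx, mul_zero]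
    rw [a1, a2]
    have hζ' := hζ.fderiv_apply e
    have hχd := hχ.fderiv_apply e
    refine integral_mul_fderiv_eq_neg_fderiv_mul_of_integrable ?_ ?_ ?_
      (fun x _ => hζ.differentiable x) (fun x _ => hχ.differentiable x)
    · exact (hζ'.continuous.mul hχ.continuous).integrable_of_hasCompactSupport
        hζ'.compact.mul_right
    · exact (hζ.continuous.mul hχd.continuous).integrable_of_hasCompactSupport
        hζ.compact.mul_right
    · exact (hζ.continuous.mul hχ.continuous).integrable_of_hasCompactSupport
        hζ.compact.mul_right

end Gauss

/-! ### The Dirichlet eigenvalue problem -/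

section Eigen

variable {n : ℕ} {Ω : Set (E n)}

lemma IsTestFun.fderiv_eq_zero {ζ : E n → ℝ} (h : IsTestFun Ω ζ) {x : E n} (hx : x ∉ Ω) :
    fderiv ℝ ζ x = 0 :=
  image_eq_zero_of_notMem_tsupport fun h' => hx (h.support (tsupport_fderiv_subset ℝ h'))

lemma enorm_sq_testPair_snd (hΩ : MeasurableSet Ω) {ζ : E n → ℝ} (h : IsTestFun Ω ζ) :
    ‖(testPair h).snd‖ₑ ^ 2 = ∫⁻ x, ‖fderiv ℝ ζ x‖ₑ ^ 2 ∂(gauss n) := by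
  have e : ∫⁻ x, ‖fderiv ℝ ζ x‖ₑ ^ 2 ∂(gauss n) = ∫⁻ x in Ω, ‖fderiv ℝ ζ x‖ₑ ^ 2 ∂(gauss n) := by
    rw [← lintegral_indicator hΩ]
    congr 1; ext x
    by_cases hx : x ∈ Ω
    · simp [hx]
    · rw [indicator_of_notMem hx, h.fderiv_eq_zero hx, ← ofReal_norm, norm_zero]; simp
  rw [enorm_sq_Lp, e]
  refine lintegral_congr_ae ?_
  filter_upwards [h.memLp_gradient.coeFn_toLp] with x hx
  rw [← enorm_gradient, ← hx]
  rfl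

/-- The Poincaré inequality on `H¹₀(Ω, γ)` for `γ(Ω) < 1`. -/
lemma exists_poincare (hΩ : IsOpen Ω) (hγ : gauss n Ω < 1) :
    ∃ C : ℝ, ∀ w ∈ H10 Ω, ‖w.fst‖ ^ 2 ≤ C * ‖w.snd‖ ^ 2 := by
  have hm := hΩ.measurableSet
  set c := gauss n Ωᶜ with hc
  have hc0 : c ≠ 0 := by
    intro h0
    have h1 := measure_add_measure_compl (μ := gauss n) hm
    rw [← hc, h0, add_zero, measure_univ] at h1
    exact hγ.ne h1
  have hcr : 0 < c.toReal := ENNReal.toReal_pos hc0 (measure_ne_top _ _)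
  set B : ℝ≥0∞ := ENNReal.ofReal (Real.pi / 2) ^ 2 * secondMoment n with hB
  have hBt : B ≠ ⊤ := ENNReal.mul_ne_top (by simp) (secondMoment_lt_top n).ne
  refine ⟨B.toReal / c.toReal, fun w hw => ?_⟩
  rw [div_mul_eq_mul_div, le_div_iff₀ hcr, mul_comm]
  refine H10_induction (p := fun w => c.toReal * ‖w.fst‖ ^ 2 ≤ B.toReal * ‖w.snd‖ ^ 2) ?_ ?_ hw
  · exact isClosed_le (continuous_const.mul ((WithLp.continuous_fst 2 _ _).norm.pow 2))
      (continuous_const.mul ((WithLp.continuous_snd 2 _ _).norm.pow 2))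
  · intro ζ hζ
    have h1 := poincare_of_support hm hζ.contDiff_one fun x hx => hζ.eq_zero hx
    rw [← enorm_sq_testPair_snd hm hζ, ← hc, ← hB] at h1
    have h2 : c * ‖(testPair hζ).fst‖ₑ ^ 2 ≤ B * ‖(testPair hζ).snd‖ₑ ^ 2 := by
      refine le_trans ?_ h1
      gcongr
      rw [enorm_sq_Lp]
      refine le_trans (le_of_eq (lintegral_congr_ae ?_)) (setLIntegral_le_lintegral Ω _)
      filter_upwards [hζ.memLp.coeFn_toLp] with x hx
      rw [← hx]; rfl
    have h3 := ENNReal.toReal_mono (ENNReal.mul_ne_top hBt (by simp)) h2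
    simpa using h3

/-- The Mehler operators, compact on `L²(Ω, γ)`, approximate the identity on `H¹₀(Ω, γ)`. -/
lemma exists_compact_approx (hΩ : IsOpen Ω) {θ : ℝ} (hθ : 0 < θ) (hθ' : θ < Real.pi / 2) :
    ∃ K : L2 Ω →L[ℝ] L2 Ω, IsCompactOperator K ∧ ∀ w ∈ H10 Ω,
      ‖w.fst - K w.fst‖ ≤ θ * √(secondMoment n).toReal * ‖w.snd‖ := by
  have hm := hΩ.measurableSet
  have hsin : 0 < Real.sin θ := Real.sin_pos_of_pos_of_lt_pi hθ (by linarith [Real.pi_pos])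
  have hcos : 0 ≤ Real.cos θ := Real.cos_nonneg_of_mem_Icc ⟨by linarith, by linarith⟩
  have hk : MemLp (mehler (n := n) (Real.cos θ) (Real.sin θ)) 2
      (((gauss n).restrict Ω).prod ((gauss n).restrict Ω)) := by
    rw [Measure.prod_restrict]
    exact (memLp_mehler hsin (Real.cos_sq_add_sin_sq θ) hcos).restrict _
  obtain ⟨K, hK, hKu⟩ := exists_compact_kernel_operator hk
  refine ⟨K, hK, fun w hw => ?_⟩
  refine H10_induction (p := fun w => ‖w.fst - K w.fst‖ ≤
    θ * √(secondMoment n).toReal * ‖w.snd‖) ?_ ?_ hw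
  · exact isClosed_le ((WithLp.continuous_fst 2 _ _).sub
      (K.continuous.comp (WithLp.continuous_fst 2 _ _))).norm
      (continuous_const.mul (WithLp.continuous_snd 2 _ _).norm)
  · intro ζ hζ
    have h1 := lintegral_sub_mehler_le hζ.contDiff_one hζ.compact hθ hθ'
    rw [← enorm_sq_testPair_snd hm hζ] at h1
    have h2 : ‖(testPair hζ).fst - K (testPair hζ).fst‖ₑ ^ 2 ≤
        ENNReal.ofReal θ ^ 2 * secondMoment n * ‖(testPair hζ).snd‖ₑ ^ 2 := by
      refine le_trans ?_ h1
      rw [enorm_sq_Lp]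
      refine le_trans (le_of_eq (lintegral_congr_ae ?_)) (setLIntegral_le_lintegral Ω _)
      filter_upwards [hζ.memLp.coeFn_toLp, Lp.coeFn_sub (testPair hζ).fst (K (testPair hζ).fst),
        hKu (testPair hζ).fst] with x hx hx2 hx3
      have e1 : (testPair hζ).fst x = ζ x := hx
      have e2 : ∫ z, mehler (Real.cos θ) (Real.sin θ) (x, z) * (testPair hζ).fst z
          ∂((gauss n).restrict Ω) =
          ∫ z, mehler (Real.cos θ) (Real.sin θ) (x, z) * ζ z ∂(gauss n) := by
        refine Eq.trans (integral_congr_ae ?_)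
          (setIntegral_eq_integral_of_forall_compl_eq_zero (s := Ω) fun z hz => by
            rw [hζ.eq_zero hz, mul_zero])
        filter_upwards [hζ.memLp.coeFn_toLp] with z hz
        exact congrArg _ hz
      rw [hx2, Pi.sub_apply, hx3, e1, e2]
    have h3 := ENNReal.toReal_mono (ENNReal.mul_ne_top (ENNReal.mul_ne_top (by simp)
      (secondMoment_lt_top n).ne) (by simp)) h2
    refine le_of_sq_le_sq ?_ (by positivity)
    rw [mul_pow, mul_pow, Real.sq_sqrt ENNReal.toReal_nonneg]
    simpa [ENNReal.toReal_ofReal hθ.le] using h3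

/-- The embedding `H¹₀(Ω, γ) → L²(Ω, γ)`. -/
def embed (Ω : Set (E n)) : H10 Ω →L[ℝ] L2 Ω :=
  (WithLp.fstL 2 ℝ (L2 Ω) (Lp (E n) 2 ((gauss n).restrict Ω))).comp (H10 Ω).subtypeL

lemma embed_apply (w : H10 Ω) : embed Ω w = (w : PairL2 Ω).fst := rfl

lemma norm_snd_le (w : PairL2 Ω) : ‖w.snd‖ ≤ ‖w‖ := by
  have h := WithLp.prod_norm_sq_eq_of_L2 w
  refine le_of_sq_le_sq ?_ (norm_nonneg _)
  rw [h]
  linarith [sq_nonneg ‖w.fst‖]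

lemma isCompactOperator_of_approx {V H' : Type*} [NormedAddCommGroup V] [NormedSpace ℝ V]
    [NormedAddCommGroup H'] [NormedSpace ℝ H'] [CompleteSpace H'] (ι : V →L[ℝ] H')
    (K : ℕ → V →L[ℝ] H') (hK : ∀ j, IsCompactOperator (K j)) {ε : ℕ → ℝ} (hε0 : ∀ j, 0 ≤ ε j) (hε : Tendsto ε atTop (𝓝 0))
    (h : ∀ j w, ‖ι w - K j w‖ ≤ ε j * ‖w‖) : IsCompactOperator ι := by
  refine isCompactOperator_of_tendsto (l := atTop) (F := K) ?_ (Eventually.of_forall hK)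
  rw [tendsto_iff_norm_sub_tendsto_zero]
  refine squeeze_zero (fun _ => norm_nonneg _) (fun j => ?_) hε
  rw [norm_sub_rev]
  exact ContinuousLinearMap.opNorm_le_bound _ (hε0 j) (h j)

/-- The embedding of `H¹₀(Ω, γ)` into `L²(Ω, γ)` is compact, even if `Ω` is unbounded: it is a norm
limit of Mehler operators. -/
lemma isCompactOperator_embed (hΩ : IsOpen Ω) : IsCompactOperator (embed Ω) := by
  have hθ : ∀ j : ℕ, (0 : ℝ) < 1 / ((j : ℝ) + 1) := fun j => by positivity
  have hθ' : ∀ j : ℕ, 1 / ((j : ℝ) + 1) < Real.pi / 2 := fun j => by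
    have h1 : 1 / ((j : ℝ) + 1) ≤ 1 := by
      rw [div_le_one (by positivity)]
      linarith [(Nat.cast_nonneg j : (0 : ℝ) ≤ j)]
    linarith [Real.pi_gt_three]
  choose K hK hKw using fun j => exists_compact_approx hΩ (hθ j) (hθ' j)
  have hlim : Tendsto (fun j : ℕ => 1 / ((j : ℝ) + 1) * √(secondMoment n).toReal) atTop (𝓝 0) := by
    simpa using (tendsto_one_div_add_atTop_nhds_zero_nat (𝕜 := ℝ)).mul_const
      (√(secondMoment n).toReal)
  refine isCompactOperator_of_approx (embed Ω) (fun j => (K j).comp (embed Ω))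
    (fun j => (hK j).comp_clm (embed Ω)) (fun j => by positivity) hlim fun j w => ?_
  refine (hKw j w w.2).trans ?_
  gcongr
  exact norm_snd_le _

lemma gauss_ne_zero_of_isOpen {U : Set (E n)} (hU : IsOpen U) (hne : U.Nonempty) : gauss n U ≠ 0 := by
  have hac : (volume : Measure (E n)) ≪ gauss n := by
    rw [gauss_eq_withDensity]
    refine withDensity_absolutelyContinuous' ?_ ?_
    · exact (continuous_dens.measurable.ennreal_ofReal).aemeasurable
    · filter_upwards with x
      simp [dens_pos]
  exact fun h => (hU.measure_pos volume hne).ne' (hac h)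

/-- Disjoint open subsets of `Ω` give infinitely many orthogonal indicator functions. -/
lemma not_finiteDimensional_L2 (hΩ : IsOpen Ω) (hne : Ω.Nonempty) (hγ : gauss n Ω < 1) :
    ¬ FiniteDimensional ℝ (L2 Ω) := by
  obtain ⟨x, hx⟩ := hne
  -- In dimension zero a nonempty set is the whole space, which has measure one.
  have hnt : Nontrivial (E n) := by
    have : Ωᶜ.Nonempty := by
      rw [nonempty_compl]
      rintro rfl
      simp at hγ
    obtain ⟨y, hy⟩ := this
    exact ⟨x, y, fun h => hy (h ▸ hx)⟩
  have hinf : Infinite Ω := (infinite_of_mem_nhds x (hΩ.mem_nhds hx)).to_subtype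
  obtain ⟨U, hU1, hU2, hU3⟩ := exists_seq_infinite_isOpen_pairwise_disjoint Ω
  let W : ℕ → Set (E n) := fun k => Subtype.val '' U k
  have hWo : ∀ k, IsOpen (W k) := fun k => hΩ.isOpenMap_subtype_val _ (hU2 k)
  have hWn : ∀ k, (W k).Nonempty := fun k => (hU1 k).nonempty.image _
  have hWs : ∀ k, W k ⊆ Ω := fun k => by rintro _ ⟨y, -, rfl⟩; exact y.2
  have hWd : ∀ j k, j ≠ k → W j ∩ W k = ∅ := fun j k hjk => by
    rw [← disjoint_iff_inter_eq_empty]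
    exact (disjoint_image_iff Subtype.val_injective).2 (hU3 hjk)
  have hWm := fun k => (hWo k).measurableSet
  intro hfin
  let f : ℕ → L2 Ω := fun k =>
    indicatorConstLp 2 (hWm k) (measure_ne_top ((gauss n).restrict Ω) (W k)) (1 : ℝ)
  have hf : LinearIndependent ℝ f := by
    refine linearIndependent_of_ne_zero_of_inner_eq_zero (fun k h0 => ?_) fun j k hjk => ?_
    · have h1 : ⟪f k, f k⟫ = 0 := by rw [h0]; simp
      rw [L2.real_inner_indicatorConstLp_one_indicatorConstLp_one, inter_self,
        Measure.real, Measure.restrict_apply (hWm k), inter_eq_left.2 (hWs k),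
        ENNReal.toReal_eq_zero_iff] at h1
      exact h1.elim (gauss_ne_zero_of_isOpen (hWo k) (hWn k)) (measure_ne_top _ _)
    · have h1 : ⟪f j, f k⟫ = 0 := by
        rw [L2.real_inner_indicatorConstLp_one_indicatorConstLp_one, hWd j k hjk]
        simp
      exact h1
  exact Set.infinite_univ (α := ℕ) (by
    have := hf.finite_of_isNoetherian
    exact Set.toFinite _)

/-- If `ι : V → H` is a compact operator with dense range, the eigenvectors of `ι ι†` are an
orthonormal basis of `H`, and they solve the eigenvalue problem for the two inner products. -/
lemma exists_hilbertBasis_of_compact_embedding {V H : Type*} [NormedAddCommGroup V]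
    [InnerProductSpace ℝ V] [CompleteSpace V] [NormedAddCommGroup H] [InnerProductSpace ℝ H]
    [CompleteSpace H] (hinf : ¬ FiniteDimensional ℝ H) (ι : V →L[ℝ] H) (hι : IsCompactOperator ι)
    (hdense : ∀ x, (∀ w, ⟪x, ι w⟫ = 0) → x = 0) :
    ∃ (b : HilbertBasis ℕ ℝ H) (m : ℕ → ℝ) (W : ℕ → V), (∀ k, 0 < m k) ∧ Antitone m ∧
      Tendsto m atTop (𝓝 0) ∧ ∀ k, ι (W k) = b k ∧ ∀ w, ⟪W k, w⟫ = (m k)⁻¹ * ⟪b k, ι w⟫ := by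
  obtain ⟨b, m, hm0, hmanti, hmlim, hTb⟩ := exists_hilbertBasis_eigenvectors hinf
    (T := ι.comp ι.adjoint) (hι.comp_clm ι.adjoint)
    (fun x y => by
      simp only [ContinuousLinearMap.coe_coe, ContinuousLinearMap.comp_apply]
      rw [← ContinuousLinearMap.adjoint_inner_right, ContinuousLinearMap.adjoint_inner_left])
    (fun x hx => by
      rw [ContinuousLinearMap.comp_apply, ← ContinuousLinearMap.adjoint_inner_right,
        real_inner_self_eq_norm_sq]
      refine pow_pos (norm_pos_iff.2 fun h0 => hx (hdense x fun w => ?_)) 2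
      rw [← ContinuousLinearMap.adjoint_inner_left, h0, inner_zero_left])
  refine ⟨b, m, fun k => (m k)⁻¹ • ι.adjoint (b k), hm0, hmanti, hmlim, fun k => ⟨?_, fun w => ?_⟩⟩
  · have := hTb k
    simp only [ContinuousLinearMap.comp_apply] at this
    rw [map_smul, this, smul_smul, inv_mul_cancel₀ (hm0 k).ne', one_smul]
  · rw [real_inner_smul_left, ContinuousLinearMap.adjoint_inner_left]

/-- The eigenfunctions of the Dirichlet problem are those of the compact operator `ι ι†`, where
`ι` is the embedding of `H¹₀(Ω, γ)` into `L²(Ω, γ)`; an eigenvalue `m` of the latter corresponds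
to the eigenvalue `1 / m - 1` of the former. -/
theorem exists_eigenSystem (hΩ : IsOpen Ω) (hne : Ω.Nonempty) (hγ : gauss n Ω < 1) :
    ∃ (lam : ℕ → ℝ) (ψ : HilbertBasis ℕ ℝ (L2 Ω)), IsDirichletEigenSystem Ω lam ψ := by
  obtain ⟨b, m, W, hm0, hmanti, hmlim, hW⟩ := exists_hilbertBasis_of_compact_embedding
    (not_finiteDimensional_L2 hΩ hne hγ) (embed Ω) (isCompactOperator_embed hΩ) (fun x hx => by
      refine (Lp.eq_zero_iff_ae_eq_zero).2 (ae_eq_zero_of_forall_testFun hΩ (Lp.memLp x) ?_)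
      intro ζ hζ
      have h1 := hx ⟨testPair hζ, testPair_mem hζ⟩
      rw [embed_apply, real_inner_comm] at h1
      change ⟪hζ.memLp.toLp ζ, x⟫ = 0 at h1
      rw [inner_toLp] at h1
      exact h1)
  have hWfst : ∀ k, (W k : PairL2 Ω).fst = b k := fun k => (hW k).1
  have hWin : ∀ k (w : PairL2 Ω), w ∈ H10 Ω →
      ⟪(W k : PairL2 Ω).snd, w.snd⟫ = ((m k)⁻¹ - 1) * ⟪b k, w.fst⟫ := fun k w hw => by
    have h2 := (hW k).2 ⟨w, hw⟩
    rw [Submodule.coe_inner, WithLp.prod_inner_apply, embed_apply] at h2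
    change ⟪(W k : PairL2 Ω).fst, w.fst⟫ + ⟪(W k : PairL2 Ω).snd, w.snd⟫ =
      (m k)⁻¹ * ⟪b k, w.fst⟫ at h2
    rw [hWfst] at h2
    linarith
  obtain ⟨C, hC⟩ := exists_poincare hΩ hγ
  refine ⟨fun k => (m k)⁻¹ - 1, b, ?_, ?_, ?_, ?_⟩
  · -- For the eigenvalue zero the gradient of `W k` would vanish, against the Poincaré inequality
    -- and `‖b k‖ = 1`.
    intro k
    have h1 := hC (W k) (W k).2
    have h2 := hWin k (W k) (W k).2
    rw [hWfst, real_inner_self_eq_norm_sq, real_inner_self_eq_norm_sq, b.orthonormal.1 k] at h2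
    rw [hWfst, b.orthonormal.1 k, h2] at h1
    have h3 : 0 ≤ (m k)⁻¹ - 1 := by
      have := sq_nonneg ‖(W k : PairL2 Ω).snd‖
      rw [h2] at this
      linarith
    refine lt_of_le_of_ne h3 fun h => ?_
    rw [← h] at h1
    norm_num at h1
  · intro j k hjk
    have := inv_anti₀ (hm0 k) (hmanti hjk)
    simp only
    linarith
  · refine tendsto_atTop_add_const_right _ (-1) ?_
    exact (tendsto_nhdsWithin_iff.2 ⟨hmlim, Eventually.of_forall hm0⟩).inv_tendsto_nhdsGT_zero
  · intro k
    refine ⟨(W k : PairL2 Ω).snd, ?_, fun ζ hζ => ?_⟩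
    · have := hasH10Gradient_of_mem (W k).2
      rwa [hWfst] at this
    · have h1 := hWin k _ (testPair_mem hζ)
      rw [real_inner_comm, real_inner_comm (testPair hζ).fst] at h1
      change ⟪hζ.memLp_gradient.toLp _, _⟫ = _ * ⟪hζ.memLp.toLp _, _⟫ at h1
      rw [inner_toLp, inner_toLp] at h1
      convert! h1 using 1
      congr 1; ext x
      rw [real_inner_comm]

/-- The eigenfunctions together with their gradients, as elements of `H¹₀(Ω, γ)`. -/
lemma IsDirichletEigenSystem.exists_pair {lam : ℕ → ℝ} {ψ : HilbertBasis ℕ ℝ (L2 Ω)}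
    (h : IsDirichletEigenSystem Ω lam ψ) : ∃ W : ℕ → PairL2 Ω, ∀ k, W k ∈ H10 Ω ∧
      (W k).fst = ψ k ∧ ∀ w ∈ H10 Ω, ⟪(W k).snd, w.snd⟫ = lam k * ⟪ψ k, w.fst⟫ := by
  have : ∀ k, ∃ W : PairL2 Ω, W ∈ H10 Ω ∧
      W.fst = ψ k ∧ ∀ w ∈ H10 Ω, ⟪W.snd, w.snd⟫ = lam k * ⟪ψ k, w.fst⟫ := by
    intro k
    obtain ⟨G, hG, hζ⟩ := h.eigen k
    obtain ⟨W, hW, h1, h2⟩ := hasH10Gradient_iff.1 hG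
    refine ⟨W, hW, Lp.ext h1, fun w hw => ?_⟩
    refine H10_induction (p := fun w => ⟪W.snd, w.snd⟫ = lam k * ⟪ψ k, w.fst⟫) ?_ ?_ hw
    · exact isClosed_eq (continuous_const.inner (WithLp.continuous_snd 2 _ _))
        (continuous_const.mul (continuous_const.inner (WithLp.continuous_fst 2 _ _)))
    · intro ζ hz
      have h3 := hζ ζ hz
      rw [real_inner_comm, real_inner_comm (testPair hz).fst]
      change ⟪hz.memLp_gradient.toLp _, _⟫ = _ * ⟪hz.memLp.toLp _, _⟫
      rw [inner_toLp, inner_toLp]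
      convert! h3 using 1
      refine integral_congr_ae ?_
      filter_upwards [h2] with x hx
      rw [hx, real_inner_comm]
  choose W hW using this
  exact ⟨W, hW⟩

end Eigen

/-! ### The modified Bessel function -/

/-- The integrand of `besselProfile`. -/
def profileIntegrand (ν z t : ℝ) : ℝ :=
  Real.exp (ν * t - Real.exp t - z ^ 2 / 4 * Real.exp (-t))

/-- The function `2^{1-ν} z^ν K_ν(z)`, in a form that makes sense up to `z = 0`; it is obtained
from the integral for `K_ν` by translating the variable by `log (z / 2)`. -/
def besselProfile (ν z : ℝ) : ℝ := ∫ t, profileIntegrand ν z t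

lemma continuous_profileIntegrand (ν z : ℝ) : Continuous (profileIntegrand ν z) := by
  unfold profileIntegrand; fun_prop

lemma profileIntegrand_pos (ν z t : ℝ) : 0 < profileIntegrand ν z t := Real.exp_pos _

lemma profileIntegrand_le_zero (ν z t : ℝ) : profileIntegrand ν z t ≤ profileIntegrand ν 0 t := by
  unfold profileIntegrand
  refine Real.exp_le_exp.2 ?_
  have : 0 ≤ z ^ 2 / 4 * Real.exp (-t) := by positivity
  simp only [ne_eq, OfNat.ofNat_ne_zero, not_false_eq_true, zero_pow, zero_div, zero_mul, sub_zero]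
  linarith

/-- The substitution `u = exp t` in Euler's integral for the Gamma function. -/
lemma abs_exp_smul_eq (ν t : ℝ) :
    |Real.exp t| • (Real.exp (-Real.exp t) * Real.exp t ^ (ν - 1)) = profileIntegrand ν 0 t := by
  unfold profileIntegrand
  rw [abs_of_pos (Real.exp_pos t), smul_eq_mul, Real.rpow_def_of_pos (Real.exp_pos t),
    Real.log_exp, ← Real.exp_add, ← Real.exp_add]
  congr 1; ring

lemma integrable_profile_zero {ν : ℝ} (hν : 0 < ν) : Integrable (profileIntegrand ν 0) := by
  have h := Real.GammaIntegral_convergent hν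
  rw [← Real.range_exp, ← image_univ, integrableOn_image_iff_integrableOn_abs_deriv_smul
    MeasurableSet.univ (fun x _ => (Real.hasDerivAt_exp x).hasDerivWithinAt)
    Real.exp_injective.injOn] at h
  rw [integrableOn_univ] at h
  simpa only [abs_exp_smul_eq] using h

lemma besselProfile_zero {ν : ℝ} (hν : 0 < ν) : besselProfile ν 0 = Real.Gamma ν := by
  rw [Real.Gamma_eq_integral hν, ← Real.range_exp, ← image_univ,
    integral_image_eq_integral_abs_deriv_smul MeasurableSet.univ
      (fun x _ => (Real.hasDerivAt_exp x).hasDerivWithinAt) Real.exp_injective.injOn,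
    setIntegral_univ]
  simp only [abs_exp_smul_eq]
  rfl

lemma integrable_profile {ν : ℝ} (hν : 0 < ν) (z : ℝ) : Integrable (profileIntegrand ν z) :=
  (integrable_profile_zero hν).mono' (continuous_profileIntegrand ν z).aestronglyMeasurable
    (Eventually.of_forall fun t => by
      rw [Real.norm_of_nonneg (profileIntegrand_pos _ _ _).le]
      exact profileIntegrand_le_zero ν z t)

lemma besselProfile_nonneg (ν z : ℝ) : 0 ≤ besselProfile ν z :=
  integral_nonneg fun t => (profileIntegrand_pos ν z t).le

lemma besselProfile_le_Gamma {ν : ℝ} (hν : 0 < ν) (z : ℝ) : besselProfile ν z ≤ Real.Gamma ν := by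
  rw [← besselProfile_zero hν]
  exact integral_mono (integrable_profile hν z) (integrable_profile hν 0)
    (profileIntegrand_le_zero ν z)

lemma continuous_besselProfile {ν : ℝ} (hν : 0 < ν) : Continuous (besselProfile ν) := by
  refine continuous_of_dominated (bound := profileIntegrand ν 0)
    (fun z => (continuous_profileIntegrand ν z).aestronglyMeasurable)
    (fun z => Eventually.of_forall fun t => ?_) (integrable_profile_zero hν)
    (Eventually.of_forall fun t => ?_)
  · rw [Real.norm_of_nonneg (profileIntegrand_pos _ _ _).le]
    exact profileIntegrand_le_zero ν z t
  · unfold profileIntegrand; fun_prop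

/-- Exponential decay. Half of `exp t` in the exponent is kept for integrability, the other half yields the decay. -/
lemma exists_besselProfile_le {ν : ℝ} (hν : 0 < ν) :
    ∃ C : ℝ, 0 ≤ C ∧ ∀ z, besselProfile ν z ≤ C * Real.exp (-(z / 2)) := by
  have hint : Integrable fun t : ℝ => Real.exp (ν * t - Real.exp t / 2) := by
    have h := ((integrable_profile_zero hν).comp_add_right (-Real.log 2)).const_mul
      (Real.exp (ν * Real.log 2))
    refine h.congr (Eventually.of_forall fun t => ?_)
    simp only [profileIntegrand]
    rw [← Real.exp_add, Real.exp_add t, Real.exp_neg (Real.log 2), Real.exp_log (by norm_num)]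
    congr 1; ring
  refine ⟨∫ t, Real.exp (ν * t - Real.exp t / 2), integral_nonneg fun t => (Real.exp_pos _).le,
    fun z => ?_⟩
  rw [besselProfile, ← integral_mul_const]
  refine integral_mono (integrable_profile hν z) (hint.mul_const _) fun t => ?_
  simp only [profileIntegrand]
  rw [← Real.exp_add]
  refine Real.exp_le_exp.2 ?_
  have h1 : z / 2 ≤ Real.exp t / 2 + z ^ 2 / 4 * Real.exp (-t) := by
    have ht := Real.exp_pos t
    rw [Real.exp_neg, ← mul_le_mul_iff_of_pos_right ht]
    field_simp
    nlinarith [sq_nonneg (Real.exp t - z), sq_nonneg (Real.exp t), sq_nonneg z]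
  linarith

lemma profile_shift {ν z : ℝ} (hz : 0 < z) (t : ℝ) :
    profileIntegrand ν z (t + Real.log (z / 2)) =
      (z / 2) ^ ν * (Real.exp (-z * Real.cosh t) * Real.exp (ν * t)) := by
  have hz2 : 0 < z / 2 := by positivity
  unfold profileIntegrand
  rw [Real.rpow_def_of_pos hz2, ← Real.exp_add, ← Real.exp_add, Real.exp_add t, neg_add,
    Real.exp_add (-t), Real.exp_neg (Real.log _), Real.exp_log hz2, Real.cosh_eq]
  congr 1
  field_simp
  ring

/-- The relation between `besselProfile` and the Bessel function. -/
lemma rpow_mul_besselK {ν z : ℝ} (hν : 0 < ν) (hz : 0 < z) :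
    z ^ ν * besselK ν z = 2 ^ (ν - 1) * besselProfile ν z := by
  have hz2 : 0 < z / 2 := by positivity
  have hint : Integrable fun t => Real.exp (-z * Real.cosh t) * Real.exp (ν * t) := by
    have h := ((integrable_profile hν z).comp_add_right (Real.log (z / 2))).const_mul
      ((z / 2) ^ ν)⁻¹
    refine h.congr (Eventually.of_forall fun t => ?_)
    simp only
    rw [profile_shift hz, inv_mul_cancel_left₀ (Real.rpow_pos_of_pos hz2 ν).ne']
  have hJ : besselProfile ν z =
      (z / 2) ^ ν * ∫ t, Real.exp (-z * Real.cosh t) * Real.exp (ν * t) := by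
    rw [besselProfile, ← integral_add_right_eq_self _ (Real.log (z / 2)), ← integral_const_mul]
    simp_rw [profile_shift hz]
  have hneg : ∫ t, Real.exp (-z * Real.cosh t) * Real.exp (-(ν * t)) =
      ∫ t, Real.exp (-z * Real.cosh t) * Real.exp (ν * t) := by
    rw [← integral_neg_eq_self]
    congr 1; ext t
    rw [Real.cosh_neg]
    congr 2; ring
  have hint' : Integrable fun t => Real.exp (-z * Real.cosh t) * Real.exp (-(ν * t)) := by
    refine hint.comp_neg.congr (Eventually.of_forall fun t => ?_)
    simp only [Real.cosh_neg]
    congr 2; ring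
  have hK : 2 * besselK ν z = ∫ t, Real.exp (-z * Real.cosh t) * Real.exp (ν * t) := by
    have h1 := integral_comp_abs (f := fun t => Real.exp (-z * Real.cosh t) * Real.cosh (ν * t))
    rw [besselK, ← h1]
    have e : ∀ t : ℝ, Real.exp (-z * Real.cosh |t|) * Real.cosh (ν * |t|) =
        (Real.exp (-z * Real.cosh t) * Real.exp (ν * t) +
          Real.exp (-z * Real.cosh t) * Real.exp (-(ν * t))) / 2 := by
      intro t
      have e1 : Real.cosh (ν * |t|) = Real.cosh (ν * t) := by
        rcases abs_choice t with h | h <;> rw [h]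
        rw [mul_neg, Real.cosh_neg]
      rw [Real.cosh_abs, e1, Real.cosh_eq (ν * t)]
      ring
    simp_rw [e]
    rw [integral_div, integral_add hint hint', hneg]
    ring
  rw [hJ, ← hK, Real.div_rpow hz.le (by norm_num), Real.rpow_sub (by norm_num), Real.rpow_one]
  have : (0 : ℝ) < 2 ^ ν := by positivity
  field_simp

/-- Reflecting the variable at `log (z / 2)` exchanges the orders `-μ` and `μ`. -/
lemma integral_profile_neg (μ : ℝ) {z : ℝ} (hz : 0 < z) :
    ∫ t, profileIntegrand (-μ) z t = (z / 2) ^ (-2 * μ) * besselProfile μ z := by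
  have hz2 : 0 < z / 2 := by positivity
  rw [besselProfile, ← integral_sub_left_eq_self _ volume (2 * Real.log (z / 2)),
    ← integral_const_mul]
  congr 1; ext t
  unfold profileIntegrand
  have e1 : Real.exp (2 * Real.log (z / 2)) = (z / 2) ^ 2 := by
    rw [two_mul, Real.exp_add, Real.exp_log hz2, sq]
  have e2 : Real.exp (2 * Real.log (z / 2) - t) = (z / 2) ^ 2 * Real.exp (-t) := by
    rw [sub_eq_add_neg, Real.exp_add, e1]
  have e3 : Real.exp (-(2 * Real.log (z / 2) - t)) = Real.exp t / (z / 2) ^ 2 := by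
    rw [neg_sub, Real.exp_sub, e1]
  rw [Real.rpow_def_of_pos hz2, ← Real.exp_add, e2, e3]
  congr 1
  field_simp
  ring

/-- The recurrence relation `(z^ν K_ν)' = -z^ν K_{1-ν}`. -/
lemma hasDerivAt_besselProfile {ν : ℝ} (hν : 0 < ν) {z : ℝ} (hz : 0 < z) :
    HasDerivAt (besselProfile ν) (-(z / 2) ^ (2 * ν - 1) * besselProfile (1 - ν) z) z := by
  let F' : ℝ → ℝ → ℝ := fun x t => -(x / 2) * profileIntegrand (ν - 1) x t
  have hd : ∀ x t, HasDerivAt (fun x => profileIntegrand ν x t) (F' x t) x := by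
    intro x t
    have h1 : HasDerivAt (fun x : ℝ => ν * t - Real.exp t - x ^ 2 / 4 * Real.exp (-t))
        (-(2 * x / 4 * Real.exp (-t))) x := by
      have := ((((hasDerivAt_id x).pow 2).div_const 4).mul_const (Real.exp (-t))).const_sub
        (ν * t - Real.exp t)
      simpa using this
    refine h1.exp.congr_deriv ?_
    simp only [F', profileIntegrand]
    rw [show (ν - 1) * t - Real.exp t - x ^ 2 / 4 * Real.exp (-t) =
      (ν * t - Real.exp t - x ^ 2 / 4 * Real.exp (-t)) + -t by ring, Real.exp_add _ (-t)]
    ring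
  have hbd : ∀ t, ∀ x ∈ Ioo (z / 2) (2 * z),
      ‖F' x t‖ ≤ z * (16 / z ^ 2) * profileIntegrand ν 0 t := by
    intro t x hx
    have hx0 : 0 < x := by linarith [hx.1]
    have e : profileIntegrand (ν - 1) x t = profileIntegrand ν 0 t *
        (Real.exp (-t) * Real.exp (-(x ^ 2 / 4 * Real.exp (-t)))) := by
      unfold profileIntegrand
      rw [← Real.exp_add, ← Real.exp_add]
      congr 1; ring
    -- The bound `u exp (-x² u / 4) ≤ 4 / x²` with `u = exp (-t)`, where `x > z / 2`.
    have hu : Real.exp (-t) * Real.exp (-(x ^ 2 / 4 * Real.exp (-t))) ≤ 16 / z ^ 2 := by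
      set u := Real.exp (-t) with hu
      have hu0 : 0 < u := Real.exp_pos _
      have h2 : x ^ 2 / 4 * u ≤ Real.exp (x ^ 2 / 4 * u) := by
        linarith [Real.add_one_le_exp (x ^ 2 / 4 * u)]
      rw [Real.exp_neg, ← div_eq_mul_inv, div_le_div_iff₀ (Real.exp_pos _) (by positivity)]
      have h3 : z ^ 2 / 4 ≤ x ^ 2 := by nlinarith [hx.1]
      have h4 : u * (z ^ 2 / 4) ≤ u * x ^ 2 := mul_le_mul_of_nonneg_left h3 hu0.le
      linarith
    simp only [F']
    rw [norm_mul, Real.norm_of_nonneg (profileIntegrand_pos _ _ _).le, e, norm_neg,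
      Real.norm_of_nonneg (by positivity)]
    have hp := profileIntegrand_pos ν 0 t
    calc x / 2 * (profileIntegrand ν 0 t *
          (Real.exp (-t) * Real.exp (-(x ^ 2 / 4 * Real.exp (-t)))))
        ≤ z * (profileIntegrand ν 0 t * (16 / z ^ 2)) := by
          gcongr
          linarith [hx.2]
      _ = _ := by ring
  have key := hasDerivAt_integral_of_dominated_loc_of_deriv_le (μ := volume) (𝕜 := ℝ)
    (F := profileIntegrand ν) (F' := F') (x₀ := z) (s := Ioo (z / 2) (2 * z))
    (bound := fun t => z * (16 / z ^ 2) * profileIntegrand ν 0 t)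
    (Ioo_mem_nhds (by linarith) (by linarith))
    (Eventually.of_forall fun x => (continuous_profileIntegrand ν x).aestronglyMeasurable)
    (integrable_profile hν z)
    ((continuous_const.mul (continuous_profileIntegrand (ν - 1) z)).aestronglyMeasurable)
    (Eventually.of_forall hbd) ((integrable_profile_zero hν).const_mul _)
    (Eventually.of_forall fun t x _ => hd x t)
  refine key.2.congr_deriv ?_
  simp only [F']
  rw [integral_const_mul, show ν - 1 = -(1 - ν) by ring, integral_profile_neg _ hz, ← mul_assoc,
    neg_mul, neg_mul]
  have hz2 : 0 < z / 2 := by positivity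
  rw [show 2 * ν - 1 = 1 + -2 * (1 - ν) by ring, Real.rpow_add hz2, Real.rpow_one]
  ring

section

/-! ### The extension profile -/

/-- The weighted measure `y^a dy` on the half line. -/
def halfLine (a : ℝ) : Measure ℝ :=
  (volume.restrict (Ioi (0 : ℝ))).withDensity fun y => ENNReal.ofReal (y ^ a)

instance (a : ℝ) : SigmaFinite (halfLine a) := by
  unfold halfLine
  exact SigmaFinite.withDensity_ofReal _

lemma measurable_rpow_ofReal (a : ℝ) : Measurable fun y : ℝ => ENNReal.ofReal (y ^ a) := by
  fun_prop

lemma integral_halfLine {F : Type*} [NormedAddCommGroup F] [NormedSpace ℝ F] (a : ℝ) (f : ℝ → F) :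
    ∫ y, f y ∂(halfLine a) = ∫ y in Ioi (0 : ℝ), y ^ a • f y := by
  rw [halfLine, integral_withDensity_eq_integral_toReal_smul (measurable_rpow_ofReal a) (by simp)]
  refine setIntegral_congr_fun measurableSet_Ioi fun y hy => ?_
  rw [ENNReal.toReal_ofReal (Real.rpow_nonneg (le_of_lt hy) a)]

lemma integrable_halfLine {F : Type*} [NormedAddCommGroup F] [NormedSpace ℝ F] (a : ℝ)
    (f : ℝ → F) : Integrable f (halfLine a) ↔ IntegrableOn (fun y => y ^ a • f y) (Ioi 0) := by
  rw [halfLine, integrable_withDensity_iff_integrable_smul' (measurable_rpow_ofReal a) (by simp)]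
  refine integrableOn_congr_fun (fun y hy => ?_) measurableSet_Ioi
  rw [ENNReal.toReal_ofReal (Real.rpow_nonneg (le_of_lt hy) a)]

lemma lintegral_halfLine (a : ℝ) (f : ℝ → ℝ≥0∞) :
    ∫⁻ y, f y ∂(halfLine a) = ∫⁻ y in Ioi (0 : ℝ), ENNReal.ofReal (y ^ a) * f y := by
  rw [halfLine, lintegral_withDensity_eq_lintegral_mul_non_measurable _ (measurable_rpow_ofReal a)
    (by simp)]
  rfl

lemma ae_halfLine_iff (a : ℝ) {p : ℝ → Prop} :
    (∀ᵐ y ∂(halfLine a), p y) ↔ ∀ᵐ y ∂(volume.restrict (Ioi (0 : ℝ))), p y := by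
  rw [halfLine, ae_withDensity_iff (measurable_rpow_ofReal a),
    ae_restrict_iff' measurableSet_Ioi, ae_restrict_iff' measurableSet_Ioi]
  refine eventually_congr (Eventually.of_forall fun y => ?_)
  refine forall_congr' fun hy => ?_
  have : ENNReal.ofReal (y ^ a) ≠ 0 := by
    simpa using Real.rpow_pos_of_pos hy a
  simp [this]

lemma halfLine_absolutelyContinuous (a : ℝ) :
    volume.restrict (Ioi (0 : ℝ)) ≪ halfLine a := fun s hs => by
  have h : ∀ᵐ y ∂(halfLine a), y ∉ s := measure_eq_zero_iff_ae_notMem.1 hs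
  exact measure_eq_zero_iff_ae_notMem.2 ((ae_halfLine_iff a).1 h)

/-- The profile `θ` of the extension of an eigenfunction with eigenvalue `lam`, normalized by
`θ(0) = 1`. -/
def extProfile (s lam y : ℝ) : ℝ := besselProfile s (√lam * y) / Real.Gamma s

/-- The derivative of `extProfile`. -/
def extDeriv (s lam y : ℝ) : ℝ :=
  -(√lam / Real.Gamma s) * (√lam * y / 2) ^ (2 * s - 1) * besselProfile (1 - s) (√lam * y)

/-- The weighted derivative `y^{1-2s} θ'(y)`, in a form that makes sense up to `y = 0`. -/
def extFlux (s lam y : ℝ) : ℝ :=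
  -(traceConst s * lam ^ s / Real.Gamma (1 - s)) * besselProfile (1 - s) (√lam * y)

variable {s lam : ℝ}

lemma traceConst_pos (hs0 : 0 < s) (hs1 : s < 1) : 0 < traceConst s := by
  have := Real.Gamma_pos_of_pos hs0
  have := Real.Gamma_pos_of_pos (sub_pos.2 hs1)
  unfold traceConst; positivity

lemma extProfile_zero (hs0 : 0 < s) : extProfile s lam 0 = 1 := by
  rw [extProfile, mul_zero, besselProfile_zero hs0, div_self (Real.Gamma_pos_of_pos hs0).ne']

lemma continuous_extProfile (hs0 : 0 < s) : Continuous (extProfile s lam) := by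
  have := continuous_besselProfile hs0
  unfold extProfile; fun_prop

lemma extProfile_nonneg (hs0 : 0 < s) (y : ℝ) : 0 ≤ extProfile s lam y :=
  div_nonneg (besselProfile_nonneg _ _) (Real.Gamma_pos_of_pos hs0).le

lemma extProfile_le_one (hs0 : 0 < s) (y : ℝ) : extProfile s lam y ≤ 1 :=
  (div_le_one (Real.Gamma_pos_of_pos hs0)).2 (besselProfile_le_Gamma hs0 _)

lemma extFlux_zero (hs1 : s < 1) : extFlux s lam 0 = -(traceConst s * lam ^ s) := by
  have := (Real.Gamma_pos_of_pos (sub_pos.2 hs1)).ne'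
  rw [extFlux, mul_zero, besselProfile_zero (sub_pos.2 hs1)]
  field_simp

lemma continuous_extFlux (hs1 : s < 1) : Continuous (extFlux s lam) := by
  have := continuous_besselProfile (sub_pos.2 hs1)
  unfold extFlux; fun_prop

lemma hasDerivAt_extProfile (hs0 : 0 < s) (hl : 0 < lam) {y : ℝ} (hy : 0 < y) :
    HasDerivAt (extProfile s lam) (extDeriv s lam y) y := by
  have hl' : 0 < √lam := Real.sqrt_pos.2 hl
  have h1 : HasDerivAt (fun y => √lam * y) √lam y := by
    simpa using (hasDerivAt_id y).const_mul √lam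
  have h2 := ((hasDerivAt_besselProfile hs0 (mul_pos hl' hy)).comp y h1).div_const (Real.Gamma s)
  refine h2.congr_deriv ?_
  unfold extDeriv
  ring

/-- The constant `2^{1-2s} / Γ(s)` in front of the flux is `c_s / Γ(1-s)`. -/
lemma traceConst_eq (hs1 : s < 1) :
    traceConst s / Real.Gamma (1 - s) = 2 ^ (1 - 2 * s) / Real.Gamma s := by
  have h1 := (Real.Gamma_pos_of_pos (sub_pos.2 hs1)).ne'
  have e : (4 : ℝ) ^ (s - 1 / 2) = 2 ^ (2 * s - 1) := by
    rw [show (4 : ℝ) = 2 ^ (2 : ℝ) by norm_num, ← Real.rpow_mul (by norm_num)]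
    congr 1; ring
  rw [traceConst, e, show 1 - 2 * s = -(2 * s - 1) by ring, Real.rpow_neg (by norm_num)]
  field_simp

lemma rpow_mul_extDeriv (hs1 : s < 1) (hl : 0 < lam) {y : ℝ} (hy : 0 < y) :
    y ^ (1 - 2 * s) * extDeriv s lam y = extFlux s lam y := by
  have hl' : 0 < √lam := Real.sqrt_pos.2 hl
  rw [extFlux, extDeriv, mul_div_right_comm (traceConst s), traceConst_eq hs1,
    Real.div_rpow (by positivity) (by norm_num), Real.mul_rpow hl'.le hy.le]
  have e1 : lam ^ s = √lam * √lam ^ (2 * s - 1) := by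
    conv_lhs => rw [← Real.sq_sqrt hl.le]
    rw [← Real.rpow_natCast, ← Real.rpow_mul hl'.le]
    nth_rewrite 2 [← Real.rpow_one √lam]
    rw [← Real.rpow_add hl']
    congr 1; push_cast; ring
  have e2 : (2 : ℝ) ^ (1 - 2 * s) = (2 ^ (2 * s - 1))⁻¹ := by
    rw [← Real.rpow_neg (by norm_num)]; congr 1; ring
  have e3 : y ^ (1 - 2 * s) = (y ^ (2 * s - 1))⁻¹ := by
    rw [← Real.rpow_neg hy.le]; congr 1; ring
  have h3 := (Real.rpow_pos_of_pos hy (2 * s - 1)).ne'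
  rw [e1, e2, e3]
  field_simp

/-- The equation `(y^a θ')' = lam y^a θ`, with `a = 1 - 2s`. -/
lemma hasDerivAt_extFlux (hs1 : s < 1) (hl : 0 < lam) {y : ℝ} (hy : 0 < y) :
    HasDerivAt (extFlux s lam) (lam * (y ^ (1 - 2 * s) * extProfile s lam y)) y := by
  have hl' : 0 < √lam := Real.sqrt_pos.2 hl
  have h1 : HasDerivAt (fun y => √lam * y) √lam y := by
    simpa using (hasDerivAt_id y).const_mul √lam
  have h2 := ((hasDerivAt_besselProfile (sub_pos.2 hs1) (mul_pos hl' hy)).comp y h1).const_mul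
    (-(traceConst s * lam ^ s / Real.Gamma (1 - s)))
  refine h2.congr_deriv ?_
  rw [sub_sub_cancel, show 2 * (1 - s) - 1 = 1 - 2 * s by ring, mul_div_right_comm,
    traceConst_eq hs1, Real.div_rpow (by positivity) (by norm_num), Real.mul_rpow hl'.le hy.le,
    extProfile]
  have e1 : lam = lam ^ s * √lam ^ (1 - 2 * s) * √lam := by
    have : lam ^ s = √lam ^ (2 * s) := by
      conv_lhs => rw [← Real.sq_sqrt hl.le]
      rw [← Real.rpow_natCast, ← Real.rpow_mul hl'.le]
      congr 1
    rw [this, ← Real.rpow_add hl', show 2 * s + (1 - 2 * s) = 1 by ring, Real.rpow_one,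
      Real.mul_self_sqrt hl.le]
  have h2 : (0 : ℝ) < 2 ^ (1 - 2 * s) := by positivity
  calc _ = (lam ^ s * √lam ^ (1 - 2 * s) * √lam) * (y ^ (1 - 2 * s) *
        (besselProfile s (√lam * y) / Real.Gamma s)) := by field_simp
    _ = _ := by rw [← e1]

lemma tendsto_extFlux_atTop (hs1 : s < 1) (hl : 0 < lam) :
    Tendsto (extFlux s lam) atTop (𝓝 0) := by
  have hl' : 0 < √lam := Real.sqrt_pos.2 hl
  obtain ⟨C, hC0, hC⟩ := exists_besselProfile_le (sub_pos.2 hs1)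
  have h1 : Tendsto (fun y => besselProfile (1 - s) (√lam * y)) atTop (𝓝 0) := by
    refine squeeze_zero (fun y => besselProfile_nonneg _ _) (fun y => hC _) ?_
    have h2 : Tendsto (fun y => √lam * y / 2) atTop atTop :=
      (tendsto_id.const_mul_atTop hl').atTop_div_const (by norm_num)
    simpa using (Real.tendsto_exp_neg_atTop_nhds_zero.comp h2).const_mul C
  have h3 := h1.const_mul (-(traceConst s * lam ^ s / Real.Gamma (1 - s)))
  rwa [mul_zero] at h3

/-- The coefficients in `besselExt` are values of the profile. -/
lemma coeff_besselExt (hs0 : 0 < s) (hl : 0 < lam) {y : ℝ} (hy : 0 < y) :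
    2 ^ (1 - s) / Real.Gamma s * ((√lam * y) ^ s * besselK s (√lam * y)) = extProfile s lam y := by
  have hl' : 0 < √lam := Real.sqrt_pos.2 hl
  rw [rpow_mul_besselK hs0 (mul_pos hl' hy), extProfile]
  have : (2 : ℝ) ^ (1 - s) * 2 ^ (s - 1) = 1 := by
    rw [← Real.rpow_add (by norm_num)]; simp
  calc _ = ((2 : ℝ) ^ (1 - s) * 2 ^ (s - 1)) * besselProfile s (√lam * y) / Real.Gamma s := by ring
    _ = _ := by rw [this, one_mul]

lemma integrableOn_rpow_mul_sq_profile {a ν : ℝ} (ha : -1 < a) (hν : 0 < ν) (hl : 0 < lam) :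
    IntegrableOn (fun y => y ^ a * besselProfile ν (√lam * y) ^ 2) (Ioi 0) := by
  have hl' : 0 < √lam := Real.sqrt_pos.2 hl
  obtain ⟨C, hC0, hC⟩ := exists_besselProfile_le hν
  have h1 := (integrableOn_rpow_mul_exp_neg_mul_rpow ha one_pos hl').const_mul (C ^ 2)
  refine Integrable.mono' h1 ?_ ?_
  · have hc := continuous_besselProfile hν
    refine Measurable.aestronglyMeasurable ?_
    have h2 : Measurable fun y : ℝ => y ^ a := by fun_prop
    have h3 : Continuous fun y => besselProfile ν (√lam * y) ^ 2 := by fun_prop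
    exact h2.mul h3.measurable
  · rw [ae_restrict_iff' measurableSet_Ioi]
    refine Eventually.of_forall fun y hy => ?_
    have hy : 0 < y := hy
    have h0 := besselProfile_nonneg ν (√lam * y)
    rw [Real.norm_of_nonneg (by positivity)]
    have h2 : besselProfile ν (√lam * y) ^ 2 ≤ (C * Real.exp (-(√lam * y / 2))) ^ 2 := by
      gcongr; exact hC _
    rw [mul_pow, ← Real.exp_nat_mul] at h2
    have h3 : ((2 : ℕ) : ℝ) * -(√lam * y / 2) = -√lam * y ^ (1 : ℝ) := by
      rw [Real.rpow_one]; push_cast; ring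
    rw [h3] at h2
    calc y ^ a * besselProfile ν (√lam * y) ^ 2
        ≤ y ^ a * (C ^ 2 * Real.exp (-√lam * y ^ (1 : ℝ))) := by gcongr
      _ = _ := by ring

lemma memLp_extProfile (hs0 : 0 < s) (hs1 : s < 1) (hl : 0 < lam) :
    MemLp (extProfile s lam) 2 (halfLine (1 - 2 * s)) := by
  rw [memLp_two_iff_integrable_sq (continuous_extProfile hs0).aestronglyMeasurable,
    integrable_halfLine]
  refine ((integrableOn_rpow_mul_sq_profile (a := 1 - 2 * s) (by linarith) hs0 hl).const_mul
    ((Real.Gamma s) ^ 2)⁻¹).congr (Eventually.of_forall fun y => ?_)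
  simp only [extProfile, smul_eq_mul]
  ring

lemma measurable_extDeriv (hs1 : s < 1) : Measurable (extDeriv s lam) := by
  have h1 : Measurable fun y : ℝ => (√lam * y / 2) ^ (2 * s - 1) := by fun_prop
  have h2 : Continuous fun y => besselProfile (1 - s) (√lam * y) := by
    have := continuous_besselProfile (sub_pos.2 hs1)
    fun_prop
  exact (h1.const_mul _).mul h2.measurable

lemma memLp_extDeriv (hs0 : 0 < s) (hs1 : s < 1) (hl : 0 < lam) :
    MemLp (extDeriv s lam) 2 (halfLine (1 - 2 * s)) := by
  rw [memLp_two_iff_integrable_sq (measurable_extDeriv hs1).aestronglyMeasurable,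
    integrable_halfLine]
  refine ((integrableOn_rpow_mul_sq_profile (a := 2 * s - 1) (by linarith) (sub_pos.2 hs1)
    hl).const_mul ((traceConst s * lam ^ s / Real.Gamma (1 - s)) ^ 2)).congr ?_
  filter_upwards [ae_restrict_mem measurableSet_Ioi] with y hy
  have hy : 0 < y := hy
  have h1 := rpow_mul_extDeriv hs1 hl hy
  have h2 : y ^ (2 * s - 1) = (y ^ (1 - 2 * s))⁻¹ := by
    rw [← Real.rpow_neg hy.le]; congr 1; ring
  have h3 := (Real.rpow_pos_of_pos hy (1 - 2 * s)).ne'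
  calc _ = y ^ (2 * s - 1) * extFlux s lam y ^ 2 := by unfold extFlux; ring
    _ = _ := by
      rw [← h1, h2, smul_eq_mul]
      field_simp

end

/-! ### Weak derivatives on the half line -/

/-- A test function with integral zero is the derivative of a test function. -/
lemma exists_testFun_deriv_eq {η : ℝ → ℝ} (hη : IsTestFun (Ioi 0) η)
    (h0 : ∫ y in Ioi (0 : ℝ), η y = 0) : ∃ ρ, IsTestFun (Ioi 0) ρ ∧ deriv ρ = η := by
  by_cases hne : (tsupport η).Nonempty
  swap
  · rw [not_nonempty_iff_eq_empty, tsupport_eq_empty_iff] at hne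
    exact ⟨0, isTestFun_zero, by rw [hne]; ext x; simp⟩
  obtain ⟨α, hα, hαm⟩ := hη.compact.isCompact.exists_isLeast hne
  obtain ⟨β, hβ, hβm⟩ := hη.compact.isCompact.exists_isGreatest hne
  have hα0 : 0 < α := hη.support hα
  have hzero : ∀ y, y < α ∨ β < y → η y = 0 := fun y hy =>
    image_eq_zero_of_notMem_tsupport fun hmem => by
      rcases hy with h | h
      · exact absurd (hαm hmem) (not_le.2 h)
      · exact absurd (hβm hmem) (not_le.2 h)
  let ρ : ℝ → ℝ := fun y => ∫ t in (0 : ℝ)..y, η t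
  have hd : ∀ y, HasDerivAt ρ (η y) y := fun y =>
    intervalIntegral.integral_hasDerivAt_right (hη.continuous.intervalIntegrable _ _)
      (hη.continuous.stronglyMeasurableAtFilter _ _) hη.continuous.continuousAt
  have hder : deriv ρ = η := funext fun y => (hd y).deriv
  have hint : Integrable η := hη.continuous.integrable_of_hasCompactSupport hη.compact
  have hρ0 : ∀ y ∉ Icc α β, ρ y = 0 := by
    intro y hy
    by_cases hya : y < α
    · refine (intervalIntegral.integral_congr (g := fun _ => (0 : ℝ)) fun t ht => ?_).trans (by simp)
      refine hzero t (Or.inl ?_)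
      rw [uIcc, mem_Icc] at ht
      exact ht.2.trans_lt (max_lt hα0 hya)
    · have hyb : β < y := by
        by_contra h
        exact hy ⟨not_lt.1 hya, not_lt.1 h⟩
      have h1 : ∫ t in Ioi y, η t = 0 := by
        refine setIntegral_eq_zero_of_forall_eq_zero fun t ht => hzero t (Or.inr ?_)
        exact hyb.trans ht
      have h2 := intervalIntegral.integral_Ioi_sub_Ioi (f := η) (a := 0) (b := y) (μ := volume)
        hint.integrableOn (by linarith [not_lt.1 hya])
      rw [h0, h1, sub_zero] at h2
      exact h2.symm
  have hts : tsupport ρ ⊆ Icc α β :=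
    closure_minimal (fun y hy => by
      by_contra h
      exact hy (hρ0 y h)) isClosed_Icc
  refine ⟨ρ, ⟨?_, ?_, ?_⟩, hder⟩
  · rw [contDiff_infty_iff_deriv]
    exact ⟨fun y => (hd y).differentiableAt, by rw [hder]; exact hη.smooth⟩
  · exact isCompact_Icc.of_isClosed_subset (isClosed_tsupport _) hts
  · exact hts.trans fun y hy => hα0.trans_le hy.1

/-- A locally integrable function on the half line whose weak derivative is zero is constant. -/
lemma ae_eq_const_of_weak_deriv_zero {h : ℝ → ℝ} (hh : LocallyIntegrableOn h (Ioi 0))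
    (hw : ∀ ρ, IsTestFun (Ioi 0) ρ → ∫ y in Ioi (0 : ℝ), h y * deriv ρ y = 0) :
    ∃ c, ∀ᵐ y ∂(volume.restrict (Ioi (0 : ℝ))), h y = c := by
  have hmulint : ∀ χ, IsTestFun (Ioi 0) χ → IntegrableOn (fun y => h y * χ y) (Ioi (0 : ℝ)) := by
    intro χ hχ
    have h1 : IntegrableOn h (tsupport χ) :=
      hh.integrableOn_compact_subset hχ.support hχ.compact.isCompact
    have h2 : IntegrableOn (fun y => h y * χ y) (tsupport χ) :=
      h1.mul_continuousOn hχ.continuous.continuousOn hχ.compact.isCompact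
    exact (h2.integrable_of_forall_notMem_eq_zero fun y hy => by
      rw [image_eq_zero_of_notMem_tsupport hy, mul_zero]).integrableOn
  -- The constant is read off from one test function `ρ₀` of integral one.
  let φ : ContDiffBump (1 : ℝ) := ⟨1 / 4, 1 / 2, by norm_num, by norm_num⟩
  let ρ₀ : ℝ → ℝ := φ.normed volume
  have hρ₀ : IsTestFun (Ioi 0) ρ₀ := by
    refine ⟨φ.contDiff_normed, φ.hasCompactSupport_normed, ?_⟩
    rw [φ.tsupport_normed_eq]
    intro y hy
    have hy' : |y - 1| ≤ 1 / 2 := hy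
    rw [abs_le] at hy'
    simp only [mem_Ioi]
    linarith [hy'.1]
  have hρ₀i : ∫ y in Ioi (0 : ℝ), ρ₀ y = 1 := by
    rw [setIntegral_eq_integral_of_forall_compl_eq_zero fun y hy => hρ₀.eq_zero hy]
    exact φ.integral_normed
  set c := ∫ y in Ioi (0 : ℝ), h y * ρ₀ y with hc
  refine ⟨c, ?_⟩
  have key : ∀ᵐ y : ℝ, y ∈ Ioi (0 : ℝ) → h y - c = 0 := by
    refine isOpen_Ioi.ae_eq_zero_of_integral_contDiff_smul_eq_zero
      (hh.sub ((locallyIntegrable_const c).locallyIntegrableOn _)) fun χ h1 h2 h3 => ?_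
    have hχ : IsTestFun (Ioi (0 : ℝ)) χ := ⟨h1, h2, h3⟩
    have hχi : IntegrableOn χ (Ioi (0 : ℝ)) :=
      (hχ.continuous.integrable_of_hasCompactSupport hχ.compact).integrableOn
    have hρ₀I : IntegrableOn ρ₀ (Ioi (0 : ℝ)) :=
      (hρ₀.continuous.integrable_of_hasCompactSupport hρ₀.compact).integrableOn
    -- Subtracting the multiple `m ρ₀` makes the integral of `χ` zero.
    set m := ∫ y in Ioi (0 : ℝ), χ y with hm
    have hη : IsTestFun (Ioi (0 : ℝ)) (χ + (-m) • ρ₀) := hχ.add (hρ₀.const_smul _)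
    obtain ⟨ρ, hρ, hρd⟩ := exists_testFun_deriv_eq hη (by
      simp only [Pi.add_apply, Pi.smul_apply, smul_eq_mul]
      rw [integral_add hχi (hρ₀I.const_mul _), integral_const_mul, hρ₀i]
      ring)
    have h4 := hw ρ hρ
    rw [hρd] at h4
    have h5 : ∫ y in Ioi (0 : ℝ), h y * χ y = m * c := by
      have e : ∀ y, h y * (χ + (-m) • ρ₀) y = h y * χ y - m * (h y * ρ₀ y) := by
        intro y
        simp only [Pi.add_apply, Pi.smul_apply, smul_eq_mul]; ring
      simp_rw [e] at h4
      rw [integral_sub (hmulint χ hχ) ((hmulint ρ₀ hρ₀).const_mul m), integral_const_mul] at h4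
      linarith
    rw [← setIntegral_eq_integral_of_forall_compl_eq_zero (s := Ioi (0 : ℝ)) fun y hy => by
      rw [hχ.eq_zero hy, zero_smul]]
    have e : ∀ y, χ y • (h y - c) = h y * χ y - c * χ y := by
      intro y
      rw [smul_eq_mul]; ring
    simp_rw [e]
    rw [integral_sub (hmulint χ hχ) (hχi.const_mul c), integral_const_mul, h5]
    ring
  rw [ae_restrict_iff' measurableSet_Ioi]
  filter_upwards [key] with y hy hy0
  linarith [hy hy0]

/-- Integration by parts against a primitive, by Fubini's theorem on the region `0 < t < y`. -/
lemma integral_mul_primitive {p g : ℝ → ℝ}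
    (hp : AEStronglyMeasurable p (volume.restrict (Ioi (0 : ℝ))))
    (hg : AEStronglyMeasurable g (volume.restrict (Ioi (0 : ℝ))))
    (hpt : ∀ t, 0 < t → IntegrableOn p (Ioi t)) (M : ℝ → ℝ)
    (hM : ∀ t, 0 < t → ∫ y in Ioi t, |p y| ≤ M t)
    (hgM : IntegrableOn (fun t => |g t| * M t) (Ioi 0)) :
    ∫ y in Ioi (0 : ℝ), p y * ∫ t in (0 : ℝ)..y, g t =
      ∫ t in Ioi (0 : ℝ), g t * ∫ y in Ioi t, p y := by
  let F : ℝ → ℝ → ℝ := fun t y => (Ioi t).indicator (fun y => g t * p y) y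
  have hFm : AEStronglyMeasurable (Function.uncurry F)
      ((volume.restrict (Ioi (0 : ℝ))).prod (volume.restrict (Ioi (0 : ℝ)))) := by
    have h1 : AEStronglyMeasurable (fun q : ℝ × ℝ => g q.1 * p q.2)
      ((volume.restrict (Ioi (0 : ℝ))).prod (volume.restrict (Ioi (0 : ℝ)))) :=
      hg.comp_fst.mul hp.comp_snd
    have h2 : MeasurableSet {q : ℝ × ℝ | q.1 < q.2} := measurableSet_lt measurable_fst measurable_snd
    refine (h1.indicator h2).congr (Eventually.of_forall fun q => ?_)
    simp only [F, Function.uncurry, indicator, mem_ofPred_eq, mem_Ioi]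
  have hrestr : ∀ t : ℝ, 0 < t →
      (volume.restrict (Ioi (0 : ℝ))).restrict (Ioi t) = volume.restrict (Ioi t) := fun t ht => by
    rw [Measure.restrict_restrict measurableSet_Ioi, Ioi_inter_Ioi, max_eq_left ht.le]
  have hFi : ∀ t, 0 < t → ∫ y in Ioi (0 : ℝ), F t y = g t * ∫ y in Ioi t, p y := by
    intro t ht
    simp only [F]
    rw [integral_indicator measurableSet_Ioi, hrestr t ht, integral_const_mul]
  have hFint : Integrable (Function.uncurry F)
      ((volume.restrict (Ioi (0 : ℝ))).prod (volume.restrict (Ioi (0 : ℝ)))) := by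
    rw [integrable_prod_iff hFm]
    constructor
    · filter_upwards [ae_restrict_mem measurableSet_Ioi] with t ht
      simp only [Function.uncurry, F]
      rw [integrable_indicator_iff measurableSet_Ioi, IntegrableOn, hrestr t ht]
      exact (hpt t ht).const_mul _
    · refine hgM.mono' hFm.norm.integral_prod_right' ?_
      filter_upwards [ae_restrict_mem measurableSet_Ioi] with t ht
      rw [Real.norm_of_nonneg (integral_nonneg fun y => norm_nonneg _)]
      have e : ∀ y, ‖Function.uncurry F (t, y)‖ = (Ioi t).indicator (fun y => |g t| * |p y|) y := by
        intro y
        simp only [Function.uncurry, F, norm_indicator_eq_indicator_norm, Real.norm_eq_abs, abs_mul]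
      simp_rw [e]
      rw [integral_indicator measurableSet_Ioi, hrestr t ht, integral_const_mul]
      exact mul_le_mul_of_nonneg_left (hM t ht) (abs_nonneg _)
  calc ∫ y in Ioi (0 : ℝ), p y * ∫ t in (0 : ℝ)..y, g t
      = ∫ y in Ioi (0 : ℝ), ∫ t in Ioi (0 : ℝ), F t y := by
        refine setIntegral_congr_fun measurableSet_Ioi fun y hy => ?_
        have hy : 0 < y := hy
        rw [intervalIntegral.integral_of_le hy.le, integral_Ioc_eq_integral_Ioo,
          ← integral_const_mul]
        have e : ∀ t, F t y = (Iio y).indicator (fun t => p y * g t) t := by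
          intro t
          simp only [F, indicator, mem_Ioi, mem_Iio, mul_comm]
        simp_rw [e]
        rw [integral_indicator measurableSet_Iio, Measure.restrict_restrict measurableSet_Iio,
          inter_comm, Ioi_inter_Iio]
    _ = ∫ t in Ioi (0 : ℝ), ∫ y in Ioi (0 : ℝ), F t y := (integral_integral_swap hFint).symm
    _ = _ := setIntegral_congr_fun measurableSet_Ioi fun t ht => hFi t ht

/-- A function with an integrable weak derivative on the half line has a continuous
representative, the primitive of the derivative. -/
lemma exists_ae_eq_primitive {f g : ℝ → ℝ} (hf : LocallyIntegrableOn f (Ioi 0))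
    (hg : ∀ R, IntegrableOn g (Ioc 0 R))
    (hw : ∀ ρ, IsTestFun (Ioi 0) ρ →
      ∫ y in Ioi (0 : ℝ), f y * deriv ρ y = -∫ y in Ioi (0 : ℝ), g y * ρ y) :
    ∃ f₀, ∀ᵐ y ∂(volume.restrict (Ioi (0 : ℝ))), f y = f₀ + ∫ t in (0 : ℝ)..y, g t := by
  have hgm : AEStronglyMeasurable g (volume.restrict (Ioi (0 : ℝ))) := by
    have : Ioi (0 : ℝ) = ⋃ N : ℕ, Ioc (0 : ℝ) N := by
      ext y
      simp only [mem_Ioi, mem_iUnion, mem_Ioc]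
      refine ⟨fun h => ?_, fun ⟨N, h, _⟩ => h⟩
      obtain ⟨N, hN⟩ := exists_nat_ge y
      exact ⟨N, h, hN⟩
    rw [this]
    exact aestronglyMeasurable_iUnion_iff.2 fun N => (hg N).aestronglyMeasurable
  have hFc : ContinuousOn (fun y => ∫ t in (0 : ℝ)..y, g t) (Ici 0) := by
    intro y hy
    have h1 : ContinuousOn (fun y => ∫ t in (0 : ℝ)..y, g t) (uIcc 0 (y + 1)) :=
      intervalIntegral.continuousOn_primitive_interval (by
        rw [uIcc_of_le (by linarith [mem_Ici.1 hy]), integrableOn_Icc_iff_integrableOn_Ioc]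
        exact hg _)
    rw [uIcc_of_le (by linarith [mem_Ici.1 hy])] at h1
    refine (h1 y ⟨hy, by linarith⟩).mono_of_mem_nhdsWithin ?_
    exact mem_nhdsWithin.2 ⟨Iio (y + 1), isOpen_Iio, by simp, fun z hz => ⟨hz.2, le_of_lt hz.1⟩⟩
  have hFl : LocallyIntegrableOn (fun y => ∫ t in (0 : ℝ)..y, g t) (Ioi 0) :=
    (hFc.mono Ioi_subset_Ici_self).locallyIntegrableOn measurableSet_Ioi
  obtain ⟨c, hc⟩ := ae_eq_const_of_weak_deriv_zero (hf.sub hFl) (fun ρ hρ => by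
    have hρd : IsTestFun (Ioi (0 : ℝ)) (deriv ρ) := hρ.fderiv_apply 1
    have hmul : ∀ u : ℝ → ℝ, LocallyIntegrableOn u (Ioi 0) →
        IntegrableOn (fun y => u y * deriv ρ y) (Ioi (0 : ℝ)) := by
      intro u hu
      have h2 : IntegrableOn (fun y => u y * deriv ρ y) (tsupport (deriv ρ)) :=
        (hu.integrableOn_compact_subset hρd.support hρd.compact.isCompact).mul_continuousOn
          hρd.continuous.continuousOn hρd.compact.isCompact
      exact (h2.integrable_of_forall_notMem_eq_zero fun y hy => by
        rw [image_eq_zero_of_notMem_tsupport hy, mul_zero]).integrableOn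
    have hdi : Integrable (deriv ρ) :=
      hρd.continuous.integrable_of_hasCompactSupport hρd.compact
    obtain ⟨β, hβ⟩ := hρd.compact.isCompact.bddAbove
    have htail : ∀ t, 0 < t → ∫ y in Ioi t, deriv ρ y = -ρ t := by
      intro t _
      have h1 := integral_Ioi_of_hasDerivAt_of_tendsto' (f := ρ) (f' := deriv ρ) (a := t) (m := 0)
        (fun y _ => (hρ.differentiable y).hasDerivAt) hdi.integrableOn
        (hρ.compact.is_zero_at_infty.mono_left atTop_le_cocompact)
      rw [h1, zero_sub]
    have h1 : ∫ y in Ioi (0 : ℝ), deriv ρ y * ∫ t in (0 : ℝ)..y, g t =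
        -∫ y in Ioi (0 : ℝ), g y * ρ y := by
      rw [integral_mul_primitive hρd.continuous.aestronglyMeasurable hgm
        (fun t _ => hdi.integrableOn)
        ((Iic β).indicator fun _ => ∫ y, |deriv ρ y|) ?_ ?_, ← integral_neg]
      · refine setIntegral_congr_fun measurableSet_Ioi fun t ht => ?_
        rw [htail t ht]; ring
      · intro t ht
        by_cases htβ : t ≤ β
        · rw [indicator_of_mem (mem_Iic.2 htβ)]
          exact setIntegral_le_integral hdi.abs (Eventually.of_forall fun y => abs_nonneg _)
        · rw [indicator_of_notMem (by simpa using htβ)]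
          refine (setIntegral_eq_zero_of_forall_eq_zero fun y hy => ?_).le
          have hy : t < y := hy
          have h0 : deriv ρ y = 0 := image_eq_zero_of_notMem_tsupport fun hmem => by
            linarith [hβ hmem, not_le.1 htβ]
          rw [h0, abs_zero]
      · have h2 : IntegrableOn (fun t => |g t| * ∫ y, |deriv ρ y|) (Ioc 0 β) :=
          (hg β).abs.mul_const _
        have h3 := (integrable_indicator_iff measurableSet_Ioc).2 h2
        refine (h3.integrableOn (s := Ioi 0)).congr_fun (fun t ht => ?_) measurableSet_Ioi
        by_cases htβ : t ≤ β
        · simp [indicator, htβ, mem_Ioi.1 ht]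
        · simp [indicator, htβ]
    have h2 := hw ρ hρ
    simp only [Pi.sub_apply, sub_mul]
    rw [integral_sub (hmul f hf) (hmul _ hFl), h2]
    simp_rw [mul_comm _ (deriv ρ _)]
    rw [h1, sub_self])
  refine ⟨c, ?_⟩
  filter_upwards [hc] with y hy
  simp only [Pi.sub_apply] at hy
  linarith

section

/-! ### The weighted trace inequality on the half line -/

variable {s lam f₀ : ℝ} {f g : ℝ → ℝ}

lemma aestronglyMeasurable_of_halfLine {a : ℝ} (hg : MemLp g 2 (halfLine a)) :
    AEStronglyMeasurable g (volume.restrict (Ioi (0 : ℝ))) :=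
  hg.1.mono_ac (halfLine_absolutelyContinuous a)

lemma lintegral_rpow_Ioc (hs0 : 0 < s) {y : ℝ} (hy : 0 ≤ y) :
    ∫⁻ t in Ioc 0 y, ENNReal.ofReal (t ^ (2 * s - 1)) = ENNReal.ofReal (y ^ (2 * s) / (2 * s)) := by
  have hi : IntervalIntegrable (fun t : ℝ => t ^ (2 * s - 1)) volume 0 y :=
    intervalIntegral.intervalIntegrable_rpow' (by linarith)
  rw [intervalIntegrable_iff_integrableOn_Ioc_of_le hy] at hi
  rw [← ofReal_integral_eq_lintegral_ofReal hi, ← intervalIntegral.integral_of_le hy,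
    integral_rpow (Or.inl (by linarith))]
  · congr 1
    rw [show 2 * s - 1 + 1 = 2 * s by ring, Real.zero_rpow (by linarith), sub_zero]
  · filter_upwards [ae_restrict_mem measurableSet_Ioc] with t ht
    exact Real.rpow_nonneg ht.1.le _

/-- As `a = 1 - 2s < 1`, the weight `t^{-a}` is integrable at zero. -/
lemma sq_lintegral_Ioc_le (hs0 : 0 < s) (hg : MemLp g 2 (halfLine (1 - 2 * s))) {y : ℝ}
    (hy : 0 ≤ y) :
    (∫⁻ t in Ioc 0 y, ‖g t‖ₑ) ^ 2 ≤
      ENNReal.ofReal (y ^ (2 * s) / (2 * s)) * ∫⁻ t, ‖g t‖ₑ ^ 2 ∂(halfLine (1 - 2 * s)) := by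
  have hgm : AEMeasurable (fun t => ‖g t‖ₑ) (volume.restrict (Ioc 0 y)) :=
    ((aestronglyMeasurable_of_halfLine hg).mono_measure
      (Measure.restrict_mono Ioc_subset_Ioi_self le_rfl)).enorm
  -- Cauchy–Schwarz for the factors `t^{-a/2}` and `t^{a/2} |g|`, where `a / 2 = 1 / 2 - s`.
  have h1 : ∫⁻ t in Ioc 0 y, ‖g t‖ₑ = ∫⁻ t in Ioc 0 y, ENNReal.ofReal (t ^ (s - 1 / 2)) *
      (ENNReal.ofReal (t ^ (1 / 2 - s)) * ‖g t‖ₑ) := by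
    refine setLIntegral_congr_fun measurableSet_Ioc fun t ht => ?_
    have e : ENNReal.ofReal (t ^ (s - 1 / 2)) * ENNReal.ofReal (t ^ (1 / 2 - s)) = 1 := by
      rw [← ENNReal.ofReal_mul (Real.rpow_nonneg ht.1.le _), ← Real.rpow_add ht.1]
      simp
    rw [← mul_assoc, e, one_mul]
  have e1 : ∀ t ∈ Ioc 0 y, ENNReal.ofReal (t ^ (s - 1 / 2)) ^ 2 =
      ENNReal.ofReal (t ^ (2 * s - 1)) := fun t ht => by
    rw [← ENNReal.ofReal_pow (Real.rpow_nonneg ht.1.le _), ← Real.rpow_natCast,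
      ← Real.rpow_mul ht.1.le]
    congr 2; push_cast; ring
  have e2 : ∀ t ∈ Ioc 0 y, (ENNReal.ofReal (t ^ (1 / 2 - s)) * ‖g t‖ₑ) ^ 2 =
      ENNReal.ofReal (t ^ (1 - 2 * s)) * ‖g t‖ₑ ^ 2 := fun t ht => by
    rw [mul_pow, ← ENNReal.ofReal_pow (Real.rpow_nonneg ht.1.le _), ← Real.rpow_natCast,
      ← Real.rpow_mul ht.1.le]
    congr 3; push_cast; ring
  have hm : AEMeasurable (fun t => ENNReal.ofReal (t ^ (1 / 2 - s)) * ‖g t‖ₑ)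
      (volume.restrict (Ioc 0 y)) := (measurable_rpow_ofReal _).aemeasurable.mul hgm
  rw [h1]
  refine (sq_lintegral_mul_le _ (by fun_prop) hm).trans ?_
  rw [setLIntegral_congr_fun measurableSet_Ioc e1, setLIntegral_congr_fun measurableSet_Ioc e2,
    lintegral_rpow_Ioc hs0 hy, lintegral_halfLine]
  gcongr
  exact Ioc_subset_Ioi_self

lemma integrableOn_Ioc_of_halfLine (hs0 : 0 < s) (hg : MemLp g 2 (halfLine (1 - 2 * s))) (R : ℝ) :
    IntegrableOn g (Ioc 0 R) := by
  rcases le_or_gt 0 R with hR | hR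
  · refine ⟨(aestronglyMeasurable_of_halfLine hg).mono_measure
      (Measure.restrict_mono Ioc_subset_Ioi_self le_rfl), ?_⟩
    have h1 := sq_lintegral_Ioc_le hs0 hg hR
    have h2 : (∫⁻ t in Ioc 0 R, ‖g t‖ₑ) ^ 2 < ⊤ :=
      h1.trans_lt (ENNReal.mul_lt_top ENNReal.ofReal_lt_top (lintegral_enorm_sq_lt_top hg))
    rw [hasFiniteIntegral_iff_enorm]
    by_contra h
    rw [not_lt, top_le_iff] at h
    rw [h] at h2
    simp at h2
  · rw [Ioc_eq_empty (by linarith)]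
    exact integrableOn_empty

lemma locallyIntegrableOn_of_halfLine (hs0 : 0 < s) (hg : MemLp g 2 (halfLine (1 - 2 * s))) :
    LocallyIntegrableOn g (Ioi 0) := fun x hx =>
  ⟨Ioc 0 (x + 1), mem_nhdsWithin.2 ⟨Iio (x + 1), isOpen_Iio, by simp, fun z hz =>
    ⟨hz.2, le_of_lt hz.1⟩⟩, integrableOn_Ioc_of_halfLine hs0 hg _⟩

/-- The trace at zero of a function on the half line of finite weighted energy. -/
lemma exists_halfLine_trace (hs0 : 0 < s) (hf : MemLp f 2 (halfLine (1 - 2 * s)))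
    (hg : MemLp g 2 (halfLine (1 - 2 * s)))
    (hw : ∀ ρ, IsTestFun (Ioi 0) ρ →
      ∫ y in Ioi (0 : ℝ), f y * deriv ρ y = -∫ y in Ioi (0 : ℝ), g y * ρ y) :
    ∃ f₀, ∀ᵐ y ∂(volume.restrict (Ioi (0 : ℝ))), f y = f₀ + ∫ t in (0 : ℝ)..y, g t :=
  exists_ae_eq_primitive (locallyIntegrableOn_of_halfLine hs0 hf)
    (integrableOn_Ioc_of_halfLine hs0 hg) hw

lemma enorm_sub_trace_sq_le (hs0 : 0 < s) (hg : MemLp g 2 (halfLine (1 - 2 * s)))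
    (hfe : ∀ᵐ y ∂(volume.restrict (Ioi (0 : ℝ))), f y = f₀ + ∫ t in (0 : ℝ)..y, g t) :
    ∀ᵐ y ∂(volume.restrict (Ioi (0 : ℝ))), ‖f y - f₀‖ₑ ^ 2 ≤
      ENNReal.ofReal (y ^ (2 * s) / (2 * s)) * ∫⁻ t, ‖g t‖ₑ ^ 2 ∂(halfLine (1 - 2 * s)) := by
  filter_upwards [hfe, ae_restrict_mem measurableSet_Ioi] with y hy hy0
  have hy0 : 0 < y := hy0
  refine le_trans ?_ (sq_lintegral_Ioc_le hs0 hg hy0.le)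
  rw [hy, add_sub_cancel_left, intervalIntegral.integral_of_le hy0.le]
  gcongr
  exact enorm_integral_le_lintegral_enorm _

/-- The weighted pairing of `f` with the profile `θ` only sees the trace of `f`: integrate by
parts, using the equation `(y^a θ')' = lam y^a θ`. -/
lemma integral_profile_pairing (hs0 : 0 < s) (hs1 : s < 1) (hl : 0 < lam)
    (hf : MemLp f 2 (halfLine (1 - 2 * s))) (hg : MemLp g 2 (halfLine (1 - 2 * s)))
    (hfe : ∀ᵐ y ∂(volume.restrict (Ioi (0 : ℝ))), f y = f₀ + ∫ t in (0 : ℝ)..y, g t) :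
    lam * ∫ y, f y * extProfile s lam y ∂(halfLine (1 - 2 * s)) +
      ∫ y, g y * extDeriv s lam y ∂(halfLine (1 - 2 * s)) = traceConst s * lam ^ s * f₀ := by
  set a := 1 - 2 * s with ha
  -- `p` is the derivative of the flux, which vanishes at infinity.
  set p : ℝ → ℝ := fun y => lam * (y ^ a * extProfile s lam y) with hp
  have hp0 : ∀ y ∈ Ioi (0 : ℝ), 0 ≤ p y := fun y hy =>
    mul_nonneg hl.le (mul_nonneg (Real.rpow_nonneg (le_of_lt hy) _) (extProfile_nonneg hs0 y))
  have hd : ∀ t : ℝ, 0 ≤ t → ∀ y ∈ Ioi t, HasDerivAt (extFlux s lam) (p y) y := fun t ht y hy =>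
    hasDerivAt_extFlux hs1 hl (ht.trans_lt hy)
  have hpi : ∀ t : ℝ, 0 ≤ t → IntegrableOn p (Ioi t) := fun t ht =>
    integrableOn_Ioi_deriv_of_nonneg (continuous_extFlux hs1).continuousWithinAt (hd t ht)
      (fun y hy => hp0 y (ht.trans_lt hy)) (tendsto_extFlux_atTop hs1 hl)
  have hpI : ∀ t : ℝ, 0 ≤ t → ∫ y in Ioi t, p y = -extFlux s lam t := fun t ht => by
    rw [integral_Ioi_of_hasDerivAt_of_tendsto (continuous_extFlux hs1).continuousWithinAt
      (hd t ht) (hpi t ht) (tendsto_extFlux_atTop hs1 hl), zero_sub]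
  have hθ := memLp_extProfile hs0 hs1 hl
  have hθ' := memLp_extDeriv hs0 hs1 hl
  have hfp : IntegrableOn (fun y => p y * f y) (Ioi 0) := by
    have h1 := ((integrable_halfLine _ _).1 (hf.integrable_mul hθ)).const_mul lam
    refine h1.congr (Eventually.of_forall fun y => ?_)
    simp only [hp, smul_eq_mul, Pi.mul_apply]; ring
  have hgq : IntegrableOn (fun y => g y * extFlux s lam y) (Ioi 0) := by
    have h1 := ((integrable_halfLine _ _).1 (hg.integrable_mul hθ'))
    refine IntegrableOn.congr_fun h1 (fun y hy => ?_) measurableSet_Ioi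
    simp only [smul_eq_mul, Pi.mul_apply]
    rw [← rpow_mul_extDeriv hs1 hl hy]; ring
  have e1 : lam * ∫ y, f y * extProfile s lam y ∂(halfLine a) = ∫ y in Ioi (0 : ℝ), p y * f y := by
    rw [integral_halfLine, ← integral_const_mul]
    congr 1; ext y
    simp only [hp, smul_eq_mul]; ring
  have e2 : ∫ y, g y * extDeriv s lam y ∂(halfLine a) =
      ∫ y in Ioi (0 : ℝ), g y * extFlux s lam y := by
    rw [integral_halfLine]
    refine setIntegral_congr_fun measurableSet_Ioi fun y hy => ?_
    rw [smul_eq_mul, ← rpow_mul_extDeriv hs1 hl hy]; ring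
  have e3 : ∫ y in Ioi (0 : ℝ), p y * ∫ t in (0 : ℝ)..y, g t =
      -∫ y in Ioi (0 : ℝ), g y * extFlux s lam y := by
    rw [integral_mul_primitive (hpi 0 le_rfl).aestronglyMeasurable
      (aestronglyMeasurable_of_halfLine hg) (fun t ht => hpi t ht.le)
      (fun t => -extFlux s lam t) ?_ ?_, ← integral_neg]
    · refine setIntegral_congr_fun measurableSet_Ioi fun t ht => ?_
      rw [hpI t (le_of_lt ht)]; ring
    · intro t ht
      rw [← hpI t ht.le]
      refine (setIntegral_congr_fun measurableSet_Ioi fun y hy => ?_).le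
      exact abs_of_nonneg (hp0 y (ht.trans hy))
    · refine IntegrableOn.congr_fun hgq.abs (fun y hy => ?_) measurableSet_Ioi
      rw [abs_mul, abs_of_nonpos (a := extFlux s lam y)]
      have := setIntegral_nonneg (μ := volume) measurableSet_Ioi
        fun z (hz : z ∈ Ioi y) => hp0 z ((mem_Ioi.1 hy).trans hz)
      rw [hpI y (le_of_lt hy)] at this
      linarith
  have e4 : ∫ y in Ioi (0 : ℝ), p y * f y =
      f₀ * (∫ y in Ioi (0 : ℝ), p y) + ∫ y in Ioi (0 : ℝ), p y * ∫ t in (0 : ℝ)..y, g t := by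
    rw [← integral_const_mul, ← integral_add ((hpi 0 le_rfl).const_mul f₀)]
    · refine integral_congr_ae ?_
      filter_upwards [hfe] with y hy
      rw [hy]; ring
    · refine (hfp.sub ((hpi 0 le_rfl).const_mul f₀)).congr ?_
      filter_upwards [hfe] with y hy
      simp only [Pi.sub_apply]
      rw [hy]; ring
  rw [e1, e2, e4, e3, hpI 0 le_rfl, extFlux_zero hs1]
  ring

lemma extProfile_eq_primitive (hs0 : 0 < s) (hs1 : s < 1) (hl : 0 < lam) :
    ∀ᵐ y ∂(volume.restrict (Ioi (0 : ℝ))),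
      extProfile s lam y = 1 + ∫ t in (0 : ℝ)..y, extDeriv s lam t := by
  filter_upwards [ae_restrict_mem measurableSet_Ioi] with y hy
  have hy : 0 < y := hy
  have h1 := intervalIntegral.integral_eq_sub_of_hasDerivAt_of_le hy.le
    (continuous_extProfile (lam := lam) hs0).continuousOn
    (fun t ht => hasDerivAt_extProfile hs0 hl ht.1)
    ((intervalIntegrable_iff_integrableOn_Ioc_of_le hy.le).2
      (integrableOn_Ioc_of_halfLine hs0 (memLp_extDeriv hs0 hs1 hl) y))
  rw [h1, extProfile_zero hs0]
  ring

/-- The energy of the profile. -/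
lemma energy_extProfile (hs0 : 0 < s) (hs1 : s < 1) (hl : 0 < lam) :
    lam * ∫ y, extProfile s lam y ^ 2 ∂(halfLine (1 - 2 * s)) +
      ∫ y, extDeriv s lam y ^ 2 ∂(halfLine (1 - 2 * s)) = traceConst s * lam ^ s := by
  have := integral_profile_pairing hs0 hs1 hl (memLp_extProfile hs0 hs1 hl)
    (memLp_extDeriv hs0 hs1 hl) (extProfile_eq_primitive hs0 hs1 hl)
  simpa [sq] using this

/-- The weighted trace inequality: the profile minimizes the energy for a given trace, as the
energy of `f - f₀ θ` is nonnegative. -/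
lemma halfLine_trace_inequality (hs0 : 0 < s) (hs1 : s < 1) (hl : 0 < lam)
    (hf : MemLp f 2 (halfLine (1 - 2 * s))) (hg : MemLp g 2 (halfLine (1 - 2 * s)))
    (hfe : ∀ᵐ y ∂(volume.restrict (Ioi (0 : ℝ))), f y = f₀ + ∫ t in (0 : ℝ)..y, g t) :
    traceConst s * lam ^ s * f₀ ^ 2 ≤ lam * ∫ y, f y ^ 2 ∂(halfLine (1 - 2 * s)) +
      ∫ y, g y ^ 2 ∂(halfLine (1 - 2 * s)) := by
  have hθ := memLp_extProfile hs0 hs1 hl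
  have hθ' := memLp_extDeriv hs0 hs1 hl
  have expand : ∀ {u v : ℝ → ℝ}, MemLp u 2 (halfLine (1 - 2 * s)) →
      MemLp v 2 (halfLine (1 - 2 * s)) →
      0 ≤ ∫ y, u y ^ 2 ∂(halfLine (1 - 2 * s)) - 2 * f₀ * ∫ y, u y * v y ∂(halfLine (1 - 2 * s)) +
        f₀ ^ 2 * ∫ y, v y ^ 2 ∂(halfLine (1 - 2 * s)) := by
    intro u v hu hv
    have h1 : 0 ≤ ∫ y, (u y - f₀ * v y) ^ 2 ∂(halfLine (1 - 2 * s)) :=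
      integral_nonneg fun y => sq_nonneg _
    have e : ∀ y, (u y - f₀ * v y) ^ 2 = u y ^ 2 - 2 * f₀ * (u y * v y) + f₀ ^ 2 * v y ^ 2 :=
      fun y => by ring
    have huv : Integrable (fun y => u y * v y) (halfLine (1 - 2 * s)) := hu.integrable_mul hv
    simp_rw [e] at h1
    have huv' : Integrable (fun y => u y ^ 2 - 2 * f₀ * (u y * v y)) (halfLine (1 - 2 * s)) :=
      hu.integrable_sq.sub (huv.const_mul _)
    rw [integral_add huv' (hv.integrable_sq.const_mul _),
      integral_sub hu.integrable_sq (huv.const_mul _), integral_const_mul, integral_const_mul] at h1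
    exact h1
  have h1 := mul_le_mul_of_nonneg_left (expand hf hθ) hl.le
  have h2 := expand hg hθ'
  have h3 := integral_profile_pairing hs0 hs1 hl hf hg hfe
  have h4 := energy_extProfile hs0 hs1 hl
  have h5 : f₀ ^ 2 * (lam * ∫ y, extProfile s lam y ^ 2 ∂(halfLine (1 - 2 * s)) +
      ∫ y, extDeriv s lam y ^ 2 ∂(halfLine (1 - 2 * s))) = f₀ ^ 2 * (traceConst s * lam ^ s) := by
    rw [h4]
  have h6 : 2 * f₀ * (lam * ∫ y, f y * extProfile s lam y ∂(halfLine (1 - 2 * s)) +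
      ∫ y, g y * extDeriv s lam y ∂(halfLine (1 - 2 * s))) =
        2 * f₀ * (traceConst s * lam ^ s * f₀) := by rw [h3]
  nlinarith [h1, h2, h5, h6]

end

/-! ### Functions on the cylinder -/

section Coefficients

variable {α β : Type*} [MeasurableSpace α] [MeasurableSpace β] {μ : Measure α} {ν : Measure β}
  [SFinite ν] {V : α × β → ℝ} {φ : α → ℝ} {σ : β → ℝ}

lemma memLp_smul_prod {F : Type*} [NormedAddCommGroup F] [NormedSpace ℝ F] {φ : α → F}
    (hσ : MemLp σ 2 ν) (hφ : MemLp φ 2 μ) :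
    MemLp (fun p : α × β => σ p.2 • φ p.1) 2 (μ.prod ν) := by
  refine memLp_two_of_lintegral (hσ.1.comp_snd.smul hφ.1.comp_fst) ?_
  simp_rw [enorm_smul, mul_pow, mul_comm (‖σ _‖ₑ ^ 2)]
  rw [lintegral_prod_mul (f := fun x => ‖φ x‖ₑ ^ 2) (g := fun y => ‖σ y‖ₑ ^ 2)
    (hφ.1.enorm.pow_const 2) (hσ.1.enorm.pow_const 2)]
  exact ENNReal.mul_lt_top (lintegral_enorm_sq_lt_top hφ) (lintegral_enorm_sq_lt_top hσ)

lemma memLp_coeff [SFinite μ] (hφ : MemLp φ 2 μ) (hV : MemLp V 2 (μ.prod ν)) :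
    MemLp (fun y => ∫ x, φ x * V (x, y) ∂μ) 2 ν := by
  refine memLp_two_of_lintegral ?_ ?_
  · exact ((hφ.1.comp_snd (μ := ν)).mul hV.1.prod_swap).integral_prod_right'
  · have hb : ∀ᵐ y ∂ν, ‖∫ x, φ x * V (x, y) ∂μ‖ₑ ^ 2 ≤
        (∫⁻ x, ‖φ x‖ₑ ^ 2 ∂μ) * ∫⁻ x, ‖V (x, y)‖ₑ ^ 2 ∂μ := by
      filter_upwards [memLp_slice_right hV] with y hy
      refine le_trans ?_ (sq_lintegral_mul_le μ hφ.1.enorm hy.1.enorm)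
      gcongr
      refine (enorm_integral_le_lintegral_enorm _).trans (le_of_eq ?_)
      simp_rw [enorm_mul]
    refine (lintegral_mono_ae hb).trans_lt ?_
    rw [lintegral_const_mul' _ _ (lintegral_enorm_sq_lt_top hφ).ne, ← lintegral_slice_right hV.1]
    exact ENNReal.mul_lt_top (lintegral_enorm_sq_lt_top hφ) (lintegral_enorm_sq_lt_top hV)

lemma integral_mul_coeff [SFinite μ] (hφ : MemLp φ 2 μ) (hσ : MemLp σ 2 ν) (hV : MemLp V 2 (μ.prod ν)) :
    ∫ y, σ y * ∫ x, φ x * V (x, y) ∂μ ∂ν = ∫ p, σ p.2 * φ p.1 * V p ∂(μ.prod ν) := by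
  have h1 : Integrable (fun p => σ p.2 * φ p.1 * V p) (μ.prod ν) :=
    (memLp_smul_prod hσ hφ).integrable_mul hV
  rw [integral_prod_symm _ h1]
  congr 1; ext y
  rw [← integral_const_mul]
  congr 1; ext x
  ring

lemma integral_mul_coeff_left [SFinite μ] (hφ : MemLp φ 2 μ) (hσ : MemLp σ 2 ν) (hV : MemLp V 2 (μ.prod ν)) :
    ∫ x, φ x * ∫ y, σ y * V (x, y) ∂ν ∂μ = ∫ p, σ p.2 * φ p.1 * V p ∂(μ.prod ν) := by
  have h1 : Integrable (fun p => σ p.2 * φ p.1 * V p) (μ.prod ν) :=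
    (memLp_smul_prod hσ hφ).integrable_mul hV
  rw [integral_prod _ h1]
  congr 1; ext x
  rw [← integral_const_mul]
  congr 1; ext y
  ring

end Coefficients

lemma memLp_mul_of_tsupport_subset {X : Type*} [TopologicalSpace X] [MeasurableSpace X]
    [OpensMeasurableSpace X] {κ : Measure X} {r χ : X → ℝ} {U : Set X} (hU : IsOpen U)
    (hr : ContinuousOn r U) (hχ : Continuous χ) (hc : HasCompactSupport χ) (hs : tsupport χ ⊆ U)
    (hK : κ (tsupport χ) < ⊤) : MemLp (fun p => χ p * r p) 2 κ := by
  have hcont : Continuous fun p => χ p * r p := by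
    refine continuous_of_tsupport fun p hp => ?_
    have hpU : p ∈ U := hs (tsupport_mul_subset_left (f := χ) (g := r) hp)
    exact hχ.continuousAt.mul (hr.continuousAt (hU.mem_nhds hpU))
  have hcs : HasCompactSupport fun p => χ p * r p := hc.mul_right
  obtain ⟨C, hC⟩ := hcs.exists_bound_of_continuous hcont
  have e : (fun p => χ p * r p) = (tsupport χ).indicator fun p => χ p * r p := by
    refine (indicator_eq_self.2 fun p hp => ?_).symm
    exact subset_tsupport _ (left_ne_zero_of_mul hp)
  have : IsFiniteMeasure (κ.restrict (tsupport χ)) := ⟨by simpa using hK⟩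
  rw [e, memLp_indicator_iff_restrict (isClosed_tsupport χ).measurableSet]
  exact MemLp.of_bound hcont.aestronglyMeasurable C (Eventually.of_forall hC)

lemma halfLine_compact_lt_top (a : ℝ) {K : Set ℝ} (hK : IsCompact K) (hs : K ⊆ Ioi 0) :
    halfLine a K < ⊤ := by
  have h1 : IntegrableOn (fun y : ℝ => y ^ a) K :=
    ContinuousOn.integrableOn_compact hK fun y hy =>
      (Real.continuousAt_rpow_const _ _ (Or.inl (ne_of_gt (hs hy)))).continuousWithinAt
  rw [halfLine, withDensity_apply _ hK.measurableSet, Measure.restrict_restrict hK.measurableSet,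
    inter_eq_left.2 hs]
  exact h1.lintegral_lt_top

lemma IsTestFun.memLp_halfLine {ρ : ℝ → ℝ} (h : IsTestFun (Ioi 0) ρ) (a : ℝ) :
    MemLp (fun y => ρ y * y ^ (-a)) 2 (halfLine a) :=
  memLp_mul_of_tsupport_subset isOpen_Ioi (fun _ hy =>
    (Real.continuousAt_rpow_const _ _ (Or.inl (ne_of_gt hy))).continuousWithinAt)
    h.continuous h.compact h.support (halfLine_compact_lt_top a h.compact h.support)

section Cylinder

variable {n : ℕ} {Ω : Set (E n)} {a s : ℝ}

lemma cylMeasure_eq_prod : cylMeasure Ω a = ((gauss n).restrict Ω).prod (halfLine a) := rfl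

lemma cylMeasure_eq_withDensity (hΩ : MeasurableSet Ω) :
    cylMeasure Ω a = (volume.restrict (cyl Ω)).withDensity
      fun p => ENNReal.ofReal (dens p.1) * ENNReal.ofReal (p.2 ^ a) := by
  have := @continuous_dens n
  have hm : Measurable fun x : E n => ENNReal.ofReal (dens x) := by fun_prop
  have := SigmaFinite.withDensity_ofReal (μ := (volume : Measure (E n)).restrict Ω)
    (f := dens)
  have := SigmaFinite.withDensity_ofReal (μ := volume.restrict (Ioi (0 : ℝ)))
    (f := fun y => y ^ a)
  rw [cylMeasure, gauss_eq_withDensity, restrict_withDensity hΩ,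
    prod_withDensity hm (measurable_rpow_ofReal a), Measure.prod_restrict, cyl,
    ← Measure.volume_eq_prod]

lemma measurable_cylDensity : Measurable fun p : E n × ℝ =>
    ENNReal.ofReal (dens p.1) * ENNReal.ofReal (p.2 ^ a) := by
  have := @continuous_dens n
  fun_prop

lemma ae_cylMeasure_iff (hΩ : MeasurableSet Ω) {P : E n × ℝ → Prop} :
    (∀ᵐ p ∂(cylMeasure Ω a), P p) ↔ ∀ᵐ p ∂(volume.restrict (cyl Ω)), P p := by
  have hm : MeasurableSet (cyl Ω) := hΩ.prod measurableSet_Ioi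
  rw [cylMeasure_eq_withDensity hΩ, ae_withDensity_iff measurable_cylDensity,
    ae_restrict_iff' hm, ae_restrict_iff' hm]
  refine eventually_congr (Eventually.of_forall fun p => forall_congr' fun hp => ?_)
  have h1 := dens_pos p.1
  have h2 := Real.rpow_pos_of_pos hp.2 a
  simp [h1, h2]

lemma integral_cylMeasure (hΩ : MeasurableSet Ω) (f : E n × ℝ → ℝ) :
    ∫ p, f p ∂(cylMeasure Ω a) = ∫ p in cyl Ω, (dens p.1 * p.2 ^ a) * f p := by
  rw [cylMeasure_eq_withDensity hΩ, integral_withDensity_eq_integral_toReal_smul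
    measurable_cylDensity (Eventually.of_forall fun p =>
      ENNReal.mul_lt_top ENNReal.ofReal_lt_top ENNReal.ofReal_lt_top)]
  refine setIntegral_congr_fun (hΩ.prod measurableSet_Ioi) fun p hp => ?_
  simp only [smul_eq_mul, ENNReal.toReal_mul]
  rw [ENNReal.toReal_ofReal (dens_pos _).le,
    ENNReal.toReal_ofReal (Real.rpow_nonneg (le_of_lt hp.2) a)]

/-- The quotient of a function by the density of `dγ ⊗ y^a dy`. -/
def divCyl (a : ℝ) (χ : E n × ℝ → ℝ) (p : E n × ℝ) : ℝ := χ p * (dens p.1 * p.2 ^ a)⁻¹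

lemma integral_divCyl_mul (hΩ : MeasurableSet Ω) (f χ : E n × ℝ → ℝ) :
    ∫ p, divCyl a χ p * f p ∂(cylMeasure Ω a) = ∫ p in cyl Ω, f p * χ p := by
  rw [integral_cylMeasure hΩ]
  refine setIntegral_congr_fun (hΩ.prod measurableSet_Ioi) fun p hp => ?_
  have h1 := (dens_pos p.1).ne'
  have h2 := (Real.rpow_pos_of_pos hp.2 a).ne'
  simp only [divCyl]
  field_simp

lemma cylMeasure_compact_lt_top {K : Set (E n × ℝ)} (hK : IsCompact K) (hs : K ⊆ cyl Ω) :
    cylMeasure Ω a K < ⊤ := by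
  refine (measure_mono (t := univ ×ˢ (Prod.snd '' K)) fun p hp =>
    ⟨mem_univ _, p, hp, rfl⟩).trans_lt ?_
  rw [cylMeasure_eq_prod, Measure.prod_prod]
  refine ENNReal.mul_lt_top (measure_lt_top _ _)
    (halfLine_compact_lt_top a (hK.image continuous_snd) ?_)
  rintro _ ⟨p, hp, rfl⟩
  exact (hs hp).2

lemma IsTestFun.memLp_divCyl (hΩ : IsOpen Ω) {χ : E n × ℝ → ℝ} (h : IsTestFun (cyl Ω) χ) :
    MemLp (divCyl a χ) 2 (cylMeasure Ω a) := by
  refine memLp_mul_of_tsupport_subset (hΩ.prod isOpen_Ioi) (fun p hp => ?_) h.continuous h.compact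
    h.support (cylMeasure_compact_lt_top h.compact h.support)
  have h2 := (Real.rpow_pos_of_pos hp.2 a).ne'
  refine (ContinuousAt.inv₀ (continuous_dens.continuousAt.comp continuousAt_fst |>.mul
    ((Real.continuousAt_rpow_const _ _ (Or.inl (ne_of_gt hp.2))).comp continuousAt_snd))
    (mul_ne_zero (dens_pos p.1).ne' h2)).continuousWithinAt

lemma IsTestFun.prod {χ : E n → ℝ} {ρ : ℝ → ℝ} (hχ : IsTestFun Ω χ) (hρ : IsTestFun (Ioi 0) ρ) :
    IsTestFun (cyl Ω) (fun p => χ p.1 * ρ p.2) := by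
  have hsub : Function.support (fun p : E n × ℝ => χ p.1 * ρ p.2) ⊆ tsupport χ ×ˢ tsupport ρ :=
    fun p hp => ⟨subset_tsupport _ (left_ne_zero_of_mul hp),
      subset_tsupport _ (right_ne_zero_of_mul hp)⟩
  have hc : IsCompact (tsupport χ ×ˢ tsupport ρ) := IsCompact.prod hχ.compact hρ.compact
  exact ⟨(hχ.smooth.comp contDiff_fst).mul (hρ.smooth.comp contDiff_snd),
    HasCompactSupport.of_support_subset_isCompact hc hsub,
    (closure_minimal hsub hc.isClosed).trans (prod_mono hχ.support hρ.support)⟩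

lemma fderiv_prod_test {χ : E n → ℝ} {ρ : ℝ → ℝ} (hχ : Differentiable ℝ χ)
    (hρ : Differentiable ℝ ρ) (p : E n × ℝ) (e : E n) (t : ℝ) :
    fderiv ℝ (fun p : E n × ℝ => χ p.1 * ρ p.2) p (e, t) =
      fderiv ℝ χ p.1 e * ρ p.2 + χ p.1 * (t * deriv ρ p.2) := by
  have h1 : HasFDerivAt (fun p : E n × ℝ => χ p.1) _ p :=
    (hχ p.1).hasFDerivAt.comp p hasFDerivAt_fst
  have h2 : HasFDerivAt (fun p : E n × ℝ => ρ p.2) _ p :=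
    (hρ p.2).hasDerivAt.hasFDerivAt.comp p hasFDerivAt_snd
  have h3 : HasFDerivAt (fun p : E n × ℝ => χ p.1 * ρ p.2) _ p := h1.mul h2
  rw [h3.fderiv]
  simp
  ring

/-- Integration over the cylinder against a product, through the coefficient of the slices. -/
lemma integral_cyl_mul_prod (hΩ : MeasurableSet Ω) {V : E n × ℝ → ℝ} {φ : E n → ℝ} {ρ : ℝ → ℝ}
    (hV : MemLp V 2 (cylMeasure Ω a)) (hφ : MemLp φ 2 ((gauss n).restrict Ω))
    (hρ : IsTestFun (Ioi 0) ρ) :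
    ∫ p in cyl Ω, V p * (φ p.1 * dens p.1 * ρ p.2) =
      ∫ y in Ioi (0 : ℝ), (∫ x in Ω, φ x * V (x, y) ∂(gauss n)) * ρ y := by
  have h1 := integral_mul_coeff hφ (hρ.memLp_halfLine a) hV
  rw [← cylMeasure_eq_prod, integral_cylMeasure hΩ, integral_halfLine] at h1
  calc _ = ∫ p in cyl Ω, dens p.1 * p.2 ^ a * (ρ p.2 * p.2 ^ (-a) * φ p.1 * V p) := by
        refine setIntegral_congr_fun (hΩ.prod measurableSet_Ioi) fun p hp => ?_
        have h2 := (Real.rpow_pos_of_pos hp.2 a).ne'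
        simp only [Real.rpow_neg (le_of_lt hp.2)]
        field_simp
    _ = _ := by
        rw [← h1]
        refine setIntegral_congr_fun measurableSet_Ioi fun y hy => ?_
        have h2 := (Real.rpow_pos_of_pos hy a).ne'
        simp only [smul_eq_mul, Real.rpow_neg (le_of_lt hy)]
        field_simp

end Cylinder

section

/-! ### The trace of a function on the cylinder -/

variable {n : ℕ} {Ω : Set (E n)} {a s : ℝ} {v g : E n × ℝ → ℝ} {G : E n × ℝ → E n}

lemma IsTestFun.deriv {ρ : ℝ → ℝ} {U : Set ℝ} (h : IsTestFun U ρ) : IsTestFun U (deriv ρ) :=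
  h.fderiv_apply 1

lemma integral_halfLine_testFun (a : ℝ) (ρ c : ℝ → ℝ) :
    ∫ y, ρ y * y ^ (-a) * c y ∂(halfLine a) = ∫ y in Ioi (0 : ℝ), c y * ρ y := by
  rw [integral_halfLine]
  refine setIntegral_congr_fun measurableSet_Ioi fun y hy => ?_
  have h2 := (Real.rpow_pos_of_pos hy a).ne'
  simp only [smul_eq_mul, Real.rpow_neg (le_of_lt hy)]
  field_simp

lemma integrableOn_mul_testFun {c ρ : ℝ → ℝ} (hc : MemLp c 2 (halfLine a))
    (hρ : IsTestFun (Ioi 0) ρ) : IntegrableOn (fun y => c y * ρ y) (Ioi 0) := by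
  have := (integrable_halfLine _ _).1 (hc.integrable_mul (hρ.memLp_halfLine a))
  refine IntegrableOn.congr_fun this (fun y hy => ?_) measurableSet_Ioi
  have h2 := (Real.rpow_pos_of_pos hy a).ne'
  simp only [smul_eq_mul, Pi.mul_apply, Real.rpow_neg (le_of_lt hy)]
  field_simp

/-- The coefficient with respect to `φ` of the slices of a function on the cylinder. -/
def sliceCoeff (Ω : Set (E n)) (φ : E n → ℝ) (V : E n × ℝ → ℝ) (y : ℝ) : ℝ :=
  ∫ x in Ω, φ x * V (x, y) ∂(gauss n)

lemma memLp_sliceCoeff {V : E n × ℝ → ℝ} {φ : E n → ℝ} (hV : MemLp V 2 (cylMeasure Ω a))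
    (hφ : MemLp φ 2 ((gauss n).restrict Ω)) : MemLp (sliceCoeff Ω φ V) 2 (halfLine a) :=
  memLp_coeff hφ hV

/-- Weak derivatives pass to coefficients: for test functions `φ` this is the definition, and both
sides are continuous in `φ ∈ L²(Ω, γ)`. -/
lemma HasEnergyGradient.integral_sliceCoeff_mul_deriv (hΩ : IsOpen Ω)
    (h : HasEnergyGradient Ω a v G g) {φ : E n → ℝ} (hφ : MemLp φ 2 ((gauss n).restrict Ω))
    {ρ : ℝ → ℝ} (hρ : IsTestFun (Ioi 0) ρ) :
    ∫ y in Ioi (0 : ℝ), sliceCoeff Ω φ v y * deriv ρ y =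
      -∫ y in Ioi (0 : ℝ), sliceCoeff Ω φ g y * ρ y := by
  have hswap : ∀ {V : E n × ℝ → ℝ}, MemLp V 2 (cylMeasure Ω a) →
      MemLp (fun q : ℝ × E n => V q.swap) 2 ((halfLine a).prod ((gauss n).restrict Ω)) :=
    fun hV => MemLp.comp_measurePreserving hV Measure.measurePreserving_swap
  have hsl : ∀ {V : E n × ℝ → ℝ} {ρ : ℝ → ℝ}, MemLp V 2 (cylMeasure Ω a) → IsTestFun (Ioi 0) ρ →
      MemLp (fun x => ∫ y, ρ y * y ^ (-a) * V (x, y) ∂(halfLine a)) 2 ((gauss n).restrict Ω) :=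
    fun hV hρ => memLp_coeff (hρ.memLp_halfLine a) (hswap hV)
  have hint : ∀ {V : E n × ℝ → ℝ} {ρ : ℝ → ℝ} {φ : E n → ℝ}, MemLp V 2 (cylMeasure Ω a) →
      IsTestFun (Ioi 0) ρ → MemLp φ 2 ((gauss n).restrict Ω) →
      ∫ x in Ω, φ x * ∫ y, ρ y * y ^ (-a) * V (x, y) ∂(halfLine a) ∂(gauss n) =
        ∫ y in Ioi (0 : ℝ), sliceCoeff Ω φ V y * ρ y := fun hV hρ hφ => by
    rw [integral_mul_coeff_left hφ (hρ.memLp_halfLine a) hV,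
      ← integral_mul_coeff hφ (hρ.memLp_halfLine a) hV]
    exact integral_halfLine_testFun _ _ _
  have hv := hsl h.memLp hρ.deriv
  have hg := hsl h.memLp_y hρ
  have hsum : ∀ {φ : E n → ℝ}, MemLp φ 2 ((gauss n).restrict Ω) →
      ∫ x in Ω, (∫ y, deriv ρ y * y ^ (-a) * v (x, y) ∂(halfLine a) +
        ∫ y, ρ y * y ^ (-a) * g (x, y) ∂(halfLine a)) * φ x ∂(gauss n) =
      (∫ y in Ioi (0 : ℝ), sliceCoeff Ω φ v y * deriv ρ y) +
        ∫ y in Ioi (0 : ℝ), sliceCoeff Ω φ g y * ρ y := fun {φ} hφ => by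
    rw [← hint h.memLp hρ.deriv hφ, ← hint h.memLp_y hρ hφ]
    refine Eq.trans ?_ (integral_add (hφ.integrable_mul hv) (hφ.integrable_mul hg))
    congr 1; ext x
    exact (add_mul _ _ _).trans (by rw [mul_comm, mul_comm (∫ y, ρ y * _ * _ ∂_)])
  have hzero := ae_eq_zero_of_forall_testFun hΩ (hv.add hg) fun ζ hζ => by
    -- The factor `dens` turns the Lebesgue integrals of the weak form into Gaussian ones.
    have h1 := h.weak.weak_y _ ((hζ.mul_smooth contDiff_dens).prod hρ)
    simp_rw [fderiv_prod_test (hζ.mul_smooth contDiff_dens).differentiable hρ.differentiable,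
      map_zero, zero_mul, zero_add, one_mul] at h1
    rw [integral_cyl_mul_prod hΩ.measurableSet h.memLp hζ.memLp hρ.deriv,
      integral_cyl_mul_prod hΩ.measurableSet h.memLp_y hζ.memLp hρ] at h1
    have h2 := hsum hζ.memLp
    simp only [Pi.add_apply]
    rw [h2]
    unfold sliceCoeff
    rw [h1]; ring
  have h3 := hsum hφ
  rw [integral_congr_ae (g := fun _ => 0), integral_zero] at h3
  · linarith
  · filter_upwards [hzero] with x hx
    simp only [Pi.add_apply, Pi.zero_apply] at hx
    rw [hx, zero_mul]

/-- The weak form of the `x`-gradient on almost every slice. -/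
lemma HasEnergyGradient.ae_slice_fderiv (hs0 : 0 < s) (hΩ : IsOpen Ω)
    (h : HasEnergyGradient Ω (1 - 2 * s) v G g) {χ : E n → ℝ} (hχ : IsTestFun Ω χ) (e : E n) :
    ∀ᵐ y ∂(volume.restrict (Ioi (0 : ℝ))),
      sliceCoeff Ω (divDens fun x => fderiv ℝ χ x e) v y +
        sliceCoeff Ω (divDens χ) (fun p => ⟪G p, e⟫) y = 0 := by
  have hGe : MemLp (fun p => ⟪G p, e⟫) 2 (cylMeasure Ω (1 - 2 * s)) := h.memLp_x.inner_const e
  have hd := (hχ.fderiv_apply e).divDens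
  have h1 := memLp_sliceCoeff h.memLp hd.memLp
  have h2 := memLp_sliceCoeff hGe hχ.divDens.memLp
  have := isOpen_Ioi.ae_eq_zero_of_integral_contDiff_smul_eq_zero (μ := volume)
    (locallyIntegrableOn_of_halfLine hs0 (h1.add h2)) fun ρ r1 r2 r3 => by
      have hρ : IsTestFun (Ioi 0) ρ := ⟨r1, r2, r3⟩
      rw [← setIntegral_eq_integral_of_forall_compl_eq_zero (s := Ioi 0)
        fun y hy => by rw [hρ.eq_zero hy, zero_smul]]
      have h3 := h.weak.weak_x _ (hχ.prod hρ) e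
      simp_rw [fderiv_prod_test hχ.differentiable hρ.differentiable, zero_mul, mul_zero,
        add_zero] at h3
      have e1 := integral_cyl_mul_prod hΩ.measurableSet h.memLp hd.memLp hρ
      have e2 := integral_cyl_mul_prod hΩ.measurableSet hGe hχ.divDens.memLp hρ
      have e3 : ∀ (χ : E n → ℝ) x, divDens χ x * dens x = χ x := fun χ x => by
        rw [OUTrace.divDens, inv_mul_cancel_right₀ (dens_pos x).ne']
      simp_rw [e3] at e1 e2
      rw [e1, e2] at h3
      calc _ = ∫ y in Ioi (0 : ℝ), (sliceCoeff Ω (divDens fun x => fderiv ℝ χ x e) v y * ρ y +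
            sliceCoeff Ω (divDens χ) (fun p => ⟪G p, e⟫) y * ρ y) := by
            congr 1; ext y
            simp only [smul_eq_mul, Pi.add_apply]; ring
        _ = 0 := by
            rw [integral_add (integrableOn_mul_testFun h1 hρ) (integrableOn_mul_testFun h2 hρ)]
            unfold sliceCoeff
            rw [h3]; ring
  rw [ae_restrict_iff' measurableSet_Ioi]
  exact this

/-- The `x`-gradient of a function of finite energy is, on almost every slice, its gradient in
`H¹₀(Ω, γ)`. A countable set of test functions, dense in `L²(Ω, γ)`, is enough to compare the two,
so a common null set can be discarded. -/
lemma HasEnergyGradient.ae_hasH10Gradient (hs0 : 0 < s) (hΩ : IsOpen Ω)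
    (h : HasEnergyGradient Ω (1 - 2 * s) v G g) :
    ∀ᵐ y ∂(volume.restrict (Ioi (0 : ℝ))),
      HasH10Gradient Ω (fun x => v (x, y)) (fun x => G (x, y)) := by
  -- `T` is the set of classes of test functions in `L²(Ω, γ)`, `t` its countable dense subset.
  let T : Set (L2 Ω) := {z | ∃ ζ : E n → ℝ, IsTestFun Ω ζ ∧ z =ᵐ[(gauss n).restrict Ω] ζ}
  have : Fact ((2 : ℝ≥0∞) ≠ ⊤) := ⟨by norm_num⟩
  obtain ⟨t, htT, htc, hTt⟩ :=
    (TopologicalSpace.IsSeparable.of_separableSpace T).exists_countable_dense_subset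
  have htT' : ∀ z ∈ t, ∃ ζ : E n → ℝ, IsTestFun Ω ζ ∧ z =ᵐ[(gauss n).restrict Ω] ζ := htT
  choose! ζ hζ hzζ using htT'
  have hcount : ∀ᵐ y ∂(volume.restrict (Ioi (0 : ℝ))), ∀ z ∈ t, ∀ i : Fin n,
      sliceCoeff Ω (divDens fun x => fderiv ℝ (fun x => ζ z x * dens x) x
        (EuclideanSpace.single i 1)) v y +
      sliceCoeff Ω (divDens fun x => ζ z x * dens x)
        (fun p => ⟪G p, EuclideanSpace.single i 1⟫) y = 0 := by
    rw [ae_ball_iff htc]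
    intro z hz
    rw [ae_all_iff]
    intro i
    exact h.ae_slice_fderiv hs0 hΩ ((hζ z hz).mul_smooth contDiff_dens) _
  have hGsl := (ae_halfLine_iff _).1 (memLp_slice_right h.memLp_x)
  filter_upwards [hcount, hGsl, h.lateral] with y hy hG hlat
  obtain ⟨G', hG'⟩ := hlat
  suffices he : G' =ᵐ[(gauss n).restrict Ω] fun x => G (x, y) by
    obtain ⟨w, hw, hw1, hw2⟩ := hasH10Gradient_iff.1 hG'
    exact hasH10Gradient_iff.2 ⟨w, hw, hw1, hw2.trans he⟩
  obtain ⟨w, hw, hw1, hw2⟩ := hasH10Gradient_iff.1 hG'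
  have hcoord : ∀ i : Fin n, ∀ᵐ x ∂((gauss n).restrict Ω),
      ⟪G' x - G (x, y), EuclideanSpace.single i (1 : ℝ)⟫ = 0 := by
    intro i
    have hD : MemLp (fun x => ⟪G' x - G (x, y), EuclideanSpace.single i (1 : ℝ)⟫) 2
        ((gauss n).restrict Ω) := (hG'.2.1.sub hG).inner_const _
    have hclosed : IsClosed {z : L2 Ω | ⟪hD.toLp _, z⟫ = 0} :=
      isClosed_eq (by fun_prop) continuous_const
    have htsub : t ⊆ {z : L2 Ω | ⟪hD.toLp _, z⟫ = 0} := by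
      intro z hz
      have hχ := (hζ z hz).mul_smooth (contDiff_dens (n := n))
      have e0 : divDens (fun x => ζ z x * dens x) = ζ z := by
        ext x
        rw [OUTrace.divDens, mul_inv_cancel_right₀ (dens_pos x).ne']
      have h1 := hy z hz i
      have h2 := H10_integral_fderiv hΩ hw hχ (EuclideanSpace.single i 1)
      rw [← setIntegral_mul_divDens hΩ.measurableSet, ← setIntegral_mul_divDens hΩ.measurableSet,
        e0] at h2
      rw [e0] at h1
      have e1 : sliceCoeff Ω (divDens fun x => fderiv ℝ (fun x => ζ z x * dens x) x
          (EuclideanSpace.single i 1)) v y = ∫ x in Ω, w.fst x *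
          divDens (fun x => fderiv ℝ (fun x => ζ z x * dens x) x (EuclideanSpace.single i 1)) x
          ∂(gauss n) := by
        refine integral_congr_ae ?_
        filter_upwards [hw1] with x hx
        rw [hx]; ring
      have e2 : ∫ x in Ω, ⟪w.snd x, EuclideanSpace.single i (1 : ℝ)⟫ * ζ z x ∂(gauss n) =
          ∫ x in Ω, ⟪G' x, EuclideanSpace.single i (1 : ℝ)⟫ * ζ z x ∂(gauss n) := by
        refine integral_congr_ae ?_
        filter_upwards [hw2] with x hx
        rw [hx]
      have i1 : Integrable (fun x => ⟪G' x, EuclideanSpace.single i (1 : ℝ)⟫ * ζ z x)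
          ((gauss n).restrict Ω) := (hG'.2.1.inner_const _).integrable_mul (hζ z hz).memLp
      have i2 : Integrable (fun x => ⟪G (x, y), EuclideanSpace.single i (1 : ℝ)⟫ * ζ z x)
          ((gauss n).restrict Ω) := (hG.inner_const _).integrable_mul (hζ z hz).memLp
      rw [e1, h2, e2] at h1
      change ⟪hD.toLp _, z⟫ = 0
      rw [inner_toLp hD z]
      calc _ = ∫ x in Ω, (⟪G' x, EuclideanSpace.single i (1 : ℝ)⟫ * ζ z x -
            ⟪G (x, y), EuclideanSpace.single i (1 : ℝ)⟫ * ζ z x) ∂(gauss n) := by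
            refine integral_congr_ae ?_
            filter_upwards [hzζ z hz] with x hx
            rw [hx, inner_sub_left]
            simp only [RCLike.inner_apply, conj_trivial]
            ring
        _ = 0 := by
            rw [integral_sub i1 i2]
            unfold sliceCoeff at h1
            simp_rw [mul_comm (ζ z _)] at h1
            linarith
    refine ae_eq_zero_of_forall_testFun hΩ hD fun η hη => ?_
    have h3 : ⟪hD.toLp _, hη.memLp.toLp η⟫ = 0 := closure_minimal htsub hclosed
      (hTt ⟨η, hη, hη.memLp.coeFn_toLp⟩)
    rw [inner_toLp] at h3
    rw [← h3]
    refine integral_congr_ae ?_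
    filter_upwards [hη.memLp.coeFn_toLp] with x hx
    rw [hx]
    simp [mul_comm]
  rw [← ae_all_iff] at hcoord
  filter_upwards [hcoord] with x hx
  rw [← sub_eq_zero]
  ext i
  have := hx i
  simpa [EuclideanSpace.inner_single_right] using this

end

section

/-! ### The trace inequality -/

section Hilbert

variable {H : Type*} [NormedAddCommGroup H] [InnerProductSpace ℝ H]

lemma hasSum_inner_sq {ι : Type*} (b : HilbertBasis ι ℝ H) (x : H) :
    HasSum (fun k => ⟪b k, x⟫ ^ 2) (‖x‖ ^ 2) := by
  have := b.hasSum_inner_mul_inner x x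
  rw [real_inner_self_eq_norm_sq] at this
  refine this.congr_fun fun k => ?_
  rw [sq, real_inner_comm x]

lemma enorm_sq_eq_tsum_inner {ι : Type*} (b : HilbertBasis ι ℝ H) (x : H) :
    ‖x‖ₑ ^ 2 = ∑' k, ‖⟪b k, x⟫‖ₑ ^ 2 := by
  have h := hasSum_inner_sq b x
  have e : ∀ t : ℝ, ‖t‖ₑ ^ 2 = ENNReal.ofReal (t ^ 2) := fun t => by
    rw [← ofReal_norm, ← ENNReal.ofReal_pow (norm_nonneg _), Real.norm_eq_abs, sq_abs]
  simp_rw [e]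
  rw [← ENNReal.ofReal_tsum_of_nonneg (fun _ => sq_nonneg _) h.summable, h.tsum_eq,
    ← ofReal_norm, ENNReal.ofReal_pow (norm_nonneg _)]

lemma exists_inner_eq_of_summable_sq (b : HilbertBasis ℕ ℝ H) [CompleteSpace H] {c : ℕ → ℝ}
    (hc : Summable fun k => c k ^ 2) : ∃ u, ∀ k, ⟪b k, u⟫ = c k := by
  have hm : Memℓp c 2 := by
    refine memℓp_gen ?_
    simpa using hc
  refine ⟨b.repr.symm ⟨c, hm⟩, fun k => ?_⟩
  rw [← b.repr_apply_apply]
  simp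

end Hilbert

variable {n : ℕ} {Ω : Set (E n)} {s : ℝ} {v g : E n × ℝ → ℝ} {G : E n × ℝ → E n}
  {lam : ℕ → ℝ} {ψ : HilbertBasis ℕ ℝ (L2 Ω)}

lemma inner_snd_of_eigen {W : ℕ → PairL2 Ω} (hW : ∀ k, W k ∈ H10 Ω ∧ (W k).fst = ψ k ∧
    ∀ w ∈ H10 Ω, ⟪(W k).snd, w.snd⟫ = lam k * ⟪ψ k, w.fst⟫) (j k : ℕ) :
    ⟪(W j).snd, (W k).snd⟫ = if j = k then lam j else 0 := by
  rw [(hW j).2.2 _ (hW k).1, (hW k).2.1, orthonormal_iff_ite.1 ψ.orthonormal]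
  simp

/-- Bessel's inequality for the gradients of the eigenfunctions, which are orthogonal with
`‖∇ψ_k‖² = lam_k`. -/
lemma IsDirichletEigenSystem.sum_le (h : IsDirichletEigenSystem Ω lam ψ) {w : PairL2 Ω}
    (hw : w ∈ H10 Ω) (F : Finset ℕ) :
    ∑ k ∈ F, lam k * ⟪ψ k, w.fst⟫ ^ 2 ≤ ‖w.snd‖ ^ 2 := by
  obtain ⟨W, hW⟩ := h.exists_pair
  have hon : Orthonormal ℝ fun k => (√(lam k))⁻¹ • (W k).snd := by
    rw [orthonormal_iff_ite]
    intro j k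
    rw [real_inner_smul_left, real_inner_smul_right, inner_snd_of_eigen hW]
    split_ifs with hjk
    · subst hjk
      have h1 := Real.sqrt_pos.2 (h.pos j)
      have h2 := Real.mul_self_sqrt (h.pos j).le
      field_simp
      rw [sq, h2]
    · simp
  refine le_trans (le_of_eq ?_) (hon.sum_inner_products_le w.snd (s := F))
  refine Finset.sum_congr rfl fun k _ => ?_
  rw [real_inner_smul_left, (hW k).2.2 w hw, Real.norm_eq_abs, sq_abs]
  have h1 := Real.sqrt_pos.2 (h.pos k)
  have h2 := Real.sq_sqrt (h.pos k).le
  field_simp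
  rw [h2]; ring

lemma inner_toLp_slice {V : E n × ℝ → ℝ} {y : ℝ}
    (hy : MemLp (fun x => V (x, y)) 2 ((gauss n).restrict Ω)) (φ : L2 Ω) :
    ⟪φ, hy.toLp _⟫ = sliceCoeff Ω φ V y := by
  rw [real_inner_comm, inner_toLp]
  simp [sliceCoeff]

/-- The energy controls the one-dimensional energies of the coefficients. -/
lemma HasEnergyGradient.sum_integral_sliceCoeff_le (hs0 : 0 < s) (hΩ : IsOpen Ω)
    (h : HasEnergyGradient Ω (1 - 2 * s) v G g) (hψ : IsDirichletEigenSystem Ω lam ψ)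
    (F : Finset ℕ) :
    ∑ k ∈ F, (lam k * ∫ y, sliceCoeff Ω (ψ k) v y ^ 2 ∂(halfLine (1 - 2 * s)) +
      ∫ y, sliceCoeff Ω (ψ k) g y ^ 2 ∂(halfLine (1 - 2 * s))) ≤ energy Ω (1 - 2 * s) G g := by
  have hf := fun k => (memLp_sliceCoeff h.memLp (Lp.memLp (ψ k))).integrable_sq
  have hg := fun k => (memLp_sliceCoeff h.memLp_y (Lp.memLp (ψ k))).integrable_sq
  have hE : Integrable (fun p => ‖G p‖ ^ 2 + g p ^ 2) (cylMeasure Ω (1 - 2 * s)) :=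
    (h.memLp_x.integrable_norm_pow (p := 2) (by norm_num)).add h.memLp_y.integrable_sq
  have hfg : ∀ k, Integrable (fun y => lam k * sliceCoeff Ω (ψ k) v y ^ 2 +
      sliceCoeff Ω (ψ k) g y ^ 2) (halfLine (1 - 2 * s)) := fun k =>
    ((hf k).const_mul _).add (hg k)
  have e1 : ∑ k ∈ F, (lam k * ∫ y, sliceCoeff Ω (ψ k) v y ^ 2 ∂(halfLine (1 - 2 * s)) +
      ∫ y, sliceCoeff Ω (ψ k) g y ^ 2 ∂(halfLine (1 - 2 * s))) =
      ∫ y, ∑ k ∈ F, (lam k * sliceCoeff Ω (ψ k) v y ^ 2 + sliceCoeff Ω (ψ k) g y ^ 2)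
        ∂(halfLine (1 - 2 * s)) := by
    rw [integral_finsetSum _ fun k _ => hfg k]
    refine Finset.sum_congr rfl fun k _ => ?_
    rw [integral_add ((hf k).const_mul _) (hg k), integral_const_mul]
  rw [cylMeasure_eq_prod] at hE
  rw [e1, energy, cylMeasure_eq_prod, integral_prod_symm _ hE]
  refine integral_mono_ae (integrable_finsetSum _ fun k _ => hfg k)
    hE.integral_prod_right ?_
  filter_upwards [(ae_halfLine_iff _).2 (h.ae_hasH10Gradient hs0 hΩ),
    memLp_slice_right h.memLp_y] with y hy hgy
  obtain ⟨w, hw, hw1, hw2⟩ := hasH10Gradient_iff.1 hy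
  have h1 := hψ.sum_le hw F
  have h2 : ∑ k ∈ F, ⟪ψ k, hgy.toLp _⟫ ^ 2 ≤ ‖hgy.toLp _‖ ^ 2 :=
    sum_le_hasSum _ (fun _ _ => sq_nonneg _) (hasSum_inner_sq ψ _)
  rw [norm_sq_Lp] at h1 h2
  have e2 : ∀ k, ⟪ψ k, w.fst⟫ = sliceCoeff Ω (ψ k) v y := fun k => by
    rw [← inner_toLp_slice hy.1]
    congr 1
    exact Lp.ext (hw1.trans hy.1.coeFn_toLp.symm)
  have e3 : ∫ x in Ω, ‖w.snd x‖ ^ 2 ∂(gauss n) = ∫ x in Ω, ‖G (x, y)‖ ^ 2 ∂(gauss n) := by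
    refine integral_congr_ae ?_
    filter_upwards [hw2] with x hx
    rw [hx]
  have e4 : ∫ x in Ω, ‖hgy.toLp _ x‖ ^ 2 ∂(gauss n) = ∫ x in Ω, g (x, y) ^ 2 ∂(gauss n) := by
    refine integral_congr_ae ?_
    filter_upwards [hgy.coeFn_toLp] with x hx
    rw [hx, Real.norm_eq_abs, sq_abs]
  simp_rw [e2] at h1
  simp_rw [inner_toLp_slice] at h2
  rw [e3] at h1
  rw [e4] at h2
  rw [Finset.sum_add_distrib, integral_add (hy.2.1.integrable_norm_pow (p := 2) (by norm_num))
    hgy.integrable_sq]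
  exact add_le_add h1 h2

lemma eventually_trace_filter {P : ℝ → Prop}
    (h : ∀ᵐ y ∂(volume.restrict (Ioi (0 : ℝ))), P y) :
    ∀ᶠ y in ae volume ⊓ 𝓝[>] (0 : ℝ), P y := by
  rw [ae_restrict_iff' measurableSet_Ioi] at h
  filter_upwards [mem_inf_of_left h, mem_inf_of_right self_mem_nhdsWithin] with y h1 h2 using h1 h2

/-- A null set of `y` does not exhaust a right neighbourhood of zero, so essential limits at zero
are unique. -/
instance neBot_trace_filter : (ae volume ⊓ 𝓝[>] (0 : ℝ)).NeBot := by
  refine inf_neBot_iff.2 fun {S} hS {T} hT => ?_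
  obtain ⟨ε, hε, hsub⟩ := mem_nhdsGT_iff_exists_Ioo_subset.1 hT
  by_contra hemp
  have h1 : Ioo 0 ε ⊆ Sᶜ := fun y hy hyS => hemp ⟨y, hyS, hsub hy⟩
  have h2 : volume (Ioo (0 : ℝ) ε) = 0 := measure_mono_null h1 hS
  rw [Real.volume_Ioo, ENNReal.ofReal_eq_zero] at h2
  exact absurd h2 (by simpa using hε)

lemma tendsto_zero_of_sq {ι : Type*} {l : Filter ι} {f : ι → ℝ≥0∞}
    (h : Tendsto (fun i => f i ^ 2) l (𝓝 0)) : Tendsto f l (𝓝 0) := by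
  have h1 := (ENNReal.continuous_rpow_const (y := 1 / 2)).tendsto (0 : ℝ≥0∞) |>.comp h
  rw [ENNReal.zero_rpow_of_pos (by norm_num)] at h1
  refine h1.congr fun i => ?_
  simp only [Function.comp_apply]
  rw [← ENNReal.rpow_natCast, ← ENNReal.rpow_mul]
  norm_num

/-- Parseval's identity for the difference of a slice and its trace. -/
lemma eLpNorm_slice_sub_sq {V : E n × ℝ → ℝ} {y : ℝ}
    (hy : MemLp (fun x => V (x, y)) 2 ((gauss n).restrict Ω)) (ψ : HilbertBasis ℕ ℝ (L2 Ω))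
    (u : L2 Ω) :
    eLpNorm (fun x => V (x, y) - u x) 2 ((gauss n).restrict Ω) ^ 2 =
      ∑' k, ‖sliceCoeff Ω (ψ k) V y - ⟪ψ k, u⟫‖ₑ ^ 2 := by
  have e : eLpNorm (fun x => V (x, y) - u x) 2 ((gauss n).restrict Ω) = ‖hy.toLp _ - u‖ₑ := by
    rw [Lp.enorm_def]
    refine eLpNorm_congr_ae ?_
    filter_upwards [Lp.coeFn_sub (hy.toLp _) u, hy.coeFn_toLp] with x h1 h2
    rw [h1, Pi.sub_apply, h2]
  rw [e, enorm_sq_eq_tsum_inner ψ]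
  simp_rw [inner_sub_right, inner_toLp_slice]

lemma isTrace_unique {a : ℝ} (hv : MemLp v 2 (cylMeasure Ω a)) {u u' : L2 Ω} (h : IsTrace v u)
    (h' : IsTrace v u') : u = u' := by
  have hsl := eventually_trace_filter ((ae_halfLine_iff _).1 (memLp_slice_right hv))
  have h1 := h.add h'
  rw [add_zero] at h1
  have h2 : ∀ᶠ y in ae volume ⊓ 𝓝[>] (0 : ℝ), ‖u - u'‖ₑ ≤
      eLpNorm (fun x => v (x, y) - u x) 2 ((gauss n).restrict Ω) +
        eLpNorm (fun x => v (x, y) - u' x) 2 ((gauss n).restrict Ω) := by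
    filter_upwards [hsl] with y hy
    rw [Lp.enorm_def, add_comm]
    refine le_trans (le_of_eq (eLpNorm_congr_ae ?_)) (eLpNorm_sub_le
      (hy.1.sub (Lp.aestronglyMeasurable u')) (hy.1.sub (Lp.aestronglyMeasurable u)) (by norm_num))
    filter_upwards [Lp.coeFn_sub u u'] with x hx
    rw [hx]
    simp
  have h3 := ge_of_tendsto h1 h2
  rw [nonpos_iff_eq_zero, enorm_eq_zero, sub_eq_zero] at h3
  exact h3

/-- Functions of finite energy have a trace. Its coefficients are the traces of the coefficients,
so the weighted trace inequality on the half line can be summed. -/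
theorem HasEnergyGradient.exists_trace (hs0 : 0 < s) (hs1 : s < 1) (hΩ : IsOpen Ω)
    (h : HasEnergyGradient Ω (1 - 2 * s) v G g) (hψ : IsDirichletEigenSystem Ω lam ψ) :
    ∃ u : L2 Ω, IsTrace v u ∧ u ∈ fracSpace lam ψ s ∧
      ∑' k, lam k ^ s * ⟪u, ψ k⟫ ^ 2 ≤ (traceConst s)⁻¹ * energy Ω (1 - 2 * s) G g := by
  have hf := fun k => memLp_sliceCoeff h.memLp (Lp.memLp (ψ k))
  have hg := fun k => memLp_sliceCoeff h.memLp_y (Lp.memLp (ψ k))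
  choose f₀ hf₀ using fun k => exists_halfLine_trace hs0 (hf k) (hg k) fun ρ hρ =>
    h.integral_sliceCoeff_mul_deriv hΩ (Lp.memLp (ψ k)) hρ
  have hc := traceConst_pos hs0 hs1
  have hsum : ∀ F : Finset ℕ, ∑ k ∈ F, lam k ^ s * f₀ k ^ 2 ≤
      (traceConst s)⁻¹ * energy Ω (1 - 2 * s) G g := fun F => by
    rw [inv_mul_eq_div, le_div_iff₀' hc, Finset.mul_sum]
    refine le_trans (Finset.sum_le_sum fun k _ => ?_) (h.sum_integral_sliceCoeff_le hs0 hΩ hψ F)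
    rw [← mul_assoc]
    exact halfLine_trace_inequality hs0 hs1 (hψ.pos k) (hf k) (hg k) (hf₀ k)
  have hnn : ∀ k, 0 ≤ lam k ^ s * f₀ k ^ 2 := fun k =>
    mul_nonneg (Real.rpow_nonneg (hψ.pos k).le _) (sq_nonneg _)
  have hsumm := summable_of_sum_le hnn hsum
  -- As `lam k ≥ lam 0 > 0`, the traces of the coefficients are square summable.
  have hl0 : 0 < lam 0 ^ s := Real.rpow_pos_of_pos (hψ.pos 0) s
  have hsq : Summable fun k => f₀ k ^ 2 := by
    refine Summable.of_nonneg_of_le (fun k => sq_nonneg _) (fun k => ?_)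
      (hsumm.mul_left (lam 0 ^ s)⁻¹)
    rw [← mul_assoc]
    refine le_mul_of_one_le_left (sq_nonneg _) ?_
    rw [inv_mul_eq_div, one_le_div hl0]
    exact Real.rpow_le_rpow (hψ.pos 0).le (hψ.mono (Nat.zero_le k)) hs0.le
  obtain ⟨u, hu⟩ := exists_inner_eq_of_summable_sq ψ hsq
  have hu' : ∀ k, ⟪u, ψ k⟫ = f₀ k := fun k => by rw [real_inner_comm, hu]
  refine ⟨u, ?_, ?_, ?_⟩
  · set M := ∫⁻ p, ‖g p‖ₑ ^ 2 ∂(cylMeasure Ω (1 - 2 * s)) with hM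
    have hMtop : M ≠ ⊤ := (lintegral_enorm_sq_lt_top h.memLp_y).ne
    have hMsum : ∑' k, ∫⁻ y, ‖sliceCoeff Ω (ψ k) g y‖ₑ ^ 2 ∂(halfLine (1 - 2 * s)) ≤ M := by
      have hgm := h.memLp_y.1
      rw [cylMeasure_eq_prod] at hgm
      rw [← lintegral_tsum fun k => (hg k).1.enorm.pow_const 2, hM, cylMeasure_eq_prod,
        lintegral_slice_right hgm]
      refine lintegral_mono_ae ?_
      filter_upwards [memLp_slice_right h.memLp_y] with y hy
      have := enorm_sq_eq_tsum_inner ψ (hy.toLp _)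
      simp_rw [inner_toLp_slice] at this
      rw [← this, Lp.enorm_def, eLpNorm_congr_ae hy.coeFn_toLp, eLpNorm_two_sq]
    have hbd : ∀ᵐ y ∂(volume.restrict (Ioi (0 : ℝ))),
        eLpNorm (fun x => v (x, y) - u x) 2 ((gauss n).restrict Ω) ^ 2 ≤
          ENNReal.ofReal (y ^ (2 * s) / (2 * s)) * M := by
      filter_upwards [(ae_halfLine_iff _).1 (memLp_slice_right h.memLp),
        ae_all_iff.2 fun k => enorm_sub_trace_sq_le hs0 (hg k) (hf₀ k)] with y hy hk
      rw [eLpNorm_slice_sub_sq hy ψ]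
      simp_rw [hu]
      refine (ENNReal.tsum_le_tsum hk).trans ?_
      rw [ENNReal.tsum_mul_left]
      gcongr
    have hlim : Tendsto (fun y : ℝ => ENNReal.ofReal (y ^ (2 * s) / (2 * s)) * M)
        (ae volume ⊓ 𝓝[>] (0 : ℝ)) (𝓝 0) := by
      have h1 : Tendsto (fun y : ℝ => y ^ (2 * s) / (2 * s)) (𝓝 0) (𝓝 0) := by
        have := ((Real.continuousAt_rpow_const 0 (2 * s) (Or.inr (by linarith))).div_const
          (2 * s)).tendsto
        rwa [Real.zero_rpow (by linarith), zero_div] at this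
      have h2 := ENNReal.Tendsto.mul_const (b := M) (ENNReal.tendsto_ofReal h1) (Or.inr hMtop)
      rw [ENNReal.ofReal_zero, zero_mul] at h2
      exact h2.mono_left (inf_le_right.trans nhdsWithin_le_nhds)
    refine tendsto_zero_of_sq ?_
    exact tendsto_of_tendsto_of_tendsto_of_le_of_le' tendsto_const_nhds hlim
      (Eventually.of_forall fun _ => zero_le) (eventually_trace_filter hbd)
  · change Summable _
    simpa only [hu'] using hsumm
  · simp only [hu']
    exact hsumm.tsum_le_of_sum_le hsum

end

/-! ### Orthogonal series -/

section Orthogonal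

variable {H : Type*} [NormedAddCommGroup H] [InnerProductSpace ℝ H] {x : ℕ → H}

lemma norm_sq_sum_of_orthogonal (ho : ∀ i j, i ≠ j → ⟪x i, x j⟫ = 0) (F : Finset ℕ) :
    ‖∑ k ∈ F, x k‖ ^ 2 = ∑ k ∈ F, ‖x k‖ ^ 2 := by
  rw [← real_inner_self_eq_norm_sq, sum_inner]
  refine Finset.sum_congr rfl fun i hi => ?_
  rw [inner_sum, Finset.sum_eq_single_of_mem i hi fun j _ hj => ho i j hj.symm,
    real_inner_self_eq_norm_sq]

lemma summable_of_orthogonal [CompleteSpace H] (ho : ∀ i j, i ≠ j → ⟪x i, x j⟫ = 0)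
    (hs : Summable fun k => ‖x k‖ ^ 2) : Summable x := by
  rw [summable_iff_vanishing_norm] at hs ⊢
  intro ε hε
  obtain ⟨F, hF⟩ := hs (ε ^ 2) (by positivity)
  refine ⟨F, fun t ht => ?_⟩
  have := (le_abs_self _).trans_lt (hF t ht)
  rw [← norm_sq_sum_of_orthogonal ho] at this
  exact lt_of_pow_lt_pow_left₀ 2 hε.le this

lemma hasSum_norm_sq_of_orthogonal (ho : ∀ i j, i ≠ j → ⟪x i, x j⟫ = 0) {X : H}
    (hX : HasSum x X) : HasSum (fun k => ‖x k‖ ^ 2) (‖X‖ ^ 2) := by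
  have h1 : Tendsto (fun F : Finset ℕ => ‖∑ k ∈ F, x k‖ ^ 2) atTop (𝓝 (‖X‖ ^ 2)) :=
    (hX.norm).pow 2
  simp_rw [norm_sq_sum_of_orthogonal ho] at h1
  exact h1

lemma hilbertBasis_ext (b : HilbertBasis ℕ ℝ H) {u v : H} (h : ∀ k, ⟪b k, u⟫ = ⟪b k, v⟫) :
    u = v := by
  refine b.repr.injective (lp.ext (funext fun k => ?_))
  rw [b.repr_apply_apply, b.repr_apply_apply, h]

lemma hasSum_smul_of_inner_eq (b : HilbertBasis ℕ ℝ H) {u : H} {c : ℕ → ℝ}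
    (h : ∀ k, ⟪b k, u⟫ = c k) : HasSum (fun k => c k • b k) u := by
  have := b.hasSum_repr u
  simp_rw [b.repr_apply_apply, h] at this
  exact this

lemma inner_tsum_smul [CompleteSpace H] (b : HilbertBasis ℕ ℝ H) {c : ℕ → ℝ}
    (hc : Summable fun k => c k ^ 2) (j : ℕ) : ⟪b j, ∑' k, c k • b k⟫ = c j := by
  obtain ⟨u, hu⟩ := exists_inner_eq_of_summable_sq b hc
  rw [(hasSum_smul_of_inner_eq b hu).tsum_eq, hu]

end Orthogonal

/-! ### Products of a function of `x` and a function of `y` -/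

section Tensor

variable {n : ℕ} {Ω : Set (E n)} {a : ℝ} {F : Type*} [NormedAddCommGroup F]
  [InnerProductSpace ℝ F] {σ τ : ℝ → ℝ}

lemma memLp_smul_cyl (hσ : MemLp σ 2 (halfLine a)) (φ : Lp F 2 ((gauss n).restrict Ω)) :
    MemLp (fun p : E n × ℝ => σ p.2 • φ p.1) 2 (cylMeasure Ω a) :=
  memLp_smul_prod hσ (Lp.memLp φ)

/-- The product `σ(y) φ(x)`, as an element of the weighted `L²` space of the cylinder. -/
def tensorLp (hσ : MemLp σ 2 (halfLine a)) (φ : Lp F 2 ((gauss n).restrict Ω)) :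
    Lp F 2 (cylMeasure Ω a) :=
  (memLp_smul_cyl hσ φ).toLp _

lemma coeFn_tensorLp (hσ : MemLp σ 2 (halfLine a)) (φ : Lp F 2 ((gauss n).restrict Ω)) :
    tensorLp hσ φ =ᵐ[cylMeasure Ω a] fun p : E n × ℝ => σ p.2 • φ p.1 :=
  MemLp.coeFn_toLp _

lemma inner_tensorLp (hσ : MemLp σ 2 (halfLine a)) (hτ : MemLp τ 2 (halfLine a))
    (φ χ : Lp F 2 ((gauss n).restrict Ω)) :
    ⟪tensorLp hσ φ, tensorLp hτ χ⟫ = ⟪φ, χ⟫ * ∫ y, σ y * τ y ∂(halfLine a) := by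
  rw [L2.inner_def, L2.inner_def, ← integral_prod_mul, ← cylMeasure_eq_prod]
  refine integral_congr_ae ?_
  filter_upwards [coeFn_tensorLp hσ φ, coeFn_tensorLp hτ χ] with p h1 h2
  rw [h1, h2, real_inner_smul_left, real_inner_smul_right]
  ring

lemma norm_sq_tensorLp (hσ : MemLp σ 2 (halfLine a)) (φ : Lp F 2 ((gauss n).restrict Ω)) :
    ‖tensorLp hσ φ‖ ^ 2 = ‖φ‖ ^ 2 * ∫ y, σ y ^ 2 ∂(halfLine a) := by
  rw [← real_inner_self_eq_norm_sq, inner_tensorLp, real_inner_self_eq_norm_sq]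
  simp_rw [sq]

/-- Pairing with a function of the cylinder as an inner product in the weighted `L²` space. -/
lemma integral_cyl_mul_eq_inner (hΩ : MeasurableSet Ω) {χ : E n × ℝ → ℝ}
    (hχ : MemLp (divCyl a χ) 2 (cylMeasure Ω a)) (f : Lp ℝ 2 (cylMeasure Ω a)) :
    ∫ p in cyl Ω, f p * χ p = ⟪hχ.toLp _, f⟫ := by
  rw [inner_toLp, ← integral_divCyl_mul (a := a) hΩ]
  simp [mul_comm]

lemma memLp_divCyl_smul {χ : E n × ℝ → ℝ} (hχ : MemLp (divCyl a χ) 2 (cylMeasure Ω a)) (e : F) :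
    MemLp (fun p => divCyl a χ p • e) 2 (cylMeasure Ω a) := by
  refine memLp_two_of_lintegral (hχ.1.smul_const e) ?_
  simp_rw [enorm_smul, mul_pow]
  rw [lintegral_mul_const' _ _ (by simp)]
  exact ENNReal.mul_lt_top (lintegral_enorm_sq_lt_top hχ) (by simp)

/-- The vector valued form of `integral_cyl_mul_eq_inner`. -/
lemma integral_cyl_inner_mul_eq_inner (hΩ : MeasurableSet Ω) {χ : E n × ℝ → ℝ}
    (hχ : MemLp (divCyl a χ) 2 (cylMeasure Ω a)) (e : F) (f : Lp F 2 (cylMeasure Ω a)) :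
    ∫ p in cyl Ω, ⟪f p, e⟫ * χ p = ⟪(memLp_divCyl_smul hχ e).toLp _, f⟫ := by
  rw [inner_toLp, ← integral_divCyl_mul (a := a) hΩ]
  simp_rw [real_inner_smul_left, real_inner_comm e]

lemma integrableOn_cyl_mul (hΩ : MeasurableSet Ω) {χ f : E n × ℝ → ℝ}
    (hχ : MemLp (divCyl a χ) 2 (cylMeasure Ω a)) (hf : MemLp f 2 (cylMeasure Ω a)) :
    IntegrableOn (fun p => f p * χ p) (cyl Ω) := by
  have h1 : Integrable (fun p => divCyl a χ p * f p) (cylMeasure Ω a) := hχ.integrable_mul hf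
  rw [cylMeasure_eq_withDensity hΩ, integrable_withDensity_iff_integrable_smul'
    measurable_cylDensity (Eventually.of_forall fun p =>
      ENNReal.mul_lt_top ENNReal.ofReal_lt_top ENNReal.ofReal_lt_top)] at h1
  refine IntegrableOn.congr_fun h1 (fun p hp => ?_) (hΩ.prod measurableSet_Ioi)
  have h2 := (dens_pos p.1).ne'
  have h3 := (Real.rpow_pos_of_pos hp.2 a).ne'
  simp only [smul_eq_mul, ENNReal.toReal_mul, divCyl]
  rw [ENNReal.toReal_ofReal (dens_pos _).le,
    ENNReal.toReal_ofReal (Real.rpow_nonneg (le_of_lt hp.2) a)]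
  field_simp

lemma IsTestFun.slice_left {η : E n × ℝ → ℝ} (h : IsTestFun (cyl Ω) η) (y : ℝ) :
    IsTestFun Ω (fun x => η (x, y)) := by
  have hemb : IsClosedEmbedding fun x : E n => (x, y) :=
    IsClosedEmbedding.of_continuous_injective_isClosedMap (by fun_prop)
      (fun x x' h => (Prod.ext_iff.1 h).1) (isClosedMap_prodMk_right y)
  refine ⟨h.smooth.comp (contDiff_prodMk_left y), h.compact.comp_isClosedEmbedding hemb,
    fun x hx => ?_⟩
  exact (h.support (tsupport_comp_subset_preimage η (f := fun x : E n => (x, y))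
    (by fun_prop) hx)).1

lemma IsTestFun.slice_right {η : E n × ℝ → ℝ} (h : IsTestFun (cyl Ω) η) (x : E n) :
    IsTestFun (Ioi 0) (fun y => η (x, y)) := by
  have hemb : IsClosedEmbedding fun y : ℝ => (x, y) :=
    IsClosedEmbedding.of_continuous_injective_isClosedMap (by fun_prop)
      (fun x x' h => (Prod.ext_iff.1 h).2) (isClosedMap_prodMk_left x)
  refine ⟨h.smooth.comp (contDiff_prodMk_right x), h.compact.comp_isClosedEmbedding hemb,
    fun y hy => ?_⟩
  exact (h.support (tsupport_comp_subset_preimage η (f := fun y : ℝ => (x, y))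
    (by fun_prop) hy)).2

lemma volume_restrict_cyl :
    (volume : Measure (E n × ℝ)).restrict (cyl Ω) =
      ((volume : Measure (E n)).restrict Ω).prod (volume.restrict (Ioi (0 : ℝ))) := by
  rw [Measure.prod_restrict, cyl, ← Measure.volume_eq_prod]

/-- The weak `x`-gradient of `σ(y) w(x)`, for `w ∈ H¹₀(Ω, γ)`. -/
lemma tensorLp_weak_x (hΩ : IsOpen Ω) (hσ : MemLp σ 2 (halfLine a)) {w : PairL2 Ω} (hw : w ∈ H10 Ω)
    {η : E n × ℝ → ℝ} (hη : IsTestFun (cyl Ω) η) (e : E n) :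
    ∫ p in cyl Ω, tensorLp hσ w.fst p * fderiv ℝ η p (e, 0) =
      -∫ p in cyl Ω, ⟪tensorLp hσ w.snd p, e⟫ * η p := by
  have hm := hΩ.measurableSet
  have hd := (hη.fderiv_apply (e, 0)).memLp_divCyl (a := a) hΩ
  have hd' := hη.memLp_divCyl (a := a) hΩ
  have e1 := (ae_cylMeasure_iff hm).1 (coeFn_tensorLp hσ w.fst)
  have e2 := (ae_cylMeasure_iff hm).1 (coeFn_tensorLp hσ w.snd)
  have i1 := integrableOn_cyl_mul hm hd (memLp_smul_cyl hσ w.fst)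
  have i2 := integrableOn_cyl_mul hm hd'
    ((memLp_smul_cyl hσ w.snd).inner_const (𝕜 := ℝ) e)
  rw [integral_congr_ae (e1.mono fun p hp => congrArg (· * fderiv ℝ η p (e, 0)) hp),
    integral_congr_ae (e2.mono fun p hp => congrArg (fun z => ⟪z, e⟫ * η p) hp)]
  rw [IntegrableOn, volume_restrict_cyl] at i1 i2
  rw [volume_restrict_cyl, integral_prod_symm _ i1, integral_prod_symm _ i2, ← integral_neg]
  congr 1; ext y
  have h1 := H10_integral_fderiv hΩ hw (hη.slice_left y) e
  have h2 : ∀ x, fderiv ℝ (fun x => η (x, y)) x e = fderiv ℝ η (x, y) (e, 0) := fun x => by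
    have : HasFDerivAt (fun x => η (x, y)) _ x :=
      (hη.differentiable (x, y)).hasFDerivAt.comp x (hasFDerivAt_prodMk_left x y)
    rw [this.fderiv]; simp
  simp_rw [h2] at h1
  calc _ = σ y * ∫ x in Ω, w.fst x * fderiv ℝ η (x, y) (e, 0) := by
        rw [← integral_const_mul]
        congr 1; ext x
        simp only [smul_eq_mul]; ring
    _ = _ := by
        rw [h1, mul_neg, ← integral_const_mul]
        congr 2; ext x
        simp only [real_inner_smul_left]; ring

/-- The weak `y`-derivative of `σ(y) φ(x)`. -/
lemma tensorLp_weak_y (hΩ : IsOpen Ω) (hσ : MemLp σ 2 (halfLine a)) (hτ : MemLp τ 2 (halfLine a))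
    (hστ : ∀ ρ, IsTestFun (Ioi 0) ρ →
      ∫ y in Ioi (0 : ℝ), σ y * deriv ρ y = -∫ y in Ioi (0 : ℝ), τ y * ρ y)
    (φ : L2 Ω) {η : E n × ℝ → ℝ} (hη : IsTestFun (cyl Ω) η) :
    ∫ p in cyl Ω, tensorLp hσ φ p * fderiv ℝ η p (0, 1) =
      -∫ p in cyl Ω, tensorLp hτ φ p * η p := by
  have hm := hΩ.measurableSet
  have hd := (hη.fderiv_apply (0, 1)).memLp_divCyl (a := a) hΩ
  have hd' := hη.memLp_divCyl (a := a) hΩ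
  have e1 := (ae_cylMeasure_iff hm).1 (coeFn_tensorLp hσ φ)
  have e2 := (ae_cylMeasure_iff hm).1 (coeFn_tensorLp hτ φ)
  have i1 := integrableOn_cyl_mul hm hd (memLp_smul_cyl hσ φ)
  have i2 := integrableOn_cyl_mul hm hd' (memLp_smul_cyl hτ φ)
  rw [integral_congr_ae (e1.mono fun p hp => congrArg (· * fderiv ℝ η p (0, 1)) hp),
    integral_congr_ae (e2.mono fun p hp => congrArg (· * η p) hp)]
  rw [IntegrableOn, volume_restrict_cyl] at i1 i2
  rw [volume_restrict_cyl, integral_prod _ i1, integral_prod _ i2, ← integral_neg]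
  congr 1; ext x
  have h1 := hστ _ (hη.slice_right x)
  have h2 : ∀ y, deriv (fun y => η (x, y)) y = fderiv ℝ η (x, y) (0, 1) := fun y => by
    have : HasFDerivAt (fun y => η (x, y)) _ y :=
      (hη.differentiable (x, y)).hasFDerivAt.comp y (hasFDerivAt_prodMk_right x y)
    rw [this.hasDerivAt.deriv]; simp
  simp_rw [h2] at h1
  calc _ = φ x * ∫ y in Ioi (0 : ℝ), σ y * fderiv ℝ η (x, y) (0, 1) := by
        rw [← integral_const_mul]
        congr 1; ext y
        simp only [smul_eq_mul]; ring
    _ = _ := by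
        rw [h1, mul_neg, ← integral_const_mul]
        congr 2; ext y
        simp only [smul_eq_mul]; ring

/-- The weight is bounded below on compact subsets of the cylinder. -/
lemma memLp_restrict_compact {F : Type*} [NormedAddCommGroup F] (hΩ : IsOpen Ω)
    {f : E n × ℝ → F} (hf : MemLp f 2 (cylMeasure Ω a)) {K : Set (E n × ℝ)} (hK : IsCompact K)
    (hs : K ⊆ cyl Ω) : MemLp f 2 (volume.restrict K) := by
  have hcont : ContinuousOn (fun p : E n × ℝ => (dens p.1 * p.2 ^ a)⁻¹) K := fun p hp => by
    have h2 := (Real.rpow_pos_of_pos (hs hp).2 a).ne'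
    exact (ContinuousAt.inv₀ (continuous_dens.continuousAt.comp continuousAt_fst |>.mul
      ((Real.continuousAt_rpow_const _ _ (Or.inl (ne_of_gt (hs hp).2))).comp continuousAt_snd))
      (mul_ne_zero (dens_pos p.1).ne' h2)).continuousWithinAt
  obtain ⟨C, hC⟩ := hK.exists_bound_of_continuousOn hcont
  refine hf.of_measure_le_smul (c := ENNReal.ofReal C) ENNReal.ofReal_ne_top ?_
  refine Measure.le_iff.2 fun S hS => ?_
  rw [Measure.restrict_apply hS, Measure.smul_apply, cylMeasure_eq_withDensity hΩ.measurableSet,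
    withDensity_apply _ hS, Measure.restrict_restrict hS, smul_eq_mul,
    ← lintegral_const_mul' _ _ ENNReal.ofReal_ne_top, ← setLIntegral_one]
  refine (lintegral_mono_ae ?_).trans (lintegral_mono_set (inter_subset_inter_right S hs))
  filter_upwards [ae_restrict_mem (hS.inter hK.measurableSet)] with p hp
  have h1 := dens_pos p.1
  have h2 := Real.rpow_pos_of_pos (hs hp.2).2 a
  have h3 := hC p hp.2
  rw [Real.norm_of_nonneg (by positivity)] at h3
  rw [← ENNReal.ofReal_mul h1.le, ← ENNReal.ofReal_mul (le_trans (by positivity) h3)]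
  refine ENNReal.one_le_ofReal.2 ?_
  calc 1 = (dens p.1 * p.2 ^ a)⁻¹ * (dens p.1 * p.2 ^ a) := by field_simp
    _ ≤ _ := by gcongr

end Tensor

section

/-! ### The extension -/

variable {n : ℕ} {Ω : Set (E n)} {s : ℝ} {lam : ℕ → ℝ} {ψ : HilbertBasis ℕ ℝ (L2 Ω)} {u : L2 Ω}
  {W : ℕ → PairL2 Ω}

lemma integral_extProfile_mul_deriv {l : ℝ} (hs0 : 0 < s) (hs1 : s < 1) (hl : 0 < l) {ρ : ℝ → ℝ}
    (hρ : IsTestFun (Ioi 0) ρ) :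
    ∫ y in Ioi (0 : ℝ), extProfile s l y * deriv ρ y =
      -∫ y in Ioi (0 : ℝ), extDeriv s l y * ρ y := by
  have i1 := integrableOn_mul_testFun (memLp_extProfile hs0 hs1 hl) hρ.deriv
  have i2 := integrableOn_mul_testFun (memLp_extDeriv hs0 hs1 hl) hρ
  have hcont : Continuous fun y => extProfile s l y * ρ y :=
    (continuous_extProfile hs0).mul hρ.continuous
  have hlim : Tendsto (fun y => extProfile s l y * ρ y) atTop (𝓝 0) :=
    (HasCompactSupport.is_zero_at_infty (hρ.compact.mul_left)).mono_left atTop_le_cocompact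
  have h := integral_Ioi_of_hasDerivAt_of_tendsto hcont.continuousWithinAt
    (fun y hy => (hasDerivAt_extProfile hs0 hl hy).mul (hρ.differentiable y).hasDerivAt)
    (i2.add i1) hlim
  rw [hρ.eq_zero (by simp), mul_zero, sub_zero] at h
  have h' := integral_add i2 i1
  rw [h] at h'
  linarith

lemma summable_inner_sq (u : L2 Ω) (ψ : HilbertBasis ℕ ℝ (L2 Ω)) :
    Summable fun k => ⟪u, ψ k⟫ ^ 2 := by
  have := (hasSum_inner_sq ψ u).summable
  simpa only [real_inner_comm] using this

lemma norm_sq_fracHalfPow (hψ : IsDirichletEigenSystem Ω lam ψ) (hu : u ∈ fracSpace lam ψ s) :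
    ‖fracHalfPow lam ψ s u‖ ^ 2 = ∑' k, lam k ^ s * ⟪u, ψ k⟫ ^ 2 := by
  have e : ∀ k, (lam k ^ (s / 2) * ⟪u, ψ k⟫) ^ 2 = lam k ^ s * ⟪u, ψ k⟫ ^ 2 := fun k => by
    rw [mul_pow, ← Real.rpow_natCast, ← Real.rpow_mul (hψ.pos k).le]
    congr 2; push_cast; ring
  have hs : Summable fun k => (lam k ^ (s / 2) * ⟪u, ψ k⟫) ^ 2 := by
    simp_rw [e]; exact hu
  have := (hasSum_inner_sq ψ (fracHalfPow lam ψ s u)).tsum_eq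
  rw [← this]
  congr 1; ext k
  rw [fracHalfPow, inner_tsum_smul ψ hs, e]

lemma inner_besselExt (hs0 : 0 < s) (hψ : IsDirichletEigenSystem Ω lam ψ) (u : L2 Ω) {y : ℝ}
    (hy : 0 < y) (j : ℕ) :
    ⟪ψ j, besselExt lam ψ s u y⟫ = ⟪u, ψ j⟫ * extProfile s (lam j) y := by
  have hG := Real.Gamma_pos_of_pos hs0
  have hC : (2 : ℝ) ^ (1 - s) / Real.Gamma s ≠ 0 := by positivity
  have e : ∀ k, (√(lam k) * y) ^ s * besselK s (√(lam k) * y) * ⟪u, ψ k⟫ =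
      (2 ^ (1 - s) / Real.Gamma s)⁻¹ * (⟪u, ψ k⟫ * extProfile s (lam k) y) := fun k => by
    rw [← coeff_besselExt hs0 (hψ.pos k) hy]
    field_simp
  have hs : Summable fun k =>
      ((√(lam k) * y) ^ s * besselK s (√(lam k) * y) * ⟪u, ψ k⟫) ^ 2 := by
    simp_rw [e, mul_pow]
    refine Summable.mul_left _ (Summable.of_nonneg_of_le (fun k => by positivity) (fun k => ?_)
      (summable_inner_sq u ψ))
    refine mul_le_of_le_one_right (sq_nonneg _) (pow_le_one₀ (extProfile_nonneg hs0 _) ?_)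
    exact extProfile_le_one hs0 _
  rw [besselExt, real_inner_smul_right, inner_tsum_smul ψ hs, e, mul_inv_cancel_left₀ hC]

/-- The three series of the extension and of its derivatives converge, being orthogonal series; the
energy of each term is that of the one-dimensional profile. -/
lemma exists_extension_series (hs0 : 0 < s) (hs1 : s < 1) (hψ : IsDirichletEigenSystem Ω lam ψ)
    (hW : ∀ k, W k ∈ H10 Ω ∧ (W k).fst = ψ k ∧
      ∀ w ∈ H10 Ω, ⟪(W k).snd, w.snd⟫ = lam k * ⟪ψ k, w.fst⟫)
    (hu : u ∈ fracSpace lam ψ s) :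
    ∃ (V : Lp ℝ 2 (cylMeasure Ω (1 - 2 * s))) (G : Lp (E n) 2 (cylMeasure Ω (1 - 2 * s)))
      (g : Lp ℝ 2 (cylMeasure Ω (1 - 2 * s))),
      HasSum (fun k => ⟪u, ψ k⟫ • tensorLp (memLp_extProfile hs0 hs1 (hψ.pos k)) (W k).fst) V ∧
      HasSum (fun k => ⟪u, ψ k⟫ • tensorLp (memLp_extProfile hs0 hs1 (hψ.pos k)) (W k).snd) G ∧
      HasSum (fun k => ⟪u, ψ k⟫ • tensorLp (memLp_extDeriv hs0 hs1 (hψ.pos k)) (W k).fst) g ∧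
      ‖G‖ ^ 2 + ‖g‖ ^ 2 = traceConst s * ∑' k, lam k ^ s * ⟪u, ψ k⟫ ^ 2 := by
  have hc := traceConst_pos hs0 hs1
  set c : ℕ → ℝ := fun k => ⟪u, ψ k⟫ with hcdef
  set A : ℕ → ℝ := fun k => ∫ y, extProfile s (lam k) y ^ 2 ∂(halfLine (1 - 2 * s)) with hA
  set B : ℕ → ℝ := fun k => ∫ y, extDeriv s (lam k) y ^ 2 ∂(halfLine (1 - 2 * s)) with hB
  have hA0 : ∀ k, 0 ≤ A k := fun k => integral_nonneg fun _ => sq_nonneg _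
  have hB0 : ∀ k, 0 ≤ B k := fun k => integral_nonneg fun _ => sq_nonneg _
  have hAB : ∀ k, lam k * A k + B k = traceConst s * lam k ^ s := fun k =>
    energy_extProfile hs0 hs1 (hψ.pos k)
  have hf : ∀ j k, ⟪(W j).fst, (W k).fst⟫ = if j = k then (1 : ℝ) else 0 := fun j k => by
    rw [(hW j).2.1, (hW k).2.1, orthonormal_iff_ite.1 ψ.orthonormal]
  have hf1 : ∀ k, ‖(W k).fst‖ ^ 2 = 1 := fun k => by
    rw [← real_inner_self_eq_norm_sq, hf, if_pos rfl]
  have hs1' : ∀ k, ‖(W k).snd‖ ^ 2 = lam k := fun k => by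
    rw [← real_inner_self_eq_norm_sq, inner_snd_of_eigen hW, if_pos rfl]
  have hsum : Summable fun k => traceConst s * (lam k ^ s * c k ^ 2) := Summable.mul_left _ hu
  have hle1 : ∀ k, c k ^ 2 * (lam k * A k) ≤ traceConst s * (lam k ^ s * c k ^ 2) := fun k => by
    nlinarith [hAB k, hB0 k, mul_nonneg (sq_nonneg (c k)) (hB0 k)]
  have hle2 : ∀ k, c k ^ 2 * B k ≤ traceConst s * (lam k ^ s * c k ^ 2) := fun k => by
    nlinarith [hAB k, mul_nonneg (sq_nonneg (c k)) (mul_nonneg (hψ.pos k).le (hA0 k))]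
  have nV : ∀ k, ‖c k • tensorLp (memLp_extProfile hs0 hs1 (hψ.pos k)) (W k).fst‖ ^ 2 =
      c k ^ 2 * A k := fun k => by
    rw [norm_smul, mul_pow, norm_sq_tensorLp, hf1, Real.norm_eq_abs, sq_abs, one_mul]
  have nG : ∀ k, ‖c k • tensorLp (memLp_extProfile hs0 hs1 (hψ.pos k)) (W k).snd‖ ^ 2 =
      c k ^ 2 * (lam k * A k) := fun k => by
    rw [norm_smul, mul_pow, norm_sq_tensorLp, hs1', Real.norm_eq_abs, sq_abs]
  have ng : ∀ k, ‖c k • tensorLp (memLp_extDeriv hs0 hs1 (hψ.pos k)) (W k).fst‖ ^ 2 =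
      c k ^ 2 * B k := fun k => by
    rw [norm_smul, mul_pow, norm_sq_tensorLp, hf1, Real.norm_eq_abs, sq_abs, one_mul]
  have sG : Summable fun k => c k ^ 2 * (lam k * A k) :=
    Summable.of_nonneg_of_le (fun k => mul_nonneg (sq_nonneg _)
      (mul_nonneg (hψ.pos k).le (hA0 k))) hle1 hsum
  have sg : Summable fun k => c k ^ 2 * B k :=
    Summable.of_nonneg_of_le (fun k => mul_nonneg (sq_nonneg _) (hB0 k)) hle2 hsum
  -- As `lam k ≥ lam 0 > 0`, the `L²` norms are controlled by the norms of the gradients.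
  have sV : Summable fun k => c k ^ 2 * A k := by
    refine Summable.of_nonneg_of_le (fun k => mul_nonneg (sq_nonneg _) (hA0 k)) (fun k => ?_)
      (sG.mul_left (lam 0)⁻¹)
    have h0 := hψ.pos 0
    have h1 := mul_le_mul_of_nonneg_right (hψ.mono (Nat.zero_le k))
      (mul_nonneg (sq_nonneg (c k)) (hA0 k))
    rw [inv_mul_eq_div, le_div_iff₀ h0]
    linarith
  have oV : ∀ i j, i ≠ j → ⟪c i • tensorLp (memLp_extProfile hs0 hs1 (hψ.pos i)) (W i).fst,
      c j • tensorLp (memLp_extProfile hs0 hs1 (hψ.pos j)) (W j).fst⟫ = 0 := fun i j hij => by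
    rw [real_inner_smul_left, real_inner_smul_right, inner_tensorLp, hf, if_neg hij]; simp
  have oG : ∀ i j, i ≠ j → ⟪c i • tensorLp (memLp_extProfile hs0 hs1 (hψ.pos i)) (W i).snd,
      c j • tensorLp (memLp_extProfile hs0 hs1 (hψ.pos j)) (W j).snd⟫ = 0 := fun i j hij => by
    rw [real_inner_smul_left, real_inner_smul_right, inner_tensorLp, inner_snd_of_eigen hW,
      if_neg hij]; simp
  have og : ∀ i j, i ≠ j → ⟪c i • tensorLp (memLp_extDeriv hs0 hs1 (hψ.pos i)) (W i).fst,
      c j • tensorLp (memLp_extDeriv hs0 hs1 (hψ.pos j)) (W j).fst⟫ = 0 := fun i j hij => by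
    rw [real_inner_smul_left, real_inner_smul_right, inner_tensorLp, hf, if_neg hij]; simp
  obtain ⟨V, hV⟩ := summable_of_orthogonal oV (by simpa only [nV] using sV)
  obtain ⟨G, hG⟩ := summable_of_orthogonal oG (by simpa only [nG] using sG)
  obtain ⟨g, hg⟩ := summable_of_orthogonal og (by simpa only [ng] using sg)
  refine ⟨V, G, g, hV, hG, hg, ?_⟩
  have h1 := hasSum_norm_sq_of_orthogonal oG hG
  have h2 := hasSum_norm_sq_of_orthogonal og hg
  simp_rw [nG] at h1
  simp_rw [ng] at h2
  rw [← tsum_mul_left, ← (h1.add h2).tsum_eq]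
  congr 1; ext k
  rw [← mul_add, hAB]; ring

/-- Weak derivatives pass to the limit in series converging in the weighted `L²` spaces. -/
lemma hasWeakGradient_of_hasSum (hΩ : IsOpen Ω) {a : ℝ} {V g : Lp ℝ 2 (cylMeasure Ω a)}
    {G : Lp (E n) 2 (cylMeasure Ω a)} {c : ℕ → ℝ} {θ θ' : ℕ → ℝ → ℝ}
    (hθ : ∀ k, MemLp (θ k) 2 (halfLine a)) (hθ' : ∀ k, MemLp (θ' k) 2 (halfLine a))
    (hd : ∀ k ρ, IsTestFun (Ioi 0) ρ →
      ∫ y in Ioi (0 : ℝ), θ k y * deriv ρ y = -∫ y in Ioi (0 : ℝ), θ' k y * ρ y)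
    (hW : ∀ k, W k ∈ H10 Ω)
    (hV : HasSum (fun k => c k • tensorLp (hθ k) (W k).fst) V)
    (hG : HasSum (fun k => c k • tensorLp (hθ k) (W k).snd) G)
    (hg : HasSum (fun k => c k • tensorLp (hθ' k) (W k).fst) g) :
    HasWeakGradient Ω V G g := by
  have hm := hΩ.measurableSet
  refine ⟨fun K hs hK => ⟨memLp_restrict_compact hΩ (Lp.memLp V) hK hs,
    memLp_restrict_compact hΩ (Lp.memLp G) hK hs, memLp_restrict_compact hΩ (Lp.memLp g) hK hs⟩,
    fun η hη e => ?_, fun η hη => ?_⟩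
  · have hη1 := (hη.fderiv_apply (e, 0)).memLp_divCyl (a := a) hΩ
    have hη2 := hη.memLp_divCyl (a := a) hΩ
    rw [integral_cyl_mul_eq_inner hm hη1, integral_cyl_inner_mul_eq_inner hm hη2]
    have h1 := hV.mapL (innerSL ℝ (hη1.toLp _))
    have h2 := (hG.mapL (innerSL ℝ ((memLp_divCyl_smul hη2 e).toLp _))).neg
    refine h1.unique (h2.congr_fun fun k => ?_)
    simp only [innerSL_apply_apply, real_inner_smul_right]
    rw [← integral_cyl_mul_eq_inner hm hη1, ← integral_cyl_inner_mul_eq_inner hm hη2,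
      tensorLp_weak_x hΩ (hθ k) (hW k) hη, mul_neg]
  · have hη1 := (hη.fderiv_apply (0, 1)).memLp_divCyl (a := a) hΩ
    have hη2 := hη.memLp_divCyl (a := a) hΩ
    rw [integral_cyl_mul_eq_inner hm hη1, integral_cyl_mul_eq_inner hm hη2]
    have h1 := hV.mapL (innerSL ℝ (hη1.toLp _))
    have h2 := (hg.mapL (innerSL ℝ (hη2.toLp _))).neg
    refine h1.unique (h2.congr_fun fun k => ?_)
    simp only [innerSL_apply_apply, real_inner_smul_right]
    rw [← integral_cyl_mul_eq_inner hm hη1, ← integral_cyl_mul_eq_inner hm hη2,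
      tensorLp_weak_y hΩ (hθ k) (hθ' k) (hd k) _ hη, mul_neg]

/-- The coefficients of the slices of a series of products. -/
lemma ae_sliceCoeff_of_hasSum {a : ℝ} {V : Lp ℝ 2 (cylMeasure Ω a)} {c : ℕ → ℝ} {θ : ℕ → ℝ → ℝ}
    (hθ : ∀ k, MemLp (θ k) 2 (halfLine a))
    (hV : HasSum (fun k => c k • tensorLp (hθ k) (ψ k)) V) (j : ℕ) :
    ∀ᵐ y ∂(halfLine a), sliceCoeff Ω (ψ j) V y = c j * θ j y := by
  have hS := memLp_sliceCoeff (Lp.memLp V) (Lp.memLp (ψ j))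
  have hD : MemLp (fun y => sliceCoeff Ω (ψ j) V y - c j * θ j y) 2 (halfLine a) :=
    hS.sub ((hθ j).const_mul (c j))
  have key : ∀ {σ : ℝ → ℝ} (hσ : MemLp σ 2 (halfLine a)),
      ∫ y, σ y * sliceCoeff Ω (ψ j) V y ∂(halfLine a) =
        ∫ y, σ y * (c j * θ j y) ∂(halfLine a) := by
    intro σ hσ
    have h1 := hV.mapL (innerSL ℝ (tensorLp hσ (ψ j)))
    have h2 := hasSum_single (f := fun k => innerSL ℝ (tensorLp hσ (ψ j))
      (c k • tensorLp (hθ k) (ψ k))) j fun k hk => by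
        rw [innerSL_apply_apply, real_inner_smul_right, inner_tensorLp,
          orthonormal_iff_ite.1 ψ.orthonormal, if_neg hk.symm]
        simp
    have h3 := h1.unique h2
    simp only [innerSL_apply_apply] at h3
    rw [real_inner_smul_right, inner_tensorLp, orthonormal_iff_ite.1 ψ.orthonormal, if_pos rfl,
      one_mul, tensorLp, inner_toLp, ← integral_const_mul] at h3
    unfold sliceCoeff
    rw [integral_mul_coeff (Lp.memLp (ψ j)) hσ (Lp.memLp V), ← cylMeasure_eq_prod]
    refine Eq.trans ?_ (h3.trans ?_)
    · congr 1; ext p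
      simp [mul_comm]
    · congr 1; ext y
      ring
  -- The identity `key` for `σ` the difference of the two sides.
  have h4 : ∫ y, (sliceCoeff Ω (ψ j) V y - c j * θ j y) ^ 2 ∂(halfLine a) = 0 := by
    have h5 := key hD
    have i1 : Integrable (fun y => (sliceCoeff Ω (ψ j) V y - c j * θ j y) *
        sliceCoeff Ω (ψ j) V y) (halfLine a) := hD.integrable_mul hS
    have i2 : Integrable (fun y => (sliceCoeff Ω (ψ j) V y - c j * θ j y) * (c j * θ j y))
        (halfLine a) := hD.integrable_mul ((hθ j).const_mul (c j))
    rw [← sub_eq_zero, ← integral_sub i1 i2] at h5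
    rw [← h5]
    congr 1; ext y
    ring
  rw [integral_eq_zero_iff_of_nonneg (fun _ => sq_nonneg _) hD.integrable_sq] at h4
  filter_upwards [h4] with y hy
  simpa [sub_eq_zero] using hy

end

section

variable {n : ℕ} {Ω : Set (E n)} {s : ℝ} {lam : ℕ → ℝ} {ψ : HilbertBasis ℕ ℝ (L2 Ω)} {u : L2 Ω}
  {W : ℕ → PairL2 Ω} {v g g' : E n × ℝ → ℝ} {G G' : E n × ℝ → E n}

lemma enorm_sq_eq_ofReal (t : ℝ) : ‖t‖ₑ ^ 2 = ENNReal.ofReal (t ^ 2) := by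
  rw [← ofReal_norm, ← ENNReal.ofReal_pow (norm_nonneg _), Real.norm_eq_abs, sq_abs]

/-- For almost every `y` the series of the extension converges in `H¹₀(Ω, γ)`, because
`∑ u_k² ‖θ_k‖² (1 + lam_k)` is finite. -/
lemma ae_summable_profile (hs0 : 0 < s) (hs1 : s < 1) (hψ : IsDirichletEigenSystem Ω lam ψ)
    (hu : u ∈ fracSpace lam ψ s) :
    ∀ᵐ y ∂(halfLine (1 - 2 * s)),
      Summable fun k => (1 + lam k) * (⟪u, ψ k⟫ * extProfile s (lam k) y) ^ 2 := by
  set c : ℕ → ℝ := fun k => ⟪u, ψ k⟫ with hcdef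
  set A : ℕ → ℝ := fun k => ∫ y, extProfile s (lam k) y ^ 2 ∂(halfLine (1 - 2 * s)) with hA
  have hθ := fun k => memLp_extProfile hs0 hs1 (hψ.pos k)
  have hA0 : ∀ k, 0 ≤ A k := fun k => integral_nonneg fun _ => sq_nonneg _
  have hB0 : ∀ k, 0 ≤ ∫ y, extDeriv s (lam k) y ^ 2 ∂(halfLine (1 - 2 * s)) := fun k =>
    integral_nonneg fun _ => sq_nonneg _
  have hle : ∀ k, lam k * A k ≤ traceConst s * lam k ^ s := fun k => by
    have := energy_extProfile hs0 hs1 (hψ.pos k)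
    have := hB0 k
    linarith
  have h0 := hψ.pos 0
  have hfac : ∀ k, (1 + lam k) * A k ≤ ((lam 0)⁻¹ + 1) * (traceConst s * lam k ^ s) := fun k => by
    have h1 : A k ≤ (lam 0)⁻¹ * (lam k * A k) := by
      rw [inv_mul_eq_div, le_div_iff₀ h0, mul_comm]
      exact mul_le_mul_of_nonneg_right (hψ.mono (Nat.zero_le k)) (hA0 k)
    have h2 := mul_le_mul_of_nonneg_left (hle k) (inv_pos.2 h0).le
    linarith [hle k]
  have hsum : Summable fun k => (1 + lam k) * (c k ^ 2 * A k) := by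
    refine Summable.of_nonneg_of_le (fun k => ?_) (fun k => ?_)
      ((show Summable fun k => lam k ^ s * c k ^ 2 from hu).mul_left
        (((lam 0)⁻¹ + 1) * traceConst s))
    · exact mul_nonneg (by linarith [hψ.pos k]) (mul_nonneg (sq_nonneg _) (hA0 k))
    · nlinarith [mul_le_mul_of_nonneg_left (hfac k) (sq_nonneg (c k))]
  have hnn : ∀ k y, 0 ≤ (1 + lam k) * (c k * extProfile s (lam k) y) ^ 2 := fun k y =>
    mul_nonneg (by linarith [hψ.pos k]) (sq_nonneg _)
  have hm : ∀ k, AEMeasurable (fun y => ENNReal.ofReal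
      ((1 + lam k) * (c k * extProfile s (lam k) y) ^ 2)) (halfLine (1 - 2 * s)) := fun k =>
    (((((hθ k).1.aemeasurable).const_mul (c k)).pow_const 2).const_mul _).ennreal_ofReal
  have hint : ∫⁻ y, ∑' k, ENNReal.ofReal ((1 + lam k) * (c k * extProfile s (lam k) y) ^ 2)
      ∂(halfLine (1 - 2 * s)) ≠ ⊤ := by
    rw [lintegral_tsum hm]
    have e : ∀ k, ∫⁻ y, ENNReal.ofReal ((1 + lam k) * (c k * extProfile s (lam k) y) ^ 2)
        ∂(halfLine (1 - 2 * s)) = ENNReal.ofReal ((1 + lam k) * (c k ^ 2 * A k)) := fun k => by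
      rw [← ofReal_integral_eq_lintegral_ofReal
        ((((hθ k).const_mul (c k)).integrable_sq).const_mul _)
        (Eventually.of_forall fun y => hnn k y), integral_const_mul, hA]
      simp_rw [mul_pow]
      rw [integral_const_mul]
    simp_rw [e]
    exact hsum.tsum_ofReal_ne_top
  filter_upwards [ae_lt_top' (AEMeasurable.tsum hm) hint] with y hy
  have := ENNReal.summable_toReal hy.ne
  simpa only [ENNReal.toReal_ofReal (hnn _ _)] using this

/-- The eigenfunctions are orthogonal in `H¹₀(Ω, γ)`, with `‖ψ_k‖² = 1 + lam_k`, so a series of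
eigenfunctions with `∑ (1 + lam_k) c_k² < ∞` converges there. -/
lemma exists_mem_H10_of_summable
    (hW : ∀ k, W k ∈ H10 Ω ∧ (W k).fst = ψ k ∧
      ∀ w ∈ H10 Ω, ⟪(W k).snd, w.snd⟫ = lam k * ⟪ψ k, w.fst⟫)
    {c : ℕ → ℝ} (hc : Summable fun k => (1 + lam k) * c k ^ 2) :
    ∃ w ∈ H10 Ω, ∀ k, ⟪ψ k, w.fst⟫ = c k := by
  have hip : ∀ j k, ⟪W j, W k⟫ = if j = k then 1 + lam j else 0 := fun j k => by
    rw [WithLp.prod_inner_apply]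
    change ⟪(W j).fst, (W k).fst⟫ + ⟪(W j).snd, (W k).snd⟫ = _
    rw [inner_snd_of_eigen hW, (hW j).2.1, (hW k).2.1, orthonormal_iff_ite.1 ψ.orthonormal]
    split_ifs <;> simp
  have ho : ∀ i j, i ≠ j → ⟪c i • W i, c j • W j⟫ = 0 := fun i j hij => by
    rw [real_inner_smul_left, real_inner_smul_right, hip, if_neg hij]; simp
  have hn : ∀ k, ‖c k • W k‖ ^ 2 = (1 + lam k) * c k ^ 2 := fun k => by
    rw [norm_smul, mul_pow, ← real_inner_self_eq_norm_sq (W k), hip, if_pos rfl,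
      Real.norm_eq_abs, sq_abs, mul_comm]
  obtain ⟨w, hw⟩ := summable_of_orthogonal ho (by simpa only [hn] using hc)
  refine ⟨w, ?_, fun j => ?_⟩
  · exact (testPairs Ω).isClosed_topologicalClosure.mem_of_tendsto hw
      (Eventually.of_forall fun F => Submodule.sum_mem _ fun k _ =>
        Submodule.smul_mem _ _ (hW k).1)
  · have h1 := hw.mapL ((innerSL ℝ (ψ j)).comp (WithLp.fstL 2 ℝ (L2 Ω) _))
    have h2 := hasSum_single (f := fun k => ((innerSL ℝ (ψ j)).comp (WithLp.fstL 2 ℝ (L2 Ω)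
      (Lp (E n) 2 ((gauss n).restrict Ω)))) (c k • W k)) j fun k hk => by
        change ⟪ψ j, (c k • W k).fst⟫ = 0
        rw [WithLp.smul_fst, (hW k).2.1, real_inner_smul_right,
          orthonormal_iff_ite.1 ψ.orthonormal, if_neg hk.symm, mul_zero]
    have h3 := h1.unique h2
    change ⟪ψ j, w.fst⟫ = ⟪ψ j, (c j • W j).fst⟫ at h3
    rw [h3, WithLp.smul_fst, (hW j).2.1, real_inner_smul_right,
      orthonormal_iff_ite.1 ψ.orthonormal, if_pos rfl, mul_one]

/-- The extension converges to `u` as `y → 0`, by dominated convergence of the series. -/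
lemma tendsto_tsum_profile (hs0 : 0 < s) (u : L2 Ω) (ψ : HilbertBasis ℕ ℝ (L2 Ω)) (lam : ℕ → ℝ) :
    Tendsto (fun y => ∑' k, (⟪u, ψ k⟫ * extProfile s (lam k) y - ⟪u, ψ k⟫) ^ 2) (𝓝 0) (𝓝 0) := by
  have := tendsto_tsum_of_dominated_convergence (𝓕 := 𝓝 (0 : ℝ))
    (f := fun y k => (⟪u, ψ k⟫ * extProfile s (lam k) y - ⟪u, ψ k⟫) ^ 2) (g := fun _ => 0)
    (summable_inner_sq u ψ) (fun k => ?_) (Eventually.of_forall fun y k => ?_)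
  · simpa using this
  · have h1 : Continuous fun y => (⟪u, ψ k⟫ * extProfile s (lam k) y - ⟪u, ψ k⟫) ^ 2 := by
      have := continuous_extProfile (lam := lam k) hs0
      fun_prop
    have h2 := h1.tendsto 0
    simpa [extProfile_zero hs0] using h2
  · rw [Real.norm_of_nonneg (sq_nonneg _)]
    have h1 := extProfile_nonneg (lam := lam k) hs0 y
    have h2 := extProfile_le_one (lam := lam k) hs0 y
    have e : (⟪u, ψ k⟫ * extProfile s (lam k) y - ⟪u, ψ k⟫) ^ 2 =
        ⟪u, ψ k⟫ ^ 2 * (1 - extProfile s (lam k) y) ^ 2 := by ring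
    rw [e]
    exact mul_le_of_le_one_right (sq_nonneg _) (pow_le_one₀ (by linarith) (by linarith))

/-- The Bessel extension of `u ∈ 𝓗^s(Ω, γ)` has finite energy, trace `u`, and energy
`c_s ‖𝓛^{s/2} u‖²`. -/
theorem exists_extension (hs0 : 0 < s) (hs1 : s < 1) (hΩ : IsOpen Ω)
    (hψ : IsDirichletEigenSystem Ω lam ψ) (hu : u ∈ fracSpace lam ψ s) :
    ∃ v G g, HasEnergyGradient Ω (1 - 2 * s) v G g ∧ IsTrace v u ∧ IsBesselExt lam ψ s v u ∧
      energy Ω (1 - 2 * s) G g = traceConst s * ∑' k, lam k ^ s * ⟪u, ψ k⟫ ^ 2 := by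
  obtain ⟨W, hW⟩ := hψ.exists_pair
  obtain ⟨V, G, g, hV, hG, hg, hE⟩ := exists_extension_series hs0 hs1 hψ hW hu
  have hweak := hasWeakGradient_of_hasSum hΩ _ _
    (fun k ρ hρ => integral_extProfile_mul_deriv hs0 hs1 (hψ.pos k) hρ)
    (fun k => (hW k).1) hV hG hg
  have hV' := hV
  simp_rw [fun k => (hW k).2.1] at hV'
  have hco := ae_all_iff.2 fun j => ae_sliceCoeff_of_hasSum _ hV' j
  have hsl := memLp_slice_right (Lp.memLp V)
  refine ⟨V, G, g, ⟨hweak, Lp.memLp V, Lp.memLp G, Lp.memLp g, ?_⟩, ?_, ?_, ?_⟩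
  · -- The slices lie in `H¹₀(Ω, γ)`.
    rw [← ae_halfLine_iff (1 - 2 * s)]
    filter_upwards [hco, hsl, ae_summable_profile hs0 hs1 hψ hu] with y hc hy hsum
    obtain ⟨w, hw, hwc⟩ := exists_mem_H10_of_summable hW hsum
    refine ⟨w.snd, hasH10Gradient_iff.2 ⟨w, hw, ?_, ae_eq_rfl⟩⟩
    have : w.fst = hy.toLp _ := hilbertBasis_ext ψ fun k => by
      rw [hwc, inner_toLp_slice, hc]
    rw [this]
    exact hy.coeFn_toLp
  · have hlim : Tendsto (fun y => ENNReal.ofReal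
        (∑' k, (⟪u, ψ k⟫ * extProfile s (lam k) y - ⟪u, ψ k⟫) ^ 2))
        (ae volume ⊓ 𝓝[>] (0 : ℝ)) (𝓝 0) := by
      have := (ENNReal.tendsto_ofReal (tendsto_tsum_profile hs0 u ψ lam)).mono_left
        (inf_le_right.trans nhdsWithin_le_nhds : ae volume ⊓ 𝓝[>] (0 : ℝ) ≤ 𝓝 0)
      rwa [ENNReal.ofReal_zero] at this
    refine tendsto_zero_of_sq (hlim.congr' ?_)
    refine eventually_trace_filter ((ae_halfLine_iff (1 - 2 * s)).1 ?_)
    filter_upwards [hco, hsl] with y hc hy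
    have h1 := hasSum_inner_sq ψ (hy.toLp _ - u)
    have e : ∀ k, ⟪ψ k, hy.toLp _ - u⟫ = ⟪u, ψ k⟫ * extProfile s (lam k) y - ⟪u, ψ k⟫ := fun k => by
      rw [inner_sub_right, inner_toLp_slice, hc, real_inner_comm u]
    simp_rw [e] at h1
    rw [eLpNorm_slice_sub_sq hy ψ, ENNReal.ofReal_tsum_of_nonneg (fun _ => sq_nonneg _) h1.summable]
    congr 1; ext k
    rw [enorm_sq_eq_ofReal, hc, real_inner_comm u]
  · rw [IsBesselExt, ← ae_halfLine_iff (1 - 2 * s)]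
    filter_upwards [hco, hsl, (ae_halfLine_iff _).2 (ae_restrict_mem measurableSet_Ioi)]
      with y hc hy hy0
    have : besselExt lam ψ s u y = hy.toLp _ := hilbertBasis_ext ψ fun k => by
      rw [inner_besselExt hs0 hψ u hy0, inner_toLp_slice, hc]
    rw [this]
    exact hy.coeFn_toLp.symm
  · rw [← hE, energy, integral_add ((Lp.memLp G).integrable_norm_pow (p := 2) (by norm_num))
      (Lp.memLp g).integrable_sq, norm_sq_Lp, norm_sq_Lp]
    simp

/-! ### Uniqueness of the weak gradient -/

lemma ae_cylMeasure_eq_of_slices {a : ℝ} {w : E n × ℝ → ℝ} (hv : MemLp v 2 (cylMeasure Ω a))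
    (hw : MemLp w 2 (cylMeasure Ω a))
    (h : ∀ᵐ y ∂(volume.restrict (Ioi (0 : ℝ))),
      (fun x => v (x, y)) =ᵐ[(gauss n).restrict Ω] fun x => w (x, y)) :
    v =ᵐ[cylMeasure Ω a] w := by
  have hd : AEStronglyMeasurable (fun p => v p - w p) (cylMeasure Ω a) := hv.1.sub hw.1
  have h1 : ∫⁻ p, ‖v p - w p‖ₑ ^ 2 ∂(cylMeasure Ω a) = 0 := by
    rw [cylMeasure_eq_prod] at hd ⊢
    rw [lintegral_slice_right hd,
      lintegral_congr_ae (g := fun _ => 0), lintegral_zero]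
    rw [← ae_halfLine_iff a] at h
    filter_upwards [h] with y hy
    rw [lintegral_congr_ae (g := fun _ => 0), lintegral_zero]
    filter_upwards [hy] with x hx
    simp [hx]
  rw [lintegral_eq_zero_iff' (hd.enorm.pow_const 2)] at h1
  filter_upwards [h1] with p hp
  simpa [sub_eq_zero] using hp

lemma ae_eq_zero_of_forall_testFun_cyl (hΩ : IsOpen Ω) {a : ℝ} {f : E n × ℝ → ℝ}
    (hf : MemLp f 2 (cylMeasure Ω a))
    (h : ∀ η, IsTestFun (cyl Ω) η → ∫ p in cyl Ω, f p * η p = 0) :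
    ∀ᵐ p ∂(cylMeasure Ω a), f p = 0 := by
  have hopen : IsOpen (cyl Ω) := hΩ.prod isOpen_Ioi
  have hloc : LocallyIntegrableOn f (cyl Ω) := by
    rw [locallyIntegrableOn_iff hopen.isLocallyClosed]
    intro K hs hK
    have : IsFiniteMeasure (volume.restrict K) := ⟨by simpa using hK.measure_lt_top⟩
    exact (memLp_restrict_compact hΩ hf hK hs).integrable (by norm_num)
  rw [ae_cylMeasure_iff hΩ.measurableSet, ae_restrict_iff' hopen.measurableSet]
  refine hopen.ae_eq_zero_of_integral_contDiff_smul_eq_zero hloc fun η h1 h2 h3 => ?_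
  have hη : IsTestFun (cyl Ω) η := ⟨h1, h2, h3⟩
  rw [← h η hη, ← setIntegral_eq_integral_of_forall_compl_eq_zero (s := cyl Ω)
    fun p hp => by rw [hη.eq_zero hp, zero_smul]]
  congr 1; ext p
  rw [smul_eq_mul, mul_comm]

/-- The energy depends only on the function, as weak derivatives are unique. -/
lemma HasEnergyGradient.energy_congr (hΩ : IsOpen Ω) {a : ℝ} {w : E n × ℝ → ℝ}
    (hv : HasEnergyGradient Ω a v G g) (hw : HasEnergyGradient Ω a w G' g')
    (h : v =ᵐ[cylMeasure Ω a] w) : energy Ω a G g = energy Ω a G' g' := by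
  have hm := hΩ.measurableSet
  have h' := (ae_cylMeasure_iff hm).1 h
  have hg : ∀ᵐ p ∂(cylMeasure Ω a), g p - g' p = 0 := by
    refine ae_eq_zero_of_forall_testFun_cyl hΩ (hv.memLp_y.sub hw.memLp_y) fun η hη => ?_
    have hd := hη.memLp_divCyl (a := a) hΩ
    have h1 := hv.weak.weak_y η hη
    have h2 := hw.weak.weak_y η hη
    rw [integral_congr_ae (h'.mono fun p hp => congrArg (· * fderiv ℝ η p (0, 1)) hp), h2] at h1
    simp_rw [sub_mul]
    rw [integral_sub (integrableOn_cyl_mul hm hd hv.memLp_y)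
      (integrableOn_cyl_mul hm hd hw.memLp_y)]
    linarith
  have hG : ∀ i : Fin n, ∀ᵐ p ∂(cylMeasure Ω a),
      ⟪G p, EuclideanSpace.single i (1 : ℝ)⟫ - ⟪G' p, EuclideanSpace.single i (1 : ℝ)⟫ = 0 := by
    intro i
    have m1 := hv.memLp_x.inner_const (𝕜 := ℝ) (EuclideanSpace.single i (1 : ℝ))
    have m2 := hw.memLp_x.inner_const (𝕜 := ℝ) (EuclideanSpace.single i (1 : ℝ))
    refine ae_eq_zero_of_forall_testFun_cyl hΩ (m1.sub m2) fun η hη => ?_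
    have hd := hη.memLp_divCyl (a := a) hΩ
    have h1 := hv.weak.weak_x η hη (EuclideanSpace.single i 1)
    have h2 := hw.weak.weak_x η hη (EuclideanSpace.single i 1)
    rw [integral_congr_ae (h'.mono fun p hp => congrArg (· * fderiv ℝ η p
      (EuclideanSpace.single i 1, 0)) hp), h2] at h1
    simp_rw [sub_mul]
    rw [integral_sub (integrableOn_cyl_mul hm hd m1) (integrableOn_cyl_mul hm hd m2)]
    linarith
  refine integral_congr_ae ?_
  filter_upwards [hg, ae_all_iff.2 hG] with p h1 h2
  have h3 : G p = G' p := by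
    ext i
    simpa [EuclideanSpace.inner_single_right, sub_eq_zero] using h2 i
  rw [h3, sub_eq_zero.1 h1]

end

end OUTrace

end

theorem mainTheorem8 (n : ℕ) (Ω : Set (OUTrace.E n)) (hΩ : IsOpen Ω) (hne : Ω.Nonempty)
    (hγ : OUTrace.gauss n Ω < 1) (s : ℝ) (hs0 : 0 < s) (hs1 : s < 1) :
    -- the Dirichlet eigenvalues and a basis of eigenfunctions exist
    (∃ (lam : ℕ → ℝ) (ψ : HilbertBasis ℕ ℝ (OUTrace.L2 Ω)),
      OUTrace.IsDirichletEigenSystem Ω lam ψ) ∧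
    -- the trace operator is well defined
    (∀ v, OUTrace.MemEnergySpace Ω (1 - 2 * s) v → ∃! u : OUTrace.L2 Ω, OUTrace.IsTrace v u) ∧
    ∀ (lam : ℕ → ℝ) (ψ : HilbertBasis ℕ ℝ (OUTrace.L2 Ω)),
      OUTrace.IsDirichletEigenSystem Ω lam ψ →
      -- the range of the trace operator
      OUTrace.traceRange Ω (1 - 2 * s) = OUTrace.fracSpace lam ψ s ∧
      -- the trace inequality
      (∀ v G g (u : OUTrace.L2 Ω), OUTrace.HasEnergyGradient Ω (1 - 2 * s) v G g →
        OUTrace.IsTrace v u →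
        ‖OUTrace.fracHalfPow lam ψ s u‖ ^ 2 ≤
          (OUTrace.traceConst s)⁻¹ * OUTrace.energy Ω (1 - 2 * s) G g) ∧
      -- the Bessel extension of a trace lies in the energy space and has that trace
      (∀ u ∈ OUTrace.fracSpace lam ψ s, ∃ w, OUTrace.MemEnergySpace Ω (1 - 2 * s) w ∧
        OUTrace.IsTrace w u ∧ OUTrace.IsBesselExt lam ψ s w u) ∧
      -- equality for the Bessel extension
      (∀ v G g (u : OUTrace.L2 Ω), OUTrace.HasEnergyGradient Ω (1 - 2 * s) v G g →
        OUTrace.IsTrace v u → OUTrace.IsBesselExt lam ψ s v u →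
        ‖OUTrace.fracHalfPow lam ψ s u‖ ^ 2 =
          (OUTrace.traceConst s)⁻¹ * OUTrace.energy Ω (1 - 2 * s) G g) := by
  refine ⟨OUTrace.exists_eigenSystem hΩ hne hγ, ?_, fun lam ψ hψ => ⟨?_, ?_, ?_, ?_⟩⟩
  · rintro v ⟨G, g, hv⟩
    obtain ⟨lam, ψ, hψ⟩ := OUTrace.exists_eigenSystem hΩ hne hγ
    obtain ⟨u, hu, -, -⟩ := hv.exists_trace hs0 hs1 hΩ hψ
    exact ⟨u, hu, fun u' hu' => OUTrace.isTrace_unique hv.memLp hu' hu⟩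
  · refine Set.Subset.antisymm ?_ fun u hu => ?_
    · rintro u ⟨v, ⟨G, g, hv⟩, hu⟩
      obtain ⟨u', hu', hmem, -⟩ := hv.exists_trace hs0 hs1 hΩ hψ
      rwa [OUTrace.isTrace_unique hv.memLp hu hu']
    · obtain ⟨v, G, g, hv, htr, -, -⟩ := OUTrace.exists_extension hs0 hs1 hΩ hψ hu
      exact ⟨v, ⟨G, g, hv⟩, htr⟩
  · intro v G g u hv hu
    obtain ⟨u', hu', hmem, hle⟩ := hv.exists_trace hs0 hs1 hΩ hψ
    rw [OUTrace.isTrace_unique hv.memLp hu hu', OUTrace.norm_sq_fracHalfPow hψ hmem]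
    exact hle
  · intro u hu
    obtain ⟨v, G, g, hv, htr, hB, -⟩ := OUTrace.exists_extension hs0 hs1 hΩ hψ hu
    exact ⟨v, ⟨G, g, hv⟩, htr, hB⟩
  · intro v G g u hv hu hB
    obtain ⟨u', hu', hmem, -⟩ := hv.exists_trace hs0 hs1 hΩ hψ
    rw [← OUTrace.isTrace_unique hv.memLp hu hu'] at hmem
    obtain ⟨w, G', g', hw, -, hB', hE⟩ := OUTrace.exists_extension hs0 hs1 hΩ hψ hmem
    -- Both functions are the Bessel extension of `u`, so they agree and have the same energy.
    have hvw : ∀ᵐ y ∂(volume.restrict (Ioi (0 : ℝ))),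
        (fun x => v (x, y)) =ᵐ[(OUTrace.gauss n).restrict Ω] fun x => w (x, y) := by
      filter_upwards [hB, hB'] with y h1 h2 using h1.trans h2.symm
    rw [hv.energy_congr hΩ hw (OUTrace.ae_cylMeasure_eq_of_slices hv.memLp hw.memLp hvw), hE,
      OUTrace.norm_sq_fracHalfPow hψ hmem,
      inv_mul_cancel_left₀ (OUTrace.traceConst_pos hs0 hs1).ne']
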